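/- Let $\mathbb F$ be the field with two elements and let $U$ be a variable of grading $-2$. An almost $\iota$-complex is a free, finitely generated, $\mathbb Z$-graded chain complex $C$ over $\mathbb F[U]$ with $U^{-1}H_*(C)\cong\mathbb F[U,U^{-1}]$ supported in even gradings, together with a grading-preserving $\mathbb F[U]$-linear map $\bar\iota\colon C\to C$ such that $\bar\iota\partial+\partial\bar\iota\in\operatorname{im}U$ and $\bar\iota^2\simeq\mathrm{id}$ mod $U$. Here $f\simeq g$ mod $U$ means that $f+g+H\partial+\partial H\in\operatorname{im}U$ for some $\mathbb F[U]$-linear map $H$ of degree $1$. Two almost $\iota$-complexes are almost locally equivalent if there are, in both directions, almost local maps between them, i.e. grading-preserving $\mathbb F[U]$-linear chain maps that commute with the maps $\bar\iota$ up to homotopy mod $U$ and induce isomorphisms on $U^{-1}H_*$. The almost local equivalence classes form an abelian group $\widehat{\mathfrak I}$ with sum given by the tensor product $(C\otimes_{\mathbb F[U]} C',\bar\iota\otimes\bar\iota')$, zero the class of $(\mathbb F[U],\mathrm{id})$, and negation given by the dual complex. For signs $a_{2l-1}\in\{+,-\}$ and nonzero integers $b_{2l}$ ($1\le l\le m$,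 $m\ge 0$), the standard complex $C(a_1,b_2,\dots,a_{2m-1},b_{2m})$ is freely generated over $\mathbb F[U]$ by $t_0,\dots,t_{2m}$, with $t_0$ in grading $0$. Write $\omega=1+\bar\iota$. For each odd $i$, $\omega t_i=t_{i-1}$ if $a_i=+$, and $\omega t_{i-1}=t_i$ if $a_i=-$. For each even $i>0$, $\partial t_i=U^{|b_i|}t_{i-1}$ if $b_i>0$, and $\partial t_{i-1}=U^{|b_i|}t_i$ if $b_i<0$. All values of $\omega$ and $\partial$ on generators not specified here are zero. The parameter sequence of a standard complex is called the standard representative of a class in $\widehat{\mathfrak I}$ if that standard complex represents the class and no standard complex with a different parameter sequence does. For $n\ge 1$ let $C(n)=C(+,-1,+,-n)$. The parameter sequence attached to $+C(n)$ is $(+,-1,+,-n)$, and the one attached to $-C(n)$ is $(-,1,-,n)$. **Theorem.** Let $m\ge 0$, let $n_1\ge n_2\ge\dots\ge n_m>1$ be integers and let $\varepsilon_1,\dots,\varepsilon_m\in\{\pm1\}$ be signs such that the sum $\varepsilon_1C(n_1)+\dots+\varepsilon_mC(n_m)$ is fully simplified, i.e. $\varepsilon_i=\varepsilon_j$ whenever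 $n_i=n_j$. Then the standard representative of the class $\varepsilon_1[C(n_1)]+\dots+\varepsilon_m[C(n_m)]\in\widehat{\mathfrak I}$ is the concatenation, in this order, of the parameter sequences attached to $\varepsilon_1C(n_1),\dots,\varepsilon_mC(n_m)$. Moreover, the classes $[C(n)]$ with $n>1$ are linearly independent over $\mathbb Z$ in $\widehat{\mathfrak I}$; in particular the subgroup they generate is isomorphic to $\mathbb Z^\infty=\bigoplus_{k\in\mathbb N}\mathbb Z$. -/

import Mathlib

open Polynomial Matrix
open scoped LaurentPolynomial Kronecker

noncomputable section

/-- The ring `𝔽[U]` over the field `𝔽` of two elements; the variable `U` is `Polynomial.X`. -/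
abbrev FU : Type := Polynomial (ZMod 2)

/-- `M : Matrix J I FU` represents the `𝔽[U]`-linear map sending the `i`-th generator to
`∑ j, M j i • (j-th generator)`.  When generators have gradings `gr`, `gr'` and `U` has grading
`-2`, this map is homogeneous of degree `k` if `U ^ n` times generator `j` can occur in the image of
generator `i` only when the gradings satisfy `gr' j - 2 n = gr i + k`. -/
def IsHomogeneousMap {I J : Type} (gr : I → ℤ) (gr' : J → ℤ) (k : ℤ) (M : Matrix J I FU) : Prop :=
  ∀ j i n, (M j i).coeff n ≠ 0 → gr' j - 2 * (n : ℤ) = gr i + k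

/-- A free, finitely generated, `ℤ`-graded chain complex over `𝔽[U]`, presented by a finite
homogeneous basis `gen` with gradings `gr`.  The underlying module is `gen → FU`; the differential
is given by its matrix, lowers the grading by one and squares to zero. -/
structure GradedComplex where
  gen : Type
  [fin : Fintype gen]
  [dec : DecidableEq gen]
  gr : gen → ℤ
  d : Matrix gen gen FU
  d_hom : IsHomogeneousMap gr gr (-1) d
  d_sq : d * d = 0

attribute [instance] GradedComplex.fin GradedComplex.dec

namespace GradedComplex

/-- The cycles of the complex. -/
abbrev cycles (C : GradedComplex) : Submodule FU (C.gen → FU) := LinearMap.ker C.d.mulVecLin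

/-- The boundaries of the complex. -/
abbrev boundaries (C : GradedComplex) : Submodule FU (C.gen → FU) :=
  LinearMap.range C.d.mulVecLin

/-- The homology `H_*(C)`, an `𝔽[U]`-module. -/
abbrev Homology (C : GradedComplex) : Type := C.cycles ⧸ C.boundaries.submoduleOf C.cycles

/-- The localized homology `U⁻¹ H_*(C)`. -/
abbrev LocHomology (C : GradedComplex) : Type :=
  LocalizedModule (Submonoid.powers (X : FU)) C.Homology

/-- The class in `U⁻¹ H_*(C)` of a cycle. -/
def locClass (C : GradedComplex) (z : C.cycles) : C.LocHomology :=
  LocalizedModule.mk (Submodule.Quotient.mk z) 1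

/-- `U⁻¹ H_*(C) ≅ 𝔽[U, U⁻¹]`, supported in even gradings.  As `U` has even degree, the odd part of
the complex is spanned over `𝔽[U]` by the generators of odd grading, and the second clause says that
the odd part of the localized homology vanishes. -/
def HasEvenTower (C : GradedComplex) : Prop :=
  Nonempty (C.LocHomology ≃ₗ[FU] (ZMod 2)[T;T⁻¹]) ∧
    ∀ z : C.cycles, (∀ i, Even (C.gr i) → z.1 i = 0) → C.locClass z = 0

/-- Grading-preserving maps `f` and `g` are homotopic mod `U` if `f + g + H ∂ + ∂ H` has image in
`im U` for some `𝔽[U]`-linear `H` of degree one. -/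
def HomotopicModU (C D : GradedComplex) (f g : Matrix D.gen C.gen FU) : Prop :=
  ∃ H E : Matrix D.gen C.gen FU, IsHomogeneousMap C.gr D.gr 1 H ∧
    f + g + H * C.d + D.d * H = (X : FU) • E

/-- The restriction of a chain map to cycles. -/
def cyclesMap {C D : GradedComplex} (f : Matrix D.gen C.gen FU) (hf : f * C.d = D.d * f) :
    C.cycles →ₗ[FU] D.cycles :=
  f.mulVecLin.restrict (p := C.cycles) (q := D.cycles) (by
    intro z hz
    simp only [LinearMap.mem_ker, mulVecLin_apply] at hz ⊢
    rw [mulVec_mulVec, ← hf, ← mulVec_mulVec, hz, mulVec_zero])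

/-- The map induced on homology by a chain map. -/
def homologyMap {C D : GradedComplex} (f : Matrix D.gen C.gen FU) (hf : f * C.d = D.d * f) :
    C.Homology →ₗ[FU] D.Homology :=
  Submodule.mapQ _ _ (cyclesMap f hf) (by
    rintro ⟨z, hz⟩ hzb
    obtain ⟨y, hy⟩ := hzb
    simp only [mulVecLin_apply, Submodule.subtype_apply] at hy
    refine ⟨f *ᵥ y, ?_⟩
    simp only [mulVecLin_apply, mulVec_mulVec, ← hf]
    rw [← mulVec_mulVec, hy]
    rfl)

/-- The map induced on `U⁻¹ H_*` by a chain map. -/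
def locHomologyMap {C D : GradedComplex} (f : Matrix D.gen C.gen FU) (hf : f * C.d = D.d * f) :
    C.LocHomology → D.LocHomology :=
  LocalizedModule.map (Submonoid.powers (X : FU)) (homologyMap f hf)

end GradedComplex

/-- An almost `ι`-complex. -/
structure AlmostIotaComplex extends GradedComplex where
  tower : toGradedComplex.HasEvenTower
  iota : Matrix gen gen FU
  iota_hom : IsHomogeneousMap gr gr 0 iota
  iota_comm : ∃ E : Matrix gen gen FU, iota * d + d * iota = (X : FU) • E
  iota_sq : toGradedComplex.HomotopicModU toGradedComplex (iota * iota) 1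

/-- An almost local map: a grading-preserving `𝔽[U]`-linear chain map which commutes with the almost
involutions up to homotopy mod `U` and induces an isomorphism on `U⁻¹ H_*`. -/
structure IsAlmostLocalMap (C D : AlmostIotaComplex) (f : Matrix D.gen C.gen FU) : Prop where
  hom : IsHomogeneousMap C.gr D.gr 0 f
  chain : f * C.d = D.d * f
  iota : C.toGradedComplex.HomotopicModU D.toGradedComplex (f * C.iota) (D.iota * f)
  loc : Function.Bijective (GradedComplex.locHomologyMap f chain)

/-- Almost local equivalence: almost local maps exist in both directions. -/
def AlmostLocallyEquivalent (C D : AlmostIotaComplex) : Prop :=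
  (∃ f, IsAlmostLocalMap C D f) ∧ (∃ g, IsAlmostLocalMap D C g)

/-! ### Homogeneous maps -/

section Homogeneous

variable {I J K I' J' : Type} {g : I → ℤ} {g' : J → ℤ} {g'' : K → ℤ} {h : I' → ℤ} {h' : J' → ℤ}

theorem IsHomogeneousMap.zero {k : ℤ} : IsHomogeneousMap g g' k (0 : Matrix J I FU) := by
  intro j i n hn
  simp at hn

theorem IsHomogeneousMap.one [DecidableEq I] : IsHomogeneousMap g g 0 (1 : Matrix I I FU) := by
  intro j i n hn
  by_cases hji : j = i
  · subst hji
    simp only [one_apply_eq, coeff_one] at hn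
    have : n = 0 := by
      by_contra hne
      simp [hne] at hn
    simp [this]
  · simp [one_apply_ne hji] at hn

theorem IsHomogeneousMap.add {k : ℤ} {M N : Matrix J I FU} (hM : IsHomogeneousMap g g' k M)
    (hN : IsHomogeneousMap g g' k N) : IsHomogeneousMap g g' k (M + N) := by
  intro j i n hn
  by_cases h1 : (M j i).coeff n = 0
  · refine hN j i n fun h2 => hn ?_
    simp [h1, h2]
  · exact hM j i n h1

theorem IsHomogeneousMap.mul [Fintype J] {k l : ℤ} {M : Matrix K J FU} {N : Matrix J I FU}
    (hM : IsHomogeneousMap g' g'' k M) (hN : IsHomogeneousMap g g' l N) :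
    IsHomogeneousMap g g'' (k + l) (M * N) := by
  intro a i n hn
  rw [mul_apply, finsetSum_coeff] at hn
  obtain ⟨j, -, hj⟩ := Finset.exists_ne_zero_of_sum_ne_zero hn
  rw [coeff_mul] at hj
  obtain ⟨⟨p, q⟩, hpq, hne⟩ := Finset.exists_ne_zero_of_sum_ne_zero hj
  rw [Finset.HasAntidiagonal.mem_antidiagonal] at hpq
  have h1 := hM a j p (left_ne_zero_of_mul hne)
  have h2 := hN j i q (right_ne_zero_of_mul hne)
  dsimp only at hpq
  have : (n : ℤ) = p + q := by rw [← hpq]; push_cast; ring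
  rw [this]
  linarith

theorem IsHomogeneousMap.kronecker {k l : ℤ} {M : Matrix J I FU} {N : Matrix J' I' FU}
    (hM : IsHomogeneousMap g g' k M) (hN : IsHomogeneousMap h h' l N) :
    IsHomogeneousMap (fun x : I × I' => g x.1 + h x.2) (fun x : J × J' => g' x.1 + h' x.2) (k + l)
      (M ⊗ₖ N) := by
  rintro ⟨a, a'⟩ ⟨i, i'⟩ n hn
  rw [kronecker_apply, coeff_mul] at hn
  obtain ⟨⟨p, q⟩, hpq, hne⟩ := Finset.exists_ne_zero_of_sum_ne_zero hn
  rw [Finset.HasAntidiagonal.mem_antidiagonal] at hpq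
  have h1 := hM a i p (left_ne_zero_of_mul hne)
  have h2 := hN a' i' q (right_ne_zero_of_mul hne)
  dsimp only at hpq ⊢
  have : (n : ℤ) = p + q := by rw [← hpq]; push_cast; ring
  rw [this]
  linarith

theorem IsHomogeneousMap.transpose {k : ℤ} {M : Matrix J I FU} (hM : IsHomogeneousMap g g' k M) :
    IsHomogeneousMap (fun j => -g' j) (fun i => -g i) k Mᵀ := by
  intro i j n hn
  have := hM j i n hn
  linarith

theorem IsHomogeneousMap.congr {k l : ℤ} (hkl : k = l) {M : Matrix J I FU}
    (hM : IsHomogeneousMap g g' k M) : IsHomogeneousMap g g' l M := hkl ▸ hM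

end Homogeneous

/-! ### Splitting off the tower -/

namespace GradedComplex

theorem locClass_eq_zero_iff {C : GradedComplex} (z : C.cycles) :
    C.locClass z = 0 ↔ ∃ (k : ℕ) (y : C.gen → FU), (X : FU) ^ k • z.1 = C.d *ᵥ y := by
  unfold locClass
  rw [← LocalizedModule.zero_mk 1, LocalizedModule.mk_eq]
  constructor
  · rintro ⟨⟨_, k, rfl⟩, h⟩
    simp only [one_smul, smul_zero] at h
    rw [← Submodule.Quotient.mk_smul, Submodule.Quotient.mk_eq_zero] at h
    obtain ⟨y, hy⟩ := h
    exact ⟨k, y, hy.symm⟩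
  · rintro ⟨k, y, h⟩
    refine ⟨⟨X ^ k, k, rfl⟩, ?_⟩
    simp only [one_smul, smul_zero]
    rw [← Submodule.Quotient.mk_smul, Submodule.Quotient.mk_eq_zero]
    exact ⟨y, h.symm⟩

/-- A splitting of the tower after multiplication by a power of `U`: maps `s : 𝔽[U] → C` and
`p : C → 𝔽[U]` supported in even gradings, with `p s = U ^ k` and `s p ≃ U ^ k`. -/
structure TowerSplitting (C : GradedComplex) (κ : Type) [Fintype κ] [DecidableEq κ] where
  s : Matrix C.gen κ FU
  p : Matrix κ C.gen FU
  h : Matrix C.gen C.gen FU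
  k : ℕ
  ds : C.d * s = 0
  pd : p * C.d = 0
  ps : p * s = (X : FU) ^ k • (1 : Matrix κ κ FU)
  sp : s * p + (C.d * h + h * C.d) = (X : FU) ^ k • (1 : Matrix C.gen C.gen FU)
  s_even : ∀ i j, ¬ Even (C.gr i) → s i j = 0
  p_even : ∀ j i, ¬ Even (C.gr i) → p j i = 0

theorem d_entry_eq_zero (C : GradedComplex) {i j : C.gen} (hij : Even (C.gr i) ↔ Even (C.gr j)) :
    C.d i j = 0 := by
  ext n
  by_contra hne
  have := C.d_hom i j n (by simpa using hne)
  have h2 : C.gr i = C.gr j + 2 * n - 1 := by linarith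
  rw [h2] at hij
  have : Even (C.gr j + 2 * (n : ℤ) - 1) ↔ ¬ Even (C.gr j) := by
    constructor
    · rintro ⟨a, ha⟩ ⟨b, hb⟩
      omega
    · intro h
      rw [Int.not_even_iff_odd] at h
      obtain ⟨b, hb⟩ := h
      exact ⟨b + n, by omega⟩
  tauto

/-- The projection to the part of even grading. -/
def evenProj (C : GradedComplex) : Matrix C.gen C.gen FU :=
  diagonal fun i => if Even (C.gr i) then 1 else 0

/-- The projection to the part of odd grading. -/
def oddProj (C : GradedComplex) : Matrix C.gen C.gen FU :=
  diagonal fun i => if Even (C.gr i) then 0 else 1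

theorem evenProj_add_oddProj (C : GradedComplex) : C.evenProj + C.oddProj = 1 := by
  rw [evenProj, oddProj, diagonal_add, ← diagonal_one]
  congr 1
  ext1 i
  split_ifs <;> simp

theorem evenProj_mul_self (C : GradedComplex) : C.evenProj * C.evenProj = C.evenProj := by
  rw [evenProj, diagonal_mul_diagonal]
  congr 1
  ext1 i
  split_ifs <;> simp

theorem oddProj_mul_self (C : GradedComplex) : C.oddProj * C.oddProj = C.oddProj := by
  rw [oddProj, diagonal_mul_diagonal]
  congr 1
  ext1 i
  split_ifs <;> simp

theorem d_mul_evenProj (C : GradedComplex) : C.d * C.evenProj = C.oddProj * C.d := by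
  ext1 i j
  rw [evenProj, oddProj, mul_diagonal, diagonal_mul]
  by_cases hij : Even (C.gr i) ↔ Even (C.gr j)
  · simp [C.d_entry_eq_zero hij]
  · by_cases hi : Even (C.gr i) <;> by_cases hj : Even (C.gr j) <;> simp_all

theorem d_mul_oddProj (C : GradedComplex) : C.d * C.oddProj = C.evenProj * C.d := by
  ext1 i j
  rw [evenProj, oddProj, mul_diagonal, diagonal_mul]
  by_cases hij : Even (C.gr i) ↔ Even (C.gr j)
  · simp [C.d_entry_eq_zero hij]
  · by_cases hi : Even (C.gr i) <;> by_cases hj : Even (C.gr j) <;> simp_all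

/-- A chain-level form of the tower condition: a generating cycle, unique up to torsion. -/
theorem HasEvenTower.exists_cycle {C : GradedComplex} (hC : C.HasEvenTower) :
    ∃ s : C.cycles, (∀ i, ¬ Even (C.gr i) → s.1 i = 0) ∧
      (∀ (f : FU) (y : C.gen → FU), f • s.1 = C.d *ᵥ y → f = 0) ∧
      ∀ w : C.cycles, ∃ (k : ℕ) (f : FU) (y : C.gen → FU),
        (X : FU) ^ k • w.1 = f • s.1 + C.d *ᵥ y := by
  obtain ⟨⟨e⟩, hodd⟩ := hC
  -- a cycle whose class is a power of `U` times the generator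
  obtain ⟨z, a, hz⟩ : ∃ (z : C.cycles) (a : ℕ), e (C.locClass z) = LaurentPolynomial.T (a : ℤ) := by
    obtain ⟨q, ⟨_, a, rfl⟩, hq⟩ : ∃ q t, e.symm 1 = LocalizedModule.mk q t := by
      obtain ⟨⟨q, t⟩, h⟩ := Quot.exists_rep (e.symm 1)
      exact ⟨q, t, h.symm⟩
    obtain ⟨z, rfl⟩ := Submodule.Quotient.mk_surjective _ q
    refine ⟨z, a, ?_⟩
    have : C.locClass z = (X : FU) ^ a • e.symm 1 := by
      rw [hq, LocalizedModule.smul'_mk, locClass, LocalizedModule.mk_eq]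
      refine ⟨1, ?_⟩
      simp only [one_smul]
      rfl
    rw [this, map_smul, LinearEquiv.apply_symm_apply, Algebra.smul_def,
      LaurentPolynomial.algebraMap_X_pow, mul_one]
  -- its even part
  have hsplit : z.1 = C.evenProj *ᵥ z.1 + C.oddProj *ᵥ z.1 := by
    rw [← add_mulVec, evenProj_add_oddProj, one_mulVec]
  have hz0 : C.d *ᵥ z.1 = 0 := z.2
  have hs0 : C.d *ᵥ (C.evenProj *ᵥ z.1) = 0 := by
    rw [mulVec_mulVec, d_mul_evenProj, ← mulVec_mulVec, hz0, mulVec_zero]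
  have ho0 : C.d *ᵥ (C.oddProj *ᵥ z.1) = 0 := by
    rw [mulVec_mulVec, d_mul_oddProj, ← mulVec_mulVec, hz0, mulVec_zero]
  let s : C.cycles := ⟨C.evenProj *ᵥ z.1, hs0⟩
  let o : C.cycles := ⟨C.oddProj *ᵥ z.1, ho0⟩
  have hadd : ∀ u v : C.cycles, C.locClass (u + v) = C.locClass u + C.locClass v := by
    intro u v
    simp only [locClass, Submodule.Quotient.mk_add]
    rw [LocalizedModule.mk_add_mk, LocalizedModule.mk_eq]
    exact ⟨1, by simp⟩
  have hsmul : ∀ (f : FU) (u : C.cycles), C.locClass (f • u) = f • C.locClass u := by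
    intro f u
    simp only [locClass, Submodule.Quotient.mk_smul, LocalizedModule.smul'_mk]
  have hos : C.locClass o = 0 := by
    refine hodd o fun i hi => ?_
    simp [o, oddProj, mulVec_diagonal, hi]
  have hs : e (C.locClass s) = LaurentPolynomial.T (a : ℤ) := by
    rw [← hz]
    congr 1
    have : z = s + o := Subtype.ext hsplit
    rw [this, hadd, hos, add_zero]
  refine ⟨s, ?_, ?_, ?_⟩
  · intro i hi
    simp [s, evenProj, mulVec_diagonal, hi]
  · intro f y hfy
    have h0 : C.locClass (f • s) = 0 := by
      rw [locClass_eq_zero_iff]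
      exact ⟨0, y, by simpa using hfy⟩
    rw [hsmul] at h0
    have h1 := congrArg e h0
    rw [map_smul, hs, map_zero, Algebra.smul_def, LaurentPolynomial.algebraMap_eq_toLaurent] at h1
    have h2 := (LaurentPolynomial.isUnit_T (R := ZMod 2) (a : ℤ)).mul_left_eq_zero.1 h1
    exact Polynomial.toLaurent_injective (by simpa using h2)
  · intro w
    obtain ⟨n, f, hf⟩ := (e (C.locClass w)).exists_T_pow
    have key : C.locClass ((X : FU) ^ (n + a) • w + (-f) • s) = 0 := by
      apply e.injective
      rw [hadd, hsmul, hsmul, map_add, map_smul, map_smul, hs, map_zero, Algebra.smul_def,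
        Algebra.smul_def, LaurentPolynomial.algebraMap_X_pow,
        LaurentPolynomial.algebraMap_eq_toLaurent, map_neg, hf]
      have : (LaurentPolynomial.T ((n + a : ℕ) : ℤ) : (ZMod 2)[T;T⁻¹])
          = LaurentPolynomial.T (n : ℤ) * LaurentPolynomial.T (a : ℤ) := by
        rw [← LaurentPolynomial.T_add]; push_cast; rfl
      rw [this]
      ring
    obtain ⟨k, y, hy⟩ := (locClass_eq_zero_iff _).1 key
    refine ⟨k + (n + a), X ^ k * f, y, ?_⟩
    have hy' : (X : FU) ^ k • ((X : FU) ^ (n + a) • w.1 + (-f) • s.1) = C.d *ᵥ y := hy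
    rw [← hy', pow_add]
    module

end GradedComplex

namespace GradedComplex

theorem exists_linear_splitting {C : GradedComplex} (s : C.cycles)
    (hs : ∀ (f : FU) (y : C.gen → FU), f • s.1 = C.d *ᵥ y → f = 0)
    (hgen : ∀ w : C.cycles, ∃ (k : ℕ) (f : FU) (y : C.gen → FU),
        (X : FU) ^ k • w.1 = f • s.1 + C.d *ᵥ y) :
    ∃ (k : ℕ) (p : (C.gen → FU) →ₗ[FU] FU) (h : (C.gen → FU) →ₗ[FU] (C.gen → FU)),
      p s.1 = X ^ k ∧ (∀ c, p (C.d *ᵥ c) = 0) ∧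
      ∀ c, p c • s.1 + (C.d *ᵥ h c + h (C.d *ᵥ c)) = (X : FU) ^ k • c := by
  classical
  let b := Module.Free.chooseBasis FU C.cycles
  choose k f y hk using fun i => hgen (b i)
  let K := ∑ i, k i
  let p₀ : C.cycles →ₗ[FU] FU := b.constr FU fun i => X ^ (K - k i) * f i
  let η : C.cycles →ₗ[FU] (C.gen → FU) := b.constr FU fun i => (X : FU) ^ (K - k i) • y i
  have hη : ∀ w : C.cycles, (X : FU) ^ K • w.1 = p₀ w • s.1 + C.d *ᵥ η w := by
    have : (X : FU) ^ K • C.cycles.subtype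
        = p₀.smulRight s.1 + C.d.mulVecLin ∘ₗ η := by
      refine b.ext fun i => ?_
      have hle : k i ≤ K := Finset.single_le_sum (fun _ _ => Nat.zero_le _) (Finset.mem_univ i)
      simp only [LinearMap.smul_apply, Submodule.subtype_apply, LinearMap.add_apply,
        LinearMap.smulRight_apply, LinearMap.comp_apply, mulVecLin_apply, p₀, η,
        Module.Basis.constr_basis, mulVec_smul]
      rw [← Nat.sub_add_cancel hle, pow_add, mul_smul, hk, Nat.sub_add_cancel hle]
      module
    exact fun w => LinearMap.congr_fun this w
  obtain ⟨σ, hσ⟩ := Module.projective_lifting_property C.d.mulVecLin.rangeRestrict LinearMap.id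
    C.d.mulVecLin.surjective_rangeRestrict
  have hσ' : ∀ x : C.boundaries, C.d *ᵥ σ x = x.1 := fun x =>
    congrArg Subtype.val (LinearMap.congr_fun hσ x)
  let δ := C.d.mulVecLin.rangeRestrict
  have hδ : ∀ c, (δ c).1 = C.d *ᵥ c := fun c => rfl
  let r : (C.gen → FU) →ₗ[FU] C.cycles :=
    (LinearMap.id - σ ∘ₗ δ).codRestrict C.cycles (by
      intro c
      simp only [LinearMap.mem_ker, mulVecLin_apply, LinearMap.sub_apply, LinearMap.id_apply,
        LinearMap.comp_apply, mulVec_sub, hσ', hδ, sub_self])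
  have hr : ∀ c, (r c).1 = c - σ (δ c) := fun c => rfl
  have hδ0 : ∀ z : C.cycles, δ z.1 = 0 := fun z => Subtype.ext z.2
  have hrz : ∀ z : C.cycles, r z.1 = z := fun z => Subtype.ext (by
    rw [hr, hδ0, map_zero, sub_zero])
  have hdd : ∀ c, C.d *ᵥ (C.d *ᵥ c) = 0 := fun c => by
    rw [mulVec_mulVec, C.d_sq, zero_mulVec]
  have hp0 : ∀ c (hc : C.d *ᵥ (C.d *ᵥ c) = 0), p₀ ⟨C.d *ᵥ c, hc⟩ = 0 := by
    intro c hc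
    refine hs _ (((X : FU) ^ K • c) - η ⟨C.d *ᵥ c, hc⟩) ?_
    rw [mulVec_sub, mulVec_smul, eq_sub_iff_add_eq]
    exact (hη ⟨C.d *ᵥ c, hc⟩).symm
  refine ⟨K, p₀ ∘ₗ r, σ ∘ₗ δ ∘ₗ η ∘ₗ r, ?_, ?_, ?_⟩
  · rw [LinearMap.comp_apply, hrz]
    have := hη s
    have h2 := hs (X ^ K - p₀ s) (η s) (by rw [sub_smul, this]; abel)
    exact (sub_eq_zero.1 h2).symm
  · intro c
    rw [LinearMap.comp_apply, hrz ⟨C.d *ᵥ c, hdd c⟩]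
    exact hp0 c _
  · intro c
    simp only [LinearMap.comp_apply]
    rw [hrz ⟨C.d *ᵥ c, hdd c⟩, hσ', hδ]
    have h1 : δ (η ⟨C.d *ᵥ c, hdd c⟩) = (X : FU) ^ K • δ c := by
      apply Subtype.ext
      have := hη ⟨C.d *ᵥ c, hdd c⟩
      rw [hp0 c, zero_smul, zero_add] at this
      exact this.symm
    rw [h1, map_smul, ← add_assoc, ← hη, hr]
    module

theorem HasEvenTower.exists_splitting {C : GradedComplex} (hC : C.HasEvenTower) :
    Nonempty (TowerSplitting C Unit) := by
  obtain ⟨s, hse, hs, hgen⟩ := hC.exists_cycle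
  obtain ⟨k, p, h, hps, hpd, hsp⟩ := exists_linear_splitting s hs hgen
  let S : Matrix C.gen Unit FU := replicateCol Unit s.1
  let P : Matrix Unit C.gen FU := of fun _ i => p (Pi.single i 1)
  let H : Matrix C.gen C.gen FU := LinearMap.toMatrix' h
  have hp : ∀ v, p v = P () ⬝ᵥ v := by
    intro v
    conv_lhs => rw [← Finset.univ_sum_single v]
    simp only [map_sum, dotProduct]
    refine Finset.sum_congr rfl fun i _ => ?_
    have : (Pi.single i (v i) : C.gen → FU) = v i • Pi.single i 1 := by
      rw [← Pi.single_smul, smul_eq_mul, mul_one]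
    rw [this, map_smul, smul_eq_mul, mul_comm]
    rfl
  have hH : ∀ v, h v = H *ᵥ v := fun v => (LinearMap.toMatrix'_mulVec h v).symm
  have hds : C.d * S = 0 := by
    ext1 i j
    exact congrFun s.2 i
  have hpd' : P * C.d = 0 := by
    ext1 i j
    have := hpd (Pi.single j 1)
    rw [hp, mulVec_single_one] at this
    exact this
  have hps' : P * S = (X : FU) ^ k • (1 : Matrix Unit Unit FU) := by
    ext1 i j
    rw [hp] at hps
    rw [Matrix.smul_apply, Subsingleton.elim i j, one_apply_eq, smul_eq_mul, mul_one, ← hps]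
    rfl
  have hsp' : S * P + (C.d * H + H * C.d) = (X : FU) ^ k • (1 : Matrix C.gen C.gen FU) := by
    refine ext_of_mulVec_single fun j => ?_
    have := hsp (Pi.single j 1)
    rw [hp, hH, hH] at this
    simp only [add_mulVec, ← mulVec_mulVec, smul_mulVec, one_mulVec]
    rw [← this]
    congr 1
    ext1 i
    simp [S, mulVec, dotProduct, mul_comm]
  have hPQ := C.evenProj_add_oddProj
  have hes : C.evenProj * S = S := by
    ext1 i j
    by_cases hi : Even (C.gr i)
    · simp [evenProj, diagonal_mul, hi]
    · simp [evenProj, diagonal_mul, hi, S, hse i hi]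
  have hos : C.oddProj * S = 0 := by
    have : (C.evenProj + C.oddProj) * S = S := by rw [hPQ, Matrix.one_mul]
    rw [Matrix.add_mul, hes] at this
    simpa using this
  refine ⟨⟨S, P * C.evenProj, C.evenProj * H * C.oddProj + C.oddProj * H * C.evenProj, k, hds, ?_,
    ?_, ?_, ?_, ?_⟩⟩
  · rw [Matrix.mul_assoc, ← d_mul_oddProj, ← Matrix.mul_assoc, hpd', Matrix.zero_mul]
  · rw [Matrix.mul_assoc, hes, hps']
  · have e1 : C.evenProj * (S * P + (C.d * H + H * C.d)) * C.evenProj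
        = (X : FU) ^ k • C.evenProj := by
      rw [hsp', Matrix.mul_smul, Matrix.smul_mul, Matrix.mul_one, evenProj_mul_self]
    have e2 : C.oddProj * (S * P + (C.d * H + H * C.d)) * C.oddProj
        = (X : FU) ^ k • C.oddProj := by
      rw [hsp', Matrix.mul_smul, Matrix.smul_mul, Matrix.mul_one, oddProj_mul_self]
    have e3 : (X : FU) ^ k • (1 : Matrix C.gen C.gen FU)
        = (X : FU) ^ k • C.evenProj + (X : FU) ^ k • C.oddProj := by
      rw [← smul_add, hPQ]
    rw [e3, ← e1, ← e2]
    have a1 : C.evenProj * (S * P) = S * P := by rw [← Matrix.mul_assoc, hes]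
    have a2 : C.oddProj * (S * P) = 0 := by rw [← Matrix.mul_assoc, hos, Matrix.zero_mul]
    simp only [Matrix.mul_add, Matrix.add_mul, a1, a2, zero_add]
    simp only [← Matrix.mul_assoc, d_mul_evenProj, d_mul_oddProj]
    simp only [Matrix.mul_assoc, d_mul_evenProj, d_mul_oddProj]
    abel
  · intro i j hi
    exact hse i hi
  · intro j i hi
    simp [evenProj, mul_diagonal, hi]

theorem TowerSplitting.mulVec_sp {C : GradedComplex} {κ : Type} [Fintype κ] [DecidableEq κ] [Unique κ]
    (t : TowerSplitting C κ) (c : C.gen → FU) :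
    t.s *ᵥ (t.p *ᵥ c) + (C.d *ᵥ (t.h *ᵥ c) + t.h *ᵥ (C.d *ᵥ c)) = (X : FU) ^ t.k • c := by
  have := congrArg (fun M => M *ᵥ c) t.sp
  simpa [add_mulVec, ← mulVec_mulVec, smul_mulVec] using this

theorem X_pow_smul_cancel {I : Type} {k : ℕ} {v : I → FU} (h : (X : FU) ^ k • v = 0) : v = 0 := by
  rcases smul_eq_zero.1 h with h | h
  · exact absurd h (pow_ne_zero _ X_ne_zero)
  · exact h

theorem TowerSplitting.torsion {C : GradedComplex} {κ : Type} [Fintype κ] [DecidableEq κ] [Unique κ]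
    (t : TowerSplitting C κ) {c y : C.gen → FU} {k : ℕ} (h : (X : FU) ^ k • c = C.d *ᵥ y) :
    t.p *ᵥ c = 0 := by
  apply X_pow_smul_cancel (k := k)
  rw [← mulVec_smul, h, mulVec_mulVec, t.pd, zero_mulVec]

theorem TowerSplitting.hasEvenTower {C : GradedComplex} {κ : Type} [Fintype κ] [DecidableEq κ] [Unique κ]
    (t : TowerSplitting C κ) : C.HasEvenTower := by
  constructor
  · let q : (C.gen → FU) →ₗ[FU] (ZMod 2)[T;T⁻¹] :=
      Algebra.linearMap FU (ZMod 2)[T;T⁻¹] ∘ₗ LinearMap.proj default ∘ₗ t.p.mulVecLin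
    have hq : ∀ c, q c = toLaurent ((t.p *ᵥ c) default) := fun c => rfl
    let φ : C.Homology →ₗ[FU] (ZMod 2)[T;T⁻¹] :=
      (C.boundaries.submoduleOf C.cycles).liftQ (q ∘ₗ C.cycles.subtype) (by
        rintro z ⟨y, hy⟩
        rw [LinearMap.mem_ker, LinearMap.comp_apply, hq, ← hy, mulVecLin_apply, mulVec_mulVec, t.pd]
        simp)
    have hφ : ∀ z : C.cycles, φ (Submodule.Quotient.mk z) = toLaurent ((t.p *ᵥ z.1) default) :=
      fun z => rfl
    have : IsLocalizedModule (Submonoid.powers (X : FU)) φ := by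
      refine ⟨?_, ?_, ?_⟩
      · rintro ⟨_, n, rfl⟩
        rw [Module.End.isUnit_iff]
        have hu : IsUnit (algebraMap FU (ZMod 2)[T;T⁻¹] (X ^ n)) := by
          rw [LaurentPolynomial.algebraMap_X_pow]
          exact LaurentPolynomial.isUnit_T _
        have he : ∀ y : (ZMod 2)[T;T⁻¹],
            (algebraMap FU (Module.End FU (ZMod 2)[T;T⁻¹]) (X ^ n)) y
              = algebraMap FU (ZMod 2)[T;T⁻¹] (X ^ n) * y := fun y => by
          rw [Module.algebraMap_end_apply, Algebra.smul_def]
        constructor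
        · intro x y hxy
          have hxy' : algebraMap FU (ZMod 2)[T;T⁻¹] (X ^ n) * x
            = algebraMap FU (ZMod 2)[T;T⁻¹] (X ^ n) * y := by rw [← he, ← he]; exact hxy
          exact hu.mul_left_cancel hxy'
        · intro y
          obtain ⟨u, hu⟩ := hu
          refine ⟨↑u⁻¹ * y, ?_⟩
          have := he (↑u⁻¹ * y)
          rw [← hu, Units.mul_inv_cancel_left] at this
          exact this
      · intro y
        obtain ⟨n, f, hf⟩ := y.exists_T_pow
        have hz : C.d *ᵥ (t.s *ᵥ fun _ => f) = 0 := by rw [mulVec_mulVec, t.ds, zero_mulVec]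
        refine ⟨⟨Submodule.Quotient.mk ⟨t.s *ᵥ fun _ => f, hz⟩, ⟨X ^ (n + t.k), _, rfl⟩⟩, ?_⟩
        rw [hφ]
        dsimp only
        rw [mulVec_mulVec, t.ps, smul_mulVec, one_mulVec]
        change (X ^ (n + t.k) : FU) • y = _
        rw [Algebra.smul_def]
        simp only [Pi.smul_apply, smul_eq_mul, map_mul, LaurentPolynomial.algebraMap_eq_toLaurent,
          hf, pow_add, toLaurent_X_pow]
        ring
      · intro x₁ x₂ hx
        obtain ⟨z₁, rfl⟩ := Submodule.Quotient.mk_surjective _ x₁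
        obtain ⟨z₂, rfl⟩ := Submodule.Quotient.mk_surjective _ x₂
        rw [hφ, hφ] at hx
        have hx' := Polynomial.toLaurent_injective hx
        have h0 : t.p *ᵥ (z₁ - z₂ : C.cycles).1 = 0 := by
          ext1 i
          rw [Unique.eq_default i]
          have : (z₁ - z₂ : C.cycles).1 = z₁.1 - z₂.1 := rfl
          rw [this, mulVec_sub, Pi.sub_apply, hx', sub_self]
          rfl
        have h1 := t.mulVec_sp (z₁ - z₂ : C.cycles).1
        have hc : C.d *ᵥ (z₁ - z₂ : C.cycles).1 = 0 := (z₁ - z₂ : C.cycles).2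
        rw [h0, hc, mulVec_zero, mulVec_zero, zero_add, add_zero] at h1
        refine ⟨⟨X ^ t.k, _, rfl⟩, ?_⟩
        change (X : FU) ^ t.k • (Submodule.Quotient.mk z₁ : C.Homology)
          = (X : FU) ^ t.k • Submodule.Quotient.mk z₂
        rw [← Submodule.Quotient.mk_smul, ← Submodule.Quotient.mk_smul, Submodule.Quotient.eq,
          ← smul_sub]
        exact ⟨t.h *ᵥ (z₁ - z₂ : C.cycles).1, h1⟩
    exact ⟨IsLocalizedModule.iso (Submonoid.powers (X : FU)) φ⟩
  · intro z hz
    have h0 : t.p *ᵥ z.1 = 0 := by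
      ext1 j
      simp only [mulVec, dotProduct, Pi.zero_apply]
      refine Finset.sum_eq_zero fun i _ => ?_
      by_cases hi : Even (C.gr i)
      · rw [hz i hi, mul_zero]
      · rw [t.p_even j i hi, zero_mul]
    have h1 := t.mulVec_sp z.1
    have hc : C.d *ᵥ z.1 = 0 := z.2
    rw [h0, hc, mulVec_zero, mulVec_zero, zero_add, add_zero] at h1
    exact (locClass_eq_zero_iff z).2 ⟨t.k, _, h1.symm⟩

/-- Chain-level criterion for a chain map to induce an isomorphism on `U⁻¹ H_*`. -/
theorem bijective_locHomologyMap_iff {C D : GradedComplex} {f : Matrix D.gen C.gen FU}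
    (hf : f * C.d = D.d * f) {κ κ' : Type} [Fintype κ] [DecidableEq κ] [Fintype κ'] [DecidableEq κ'] [Unique κ] [Unique κ'] (t : TowerSplitting C κ)
    (t' : TowerSplitting D κ') :
    Function.Bijective (locHomologyMap f hf) ↔
      ∃ N, (t'.p * f * t.s) default default ∣ (X : FU) ^ N := by
  have hmk : ∀ (z : C.cycles) (u), locHomologyMap f hf
      (LocalizedModule.mk (Submodule.Quotient.mk z) u)
      = LocalizedModule.mk (Submodule.Quotient.mk (cyclesMap f hf z)) u := by
    intro z u
    rw [locHomologyMap, LocalizedModule.map_mk]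
    rfl
  have hfz : ∀ z : C.cycles, (cyclesMap f hf z).1 = f *ᵥ z.1 := fun z => rfl
  have hcyc : ∀ (E : GradedComplex) (z : E.cycles), E.d *ᵥ z.1 = 0 := fun E z => z.2
  set P := t'.p * f * t.s with hP
  have hcol : ∀ v : κ → FU, (P *ᵥ v) default = P default default * v default := fun v => by
    simp [mulVec, dotProduct]
  -- the scalar by which `f` acts on a cycle
  have hscal : ∀ z : C.cycles, (X : FU) ^ t.k * (t'.p *ᵥ (f *ᵥ z.1)) default
      = P default default * (t.p *ᵥ z.1) default := by
    intro z
    have h1 := t.mulVec_sp z.1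
    rw [hcyc, mulVec_zero, add_zero] at h1
    have h2 := congrArg (fun v => (t'.p *ᵥ (f *ᵥ v)) default) h1
    simp only [mulVec_add, mulVec_smul] at h2
    rw [mulVec_mulVec _ f C.d, hf, ← mulVec_mulVec _ D.d, mulVec_mulVec _ t'.p D.d, t'.pd,
      zero_mulVec, add_zero] at h2
    rw [mulVec_mulVec _ f, mulVec_mulVec _ t'.p, ← Matrix.mul_assoc, ← hP] at h2
    rw [← hcol, h2]
    rfl
  constructor
  · rintro ⟨-, hsurj⟩
    have hz : D.d *ᵥ (t'.s *ᵥ fun _ => 1) = 0 := by rw [mulVec_mulVec, t'.ds, zero_mulVec]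
    obtain ⟨x, hx⟩ := hsurj (D.locClass ⟨t'.s *ᵥ fun _ => 1, hz⟩)
    obtain ⟨⟨q, ⟨_, a, rfl⟩⟩, rfl⟩ := Quot.exists_rep x
    obtain ⟨z, rfl⟩ := Submodule.Quotient.mk_surjective _ q
    have hx' := (hmk z ⟨X ^ a, a, rfl⟩).symm.trans hx
    rw [locClass, LocalizedModule.mk_eq] at hx'
    obtain ⟨⟨_, b, rfl⟩, h⟩ := hx'
    change (X : FU) ^ b • (1 : FU) • (Submodule.Quotient.mk (cyclesMap f hf z) : D.Homology)
      = (X : FU) ^ b • (X : FU) ^ a • Submodule.Quotient.mk _ at h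
    simp only [← Submodule.Quotient.mk_smul] at h
    rw [Submodule.Quotient.eq] at h
    obtain ⟨y, hy⟩ := h
    have hy' : D.d *ᵥ y = (X : FU) ^ b • (1 : FU) • (f *ᵥ z.1)
      - (X : FU) ^ b • (X : FU) ^ a • (t'.s *ᵥ fun _ => 1) := hy
    have h3 := congrArg (fun v => (t'.p *ᵥ v) default) hy'
    simp only [mulVec_sub, mulVec_smul] at h3
    rw [mulVec_mulVec _ t'.p D.d, mulVec_mulVec _ t'.p t'.s, t'.pd, t'.ps, zero_mulVec] at h3
    simp only [smul_mulVec, one_mulVec, Pi.zero_apply, Pi.sub_apply, Pi.smul_apply, smul_eq_mul,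
      one_mul, mul_one] at h3
    refine ⟨t.k + (b + (a + t'.k)), X ^ b * (t.p *ᵥ z.1) default, ?_⟩
    have h4 := hscal z
    rw [pow_add, pow_add X b, pow_add X a]
    calc _ = X ^ t.k * (X ^ b * (t'.p *ᵥ f *ᵥ z.1) default) := by
          rw [eq_comm, ← sub_eq_zero, ← mul_sub, ← h3, mul_zero]
      _ = X ^ b * (X ^ t.k * (t'.p *ᵥ f *ᵥ z.1) default) := by ring
      _ = _ := by rw [h4]; ring
  · rintro ⟨N, g, hg⟩
    have hP0 : P default default ≠ 0 := fun h => by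
      rw [h, zero_mul] at hg
      exact pow_ne_zero N X_ne_zero hg
    constructor
    · have hker : ∀ x, locHomologyMap f hf x = 0 → x = 0 := by
        intro x hx
        obtain ⟨⟨q, u⟩, rfl⟩ := Quot.exists_rep x
        obtain ⟨z, rfl⟩ := Submodule.Quotient.mk_surjective _ q
        have hx' := (hmk z u).symm.trans hx
        rw [← LocalizedModule.zero_mk 1, LocalizedModule.mk_eq] at hx'
        obtain ⟨⟨_, b, rfl⟩, h⟩ := hx'
        rw [one_smul, smul_zero, smul_zero] at h
        change (X : FU) ^ b • (Submodule.Quotient.mk (cyclesMap f hf z) : D.Homology) = 0 at h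
        rw [← Submodule.Quotient.mk_smul, Submodule.Quotient.mk_eq_zero] at h
        obtain ⟨y, hy⟩ := h
        have hy' : (X : FU) ^ b • (f *ᵥ z.1) = D.d *ᵥ y := hy.symm
        have h1 := t'.torsion hy'
        have h2 := hscal z
        rw [h1, Pi.zero_apply, mul_zero, eq_comm, mul_eq_zero] at h2
        have h3 : t.p *ᵥ z.1 = 0 := by
          ext1 i
          rw [Unique.eq_default i]
          exact h2.resolve_left hP0
        have h4 := t.mulVec_sp z.1
        rw [h3, hcyc, mulVec_zero, mulVec_zero, zero_add, add_zero] at h4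
        change LocalizedModule.mk (Submodule.Quotient.mk z) u = 0
        rw [← LocalizedModule.zero_mk 1, LocalizedModule.mk_eq]
        refine ⟨⟨X ^ t.k, _, rfl⟩, ?_⟩
        rw [one_smul, smul_zero, smul_zero]
        change (X : FU) ^ t.k • (Submodule.Quotient.mk z : C.Homology) = 0
        rw [← Submodule.Quotient.mk_smul, Submodule.Quotient.mk_eq_zero]
        exact ⟨_, h4⟩
      intro x y hxy
      rw [← sub_eq_zero]
      apply hker
      rw [locHomologyMap, map_sub, sub_eq_zero]
      exact hxy
    · intro x
      obtain ⟨⟨q, ⟨_, a, rfl⟩⟩, rfl⟩ := Quot.exists_rep x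
      obtain ⟨w, rfl⟩ := Submodule.Quotient.mk_surjective _ q
      -- use the cycle `s (g * p w)`
      have hz : C.d *ᵥ (t.s *ᵥ fun _ => g * (t'.p *ᵥ w.1) default) = 0 := by
        rw [mulVec_mulVec, t.ds, zero_mulVec]
      refine ⟨LocalizedModule.mk (Submodule.Quotient.mk ⟨_, hz⟩) ⟨X ^ (a + N), _, rfl⟩, ?_⟩
      rw [hmk]
      change _ = LocalizedModule.mk (Submodule.Quotient.mk w) (⟨X ^ a, a, rfl⟩ : Submonoid.powers (X : FU))
      rw [LocalizedModule.mk_eq]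
      refine ⟨⟨X ^ t'.k, _, rfl⟩, ?_⟩
      change (X : FU) ^ t'.k • (X : FU) ^ a • (Submodule.Quotient.mk _ : D.Homology)
        = (X : FU) ^ t'.k • (X : FU) ^ (a + N) • Submodule.Quotient.mk w
      simp only [← Submodule.Quotient.mk_smul]
      rw [Submodule.Quotient.eq]
      set v := f *ᵥ (t.s *ᵥ fun _ => g * (t'.p *ᵥ w.1) default) with hv
      have hdv : D.d *ᵥ v = 0 := by
        rw [hv, mulVec_mulVec _ D.d f, ← hf, ← mulVec_mulVec _ f, hz, mulVec_zero]
      have h1 := t'.mulVec_sp v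
      have h2 := t'.mulVec_sp ((X : FU) ^ N • w.1)
      have hpv : t'.p *ᵥ v = t'.p *ᵥ ((X : FU) ^ N • w.1) := by
        ext1 i
        rw [Unique.eq_default i, hv, mulVec_mulVec, mulVec_mulVec, ← hP, hcol, mulVec_smul,
          Pi.smul_apply, smul_eq_mul, hg]
        ring
      rw [hdv, mulVec_zero, add_zero, hpv] at h1
      rw [mulVec_smul D.d, hcyc, smul_zero, mulVec_zero, add_zero] at h2
      refine ⟨(X : FU) ^ a • (t'.h *ᵥ v - t'.h *ᵥ ((X : FU) ^ N • w.1)), ?_⟩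
      change D.d *ᵥ _ = (X : FU) ^ t'.k • (X : FU) ^ a • v
        - (X : FU) ^ t'.k • (X : FU) ^ (a + N) • w.1
      have h3 : (X : FU) ^ t'.k • v - (X : FU) ^ t'.k • ((X : FU) ^ N • w.1)
          = D.d *ᵥ (t'.h *ᵥ v - t'.h *ᵥ ((X : FU) ^ N • w.1)) := by
        rw [← h1, ← h2, mulVec_sub]
        abel
      rw [mulVec_smul, ← h3, pow_add]
      module

end GradedComplex

/-! ### Trivial complex, tensor products and duals -/

theorem FU_matrix_add_self {I J : Type} (M : Matrix I J FU) : M + M = 0 := by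
  ext1 i j
  exact CharTwo.add_self_eq_zero (M i j)

theorem FU_matrix_add_eq_zero {I J : Type} {M N : Matrix I J FU} (h : M = N) : M + N = 0 := by
  rw [h, FU_matrix_add_self]

theorem FU_matrix_eq_of_eq_add {I J : Type} {A B : Matrix I J FU} (M : Matrix I J FU)
    (h : A = B + (M + M)) : A = B := by
  rw [h, FU_matrix_add_self, add_zero]

namespace GradedComplex

/-- The complex `𝔽[U]` with generator in grading zero. -/
def trivial : GradedComplex where
  gen := Unit
  gr := fun _ => 0
  d := 0
  d_hom := IsHomogeneousMap.zero
  d_sq := by simp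

/-- The tower of the trivial complex. -/
def trivialSplitting : TowerSplitting trivial Unit where
  s := (1 : Matrix Unit Unit FU)
  p := (1 : Matrix Unit Unit FU)
  h := 0
  k := 0
  ds := Matrix.zero_mul _
  pd := Matrix.mul_zero _
  ps := by
    rw [pow_zero, one_smul]
    exact Matrix.one_mul (1 : Matrix Unit Unit FU)
  sp := by
    rw [pow_zero, one_smul, Matrix.mul_zero, Matrix.zero_mul, add_zero, add_zero]
    exact Matrix.one_mul (1 : Matrix Unit Unit FU)
  s_even := fun i _ hi => absurd (show Even (0 : ℤ) by simp) hi
  p_even := fun _ i hi => absurd (show Even (0 : ℤ) by simp) hi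

/-- The tensor product over `𝔽[U]`, with differential `∂ ⊗ 1 + 1 ⊗ ∂`. -/
def tensor (C D : GradedComplex) : GradedComplex where
  gen := C.gen × D.gen
  gr := fun x => C.gr x.1 + D.gr x.2
  d := C.d ⊗ₖ (1 : Matrix D.gen D.gen FU) + (1 : Matrix C.gen C.gen FU) ⊗ₖ D.d
  d_hom := ((C.d_hom.kronecker IsHomogeneousMap.one).congr (by norm_num)).add
    ((IsHomogeneousMap.one.kronecker D.d_hom).congr (by norm_num))
  d_sq := by
    simp only [Matrix.mul_add, Matrix.add_mul, ← mul_kronecker_mul, Matrix.one_mul, Matrix.mul_one,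
      C.d_sq, D.d_sq, zero_kronecker, kronecker_zero, zero_add, add_zero]
    exact FU_matrix_add_self _

theorem tensor_d (C D : GradedComplex) : (C.tensor D).d
    = C.d ⊗ₖ (1 : Matrix D.gen D.gen FU) + (1 : Matrix C.gen C.gen FU) ⊗ₖ D.d := rfl

/-- The dual complex `Hom(C, 𝔽[U])` in the dual basis. -/
def dual (C : GradedComplex) : GradedComplex where
  gen := C.gen
  gr := fun i => -C.gr i
  d := C.dᵀ
  d_hom := C.d_hom.transpose
  d_sq := by rw [← transpose_mul, C.d_sq, transpose_zero]

theorem TowerSplitting.tensor_sp {C D : GradedComplex} {κ κ' : Type} [Fintype κ] [DecidableEq κ]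
    [Fintype κ'] [DecidableEq κ'] (t : TowerSplitting C κ) (t' : TowerSplitting D κ') :
    (t.s ⊗ₖ t'.s) * (t.p ⊗ₖ t'.p)
      + ((C.d ⊗ₖ (1 : Matrix D.gen D.gen FU) + (1 : Matrix C.gen C.gen FU) ⊗ₖ D.d)
        * (t.h ⊗ₖ ((X : FU) ^ t'.k • (1 : Matrix D.gen D.gen FU)) + (t.s * t.p) ⊗ₖ t'.h)
      + (t.h ⊗ₖ ((X : FU) ^ t'.k • (1 : Matrix D.gen D.gen FU)) + (t.s * t.p) ⊗ₖ t'.h)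
        * (C.d ⊗ₖ (1 : Matrix D.gen D.gen FU) + (1 : Matrix C.gen C.gen FU) ⊗ₖ D.d))
      = (X : FU) ^ (t.k + t'.k) • (1 : Matrix (C.gen × D.gen) (C.gen × D.gen) FU) := by
  have a1 : C.d * (t.s * t.p) = 0 := by rw [← Matrix.mul_assoc, t.ds, Matrix.zero_mul]
  have a2 : (t.s * t.p) * C.d = 0 := by rw [Matrix.mul_assoc, t.pd, Matrix.mul_zero]
  obtain ⟨N, hN⟩ : ∃ N, N = (X : FU) ^ t'.k • (1 : Matrix D.gen D.gen FU) := ⟨_, rfl⟩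
  have hNd : D.d * N = N * D.d := by
    rw [hN, Matrix.mul_smul, Matrix.smul_mul, Matrix.mul_one, Matrix.one_mul]
  have e : (X : FU) ^ (t.k + t'.k) • (1 : Matrix (C.gen × D.gen) (C.gen × D.gen) FU)
      = (C.d * t.h + t.h * C.d) ⊗ₖ N
      + (t.s * t.p) ⊗ₖ (t'.s * t'.p + (D.d * t'.h + t'.h * D.d)) := by
    rw [t'.sp, hN, ← add_kronecker, add_comm _ (t.s * t.p), t.sp, smul_kronecker, kronecker_smul,
      smul_smul, pow_add, one_kronecker_one]
  rw [e, ← hN]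
  simp only [Matrix.mul_add, Matrix.add_mul, ← mul_kronecker_mul, Matrix.one_mul, Matrix.mul_one,
    a1, a2, zero_kronecker, add_kronecker, kronecker_add, zero_add, hNd]
  generalize t.h ⊗ₖ (N * D.d) = A
  refine FU_matrix_eq_of_eq_add A ?_
  abel

/-- The tower of a tensor product. -/
def TowerSplitting.tensor {C D : GradedComplex} {κ κ' : Type} [Fintype κ] [DecidableEq κ] [Fintype κ'] [DecidableEq κ']
    (t : TowerSplitting C κ) (t' : TowerSplitting D κ') :
    TowerSplitting (C.tensor D) (κ × κ') where
  s := t.s ⊗ₖ t'.s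
  p := t.p ⊗ₖ t'.p
  h := t.h ⊗ₖ ((X : FU) ^ t'.k • (1 : Matrix D.gen D.gen FU)) + (t.s * t.p) ⊗ₖ t'.h
  k := t.k + t'.k
  ds := by
    change (C.d ⊗ₖ (1 : Matrix D.gen D.gen FU) + (1 : Matrix C.gen C.gen FU) ⊗ₖ D.d)
      * (t.s ⊗ₖ t'.s) = 0
    rw [Matrix.add_mul, ← mul_kronecker_mul, ← mul_kronecker_mul, t.ds, t'.ds, zero_kronecker,
      kronecker_zero, add_zero]
  pd := by
    change (t.p ⊗ₖ t'.p)
      * (C.d ⊗ₖ (1 : Matrix D.gen D.gen FU) + (1 : Matrix C.gen C.gen FU) ⊗ₖ D.d) = 0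
    rw [Matrix.mul_add, ← mul_kronecker_mul, ← mul_kronecker_mul, t.pd, t'.pd, zero_kronecker,
      kronecker_zero, add_zero]
  ps := by
    change (t.p ⊗ₖ t'.p) * (t.s ⊗ₖ t'.s) = _
    rw [← mul_kronecker_mul, t.ps, t'.ps, smul_kronecker, kronecker_smul, smul_smul, pow_add,
      one_kronecker_one]
  sp := by
    change (t.s ⊗ₖ t'.s) * (t.p ⊗ₖ t'.p)
      + ((C.d ⊗ₖ (1 : Matrix D.gen D.gen FU) + (1 : Matrix C.gen C.gen FU) ⊗ₖ D.d)
        * (t.h ⊗ₖ ((X : FU) ^ t'.k • (1 : Matrix D.gen D.gen FU)) + (t.s * t.p) ⊗ₖ t'.h)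
      + (t.h ⊗ₖ ((X : FU) ^ t'.k • (1 : Matrix D.gen D.gen FU)) + (t.s * t.p) ⊗ₖ t'.h)
        * (C.d ⊗ₖ (1 : Matrix D.gen D.gen FU) + (1 : Matrix C.gen C.gen FU) ⊗ₖ D.d))
      = (X : FU) ^ (t.k + t'.k) • (1 : Matrix (C.gen × D.gen) (C.gen × D.gen) FU)
    exact t.tensor_sp t'
  s_even := by
    rintro ⟨i, i'⟩ ⟨j, j'⟩ hi
    change t.s i j * t'.s i' j' = 0
    by_cases h : Even (C.gr i)
    · rw [t'.s_even i' j', mul_zero]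
      intro h'
      exact hi (h.add h')
    · rw [t.s_even i j h, zero_mul]
  p_even := by
    rintro ⟨j, j'⟩ ⟨i, i'⟩ hi
    change t.p j i * t'.p j' i' = 0
    by_cases h : Even (C.gr i)
    · rw [t'.p_even j' i', mul_zero]
      intro h'
      exact hi (h.add h')
    · rw [t.p_even j i h, zero_mul]

/-- The tower of a dual complex. -/
def TowerSplitting.dual {C : GradedComplex} {κ : Type} [Fintype κ] [DecidableEq κ] (t : TowerSplitting C κ) :
    TowerSplitting C.dual κ where
  s := t.pᵀ
  p := t.sᵀ
  h := t.hᵀ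
  k := t.k
  ds := by
    change C.dᵀ * t.pᵀ = 0
    rw [← transpose_mul, t.pd, transpose_zero]
  pd := by
    change t.sᵀ * C.dᵀ = 0
    rw [← transpose_mul, t.ds, transpose_zero]
  ps := by
    change t.sᵀ * t.pᵀ = _
    rw [← transpose_mul, t.ps, transpose_smul, transpose_one]
  sp := by
    change t.pᵀ * t.sᵀ + (C.dᵀ * t.hᵀ + t.hᵀ * C.dᵀ) = (X : FU) ^ t.k • (1 : Matrix C.gen C.gen FU)
    rw [← transpose_mul, ← transpose_mul, ← transpose_mul, ← transpose_add, ← transpose_add,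
      add_comm (t.h * C.d), t.sp, transpose_smul, transpose_one]
  s_even := fun i j hi => t.p_even j i fun h => hi h.neg
  p_even := fun j i hi => t.s_even i j fun h => hi h.neg

end GradedComplex

instance uniqueProd {κ κ' : Type} [Unique κ] [Unique κ'] : Unique (κ × κ') where
  uniq := fun _ => Subsingleton.elim _ _

namespace AlmostIotaComplex

open GradedComplex

theorem exists_splitting (C : AlmostIotaComplex) : Nonempty (TowerSplitting C.toGradedComplex Unit) :=
  C.tower.exists_splitting

/-- The trivial almost `ι`-complex. -/
def trivial : AlmostIotaComplex where
  toGradedComplex := GradedComplex.trivial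
  tower := trivialSplitting.hasEvenTower
  iota := (1 : Matrix Unit Unit FU)
  iota_hom := IsHomogeneousMap.one
  iota_comm := ⟨0, by
    rw [smul_zero]
    exact FU_matrix_add_eq_zero ((Matrix.mul_zero _).trans (Matrix.zero_mul _).symm)⟩
  iota_sq := by
    refine ⟨0, 0, IsHomogeneousMap.zero, ?_⟩
    rw [Matrix.zero_mul, Matrix.mul_zero, smul_zero, add_zero, add_zero]
    exact FU_matrix_add_eq_zero (Matrix.one_mul (1 : Matrix Unit Unit FU))

/-- The tensor product `(C, ι) ⊗ (C', ι') = (C ⊗ C', ι ⊗ ι')`. -/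
def tensor (C D : AlmostIotaComplex) : AlmostIotaComplex where
  toGradedComplex := C.toGradedComplex.tensor D.toGradedComplex
  tower := by
    obtain ⟨t⟩ := C.exists_splitting
    obtain ⟨t'⟩ := D.exists_splitting
    exact (t.tensor t').hasEvenTower
  iota := C.iota ⊗ₖ D.iota
  iota_hom := (C.iota_hom.kronecker D.iota_hom).congr (by norm_num)
  iota_comm := by
    obtain ⟨E, hE⟩ := C.iota_comm
    obtain ⟨E', hE'⟩ := D.iota_comm
    refine ⟨E ⊗ₖ D.iota + C.iota ⊗ₖ E', ?_⟩
    change (C.iota ⊗ₖ D.iota) * (C.d ⊗ₖ (1 : Matrix D.gen D.gen FU)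
        + (1 : Matrix C.gen C.gen FU) ⊗ₖ D.d)
      + (C.d ⊗ₖ (1 : Matrix D.gen D.gen FU) + (1 : Matrix C.gen C.gen FU) ⊗ₖ D.d)
        * (C.iota ⊗ₖ D.iota) = (X : FU) • (E ⊗ₖ D.iota + C.iota ⊗ₖ E')
    rw [smul_add, ← smul_kronecker, ← kronecker_smul, ← hE, ← hE']
    simp only [Matrix.mul_add, Matrix.add_mul, ← mul_kronecker_mul, Matrix.one_mul, Matrix.mul_one,
      add_kronecker, kronecker_add]
    abel
  iota_sq := by
    obtain ⟨H, E, hH, hE⟩ := C.iota_sq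
    obtain ⟨H', E', hH', hE'⟩ := D.iota_sq
    obtain ⟨G, hG⟩ := C.iota_comm
    -- `ι² ` commutes with the differential modulo `U`
    have hsq : (C.iota * C.iota) * C.d + C.d * (C.iota * C.iota)
        = (X : FU) • (C.iota * G + G * C.iota) := by
      rw [smul_add, ← Matrix.mul_smul, ← Matrix.smul_mul, ← hG]
      simp only [Matrix.mul_add, Matrix.add_mul, Matrix.mul_assoc]
      refine (FU_matrix_eq_of_eq_add (C.iota * (C.d * C.iota)) ?_).symm
      abel
    refine ⟨H ⊗ₖ (1 : Matrix D.gen D.gen FU) + (C.iota * C.iota) ⊗ₖ H',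
      E ⊗ₖ (1 : Matrix D.gen D.gen FU) + (C.iota * C.iota) ⊗ₖ E'
        + (C.iota * G + G * C.iota) ⊗ₖ H', ?_, ?_⟩
    · exact ((hH.kronecker IsHomogeneousMap.one).congr (by norm_num)).add
        (((C.iota_hom.mul C.iota_hom).kronecker hH').congr (by norm_num))
    · change (C.iota ⊗ₖ D.iota) * (C.iota ⊗ₖ D.iota)
          + (1 : Matrix (C.gen × D.gen) (C.gen × D.gen) FU)
        + (H ⊗ₖ (1 : Matrix D.gen D.gen FU) + (C.iota * C.iota) ⊗ₖ H')
          * (C.d ⊗ₖ (1 : Matrix D.gen D.gen FU) + (1 : Matrix C.gen C.gen FU) ⊗ₖ D.d)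
        + (C.d ⊗ₖ (1 : Matrix D.gen D.gen FU) + (1 : Matrix C.gen C.gen FU) ⊗ₖ D.d)
          * (H ⊗ₖ (1 : Matrix D.gen D.gen FU) + (C.iota * C.iota) ⊗ₖ H')
        = (X : FU) • (E ⊗ₖ (1 : Matrix D.gen D.gen FU) + (C.iota * C.iota) ⊗ₖ E'
          + (C.iota * G + G * C.iota) ⊗ₖ H')
      rw [smul_add, smul_add, ← smul_kronecker, ← kronecker_smul, ← smul_kronecker, ← hE, ← hE',
        ← hsq]
      rw [← one_kronecker_one (α := FU)]
      simp only [Matrix.mul_add, Matrix.add_mul, ← mul_kronecker_mul, Matrix.one_mul,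
        Matrix.mul_one, add_kronecker, kronecker_add]
      refine FU_matrix_eq_of_eq_add (H ⊗ₖ D.d) ?_
      refine (FU_matrix_eq_of_eq_add ((C.iota * C.iota) ⊗ₖ (1 : Matrix D.gen D.gen FU)) ?_).symm
      abel

/-- The dual almost `ι`-complex. -/
def dual (C : AlmostIotaComplex) : AlmostIotaComplex where
  toGradedComplex := C.toGradedComplex.dual
  tower := by
    obtain ⟨t⟩ := C.exists_splitting
    exact t.dual.hasEvenTower
  iota := C.iotaᵀ
  iota_hom := C.iota_hom.transpose
  iota_comm := by
    obtain ⟨E, hE⟩ := C.iota_comm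
    refine ⟨Eᵀ, ?_⟩
    change C.iotaᵀ * C.dᵀ + C.dᵀ * C.iotaᵀ = (X : FU) • Eᵀ
    rw [← transpose_smul, ← hE, transpose_add, transpose_mul, transpose_mul, add_comm]
  iota_sq := by
    obtain ⟨H, E, hH, hE⟩ := C.iota_sq
    refine ⟨Hᵀ, Eᵀ, hH.transpose, ?_⟩
    change C.iotaᵀ * C.iotaᵀ + (1 : Matrix C.gen C.gen FU) + Hᵀ * C.dᵀ + C.dᵀ * Hᵀ = (X : FU) • Eᵀ
    rw [← transpose_smul, ← hE]
    simp only [transpose_add, transpose_mul, transpose_one]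
    abel

end AlmostIotaComplex

/-! ### Almost local maps -/

namespace GradedComplex

theorem bijective_of_mul_eq_one {C D : GradedComplex} (hC : C.HasEvenTower) (hD : D.HasEvenTower)
    {f : Matrix D.gen C.gen FU} {g : Matrix C.gen D.gen FU} (hf : f * C.d = D.d * f)
    (hg : g * D.d = C.d * g) (hfg : f * g = 1) : Function.Bijective (locHomologyMap f hf) := by
  obtain ⟨t⟩ := hC.exists_splitting
  obtain ⟨t'⟩ := hD.exists_splitting
  rw [bijective_locHomologyMap_iff hf t t']
  have key : (t'.p * f * t.s) * (t.p * g * t'.s) = (X : FU) ^ (t.k + t'.k) • (1 : Matrix Unit Unit FU) := by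
    have h1 : (t'.p * f) * ((X : FU) ^ t.k • (1 : Matrix C.gen C.gen FU)) * (g * t'.s)
        = (X : FU) ^ (t.k + t'.k) • (1 : Matrix Unit Unit FU) := by
      rw [Matrix.mul_smul, Matrix.mul_one, Matrix.smul_mul, Matrix.mul_assoc,
        ← Matrix.mul_assoc f, hfg, Matrix.one_mul, t'.ps, smul_smul, pow_add]
    have h2 : (t'.p * f) * C.d = 0 := by
      rw [Matrix.mul_assoc, hf, ← Matrix.mul_assoc, t'.pd, Matrix.zero_mul]
    have h3 : C.d * (g * t'.s) = 0 := by
      rw [← Matrix.mul_assoc, ← hg, Matrix.mul_assoc, t'.ds, Matrix.mul_zero]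
    rw [← h1, ← t.sp, Matrix.mul_add, Matrix.mul_add, ← Matrix.mul_assoc _ C.d, h2,
      Matrix.zero_mul, zero_add, Matrix.add_mul, Matrix.mul_assoc _ (t.h * C.d),
      Matrix.mul_assoc t.h, h3, Matrix.mul_zero, Matrix.mul_zero, add_zero]
    simp only [Matrix.mul_assoc]
  refine ⟨t.k + t'.k, (t.p * g * t'.s) default default, ?_⟩
  have := congrFun (congrFun key default) default
  rw [mul_apply, Fintype.sum_unique, Matrix.smul_apply, one_apply_eq, smul_eq_mul, mul_one] at this
  exact this.symm

/-- The row vector representing a bilinear form. -/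
def rowVec {I J : Type} (M : Matrix J I FU) : Matrix Unit (I × J) FU := of fun _ x => M x.2 x.1

/-- The column vector representing an element of a tensor product. -/
def colVec {I J : Type} (M : Matrix I J FU) : Matrix (I × J) Unit FU := of fun x _ => M x.1 x.2

theorem rowVec_mul {I J A B : Type} [Fintype I] [Fintype J] (M : Matrix J I FU)
    (P : Matrix I A FU) (Q : Matrix B J FU) : rowVec M * (P ⊗ₖ Qᵀ) = rowVec (Q * M * P) := by
  ext1 u ⟨a, b⟩
  simp only [rowVec, mul_apply, of_apply, Fintype.sum_prod_type, kronecker_apply, transpose_apply,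
    Finset.sum_mul]
  refine Finset.sum_congr rfl fun i _ => Finset.sum_congr rfl fun j _ => ?_
  ring

theorem mul_colVec {I J A B : Type} [Fintype I] [Fintype J] (M : Matrix I J FU)
    (P : Matrix A I FU) (Q : Matrix J B FU) : (P ⊗ₖ Qᵀ) * colVec M = colVec (P * M * Q) := by
  ext1 ⟨a, b⟩ u
  simp only [colVec, mul_apply, of_apply, Fintype.sum_prod_type, kronecker_apply, transpose_apply,
    Finset.sum_mul]
  rw [Finset.sum_comm]
  refine Finset.sum_congr rfl fun i _ => Finset.sum_congr rfl fun j _ => ?_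
  ring

theorem rowVec_add {I J : Type} (M N : Matrix J I FU) : rowVec (M + N) = rowVec M + rowVec N := rfl

theorem colVec_add {I J : Type} (M N : Matrix I J FU) : colVec (M + N) = colVec M + colVec N := rfl

end GradedComplex

namespace IsAlmostLocalMap

open GradedComplex

theorem comp {C D E : AlmostIotaComplex} {g : Matrix E.gen D.gen FU} {f : Matrix D.gen C.gen FU}
    (hg : IsAlmostLocalMap D E g) (hf : IsAlmostLocalMap C D f) :
    IsAlmostLocalMap C E (g * f) := by
  have hch : (g * f) * C.d = E.d * (g * f) := by
    rw [Matrix.mul_assoc, hf.chain, ← Matrix.mul_assoc, hg.chain, Matrix.mul_assoc]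
  refine ⟨(hg.hom.mul hf.hom).congr (by norm_num), hch, ?_, ?_⟩
  · obtain ⟨H, G, hH, h⟩ := hf.iota
    obtain ⟨H', G', hH', h'⟩ := hg.iota
    refine ⟨g * H + H' * f, g * G + G' * f, ((hg.hom.mul hH).congr (by norm_num)).add
      ((hH'.mul hf.hom).congr (by norm_num)), ?_⟩
    rw [smul_add, ← Matrix.mul_smul, ← Matrix.smul_mul, ← h, ← h']
    simp only [Matrix.mul_add, Matrix.add_mul]
    rw [Matrix.mul_assoc H' f, hf.chain, ← Matrix.mul_assoc E.d g, ← hg.chain]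
    simp only [Matrix.mul_assoc]
    refine (FU_matrix_eq_of_eq_add (g * (D.iota * f)) ?_).symm
    abel
  · obtain ⟨t⟩ := C.exists_splitting
    obtain ⟨t'⟩ := D.exists_splitting
    obtain ⟨t''⟩ := E.exists_splitting
    obtain ⟨M, hM⟩ := (bijective_locHomologyMap_iff hf.chain t t').1 hf.loc
    obtain ⟨N, hN⟩ := (bijective_locHomologyMap_iff hg.chain t' t'').1 hg.loc
    rw [bijective_locHomologyMap_iff hch t t'']
    refine ⟨N + M, ?_⟩
    rw [pow_add]
    refine dvd_trans ?_ (mul_dvd_mul hN hM)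
    have key : (t''.p * g * t'.s) * (t'.p * f * t.s)
        = (X : FU) ^ t'.k • (t''.p * (g * f) * t.s) := by
      have h1 : (t''.p * g) * ((X : FU) ^ t'.k • (1 : Matrix D.gen D.gen FU)) * (f * t.s)
          = (X : FU) ^ t'.k • (t''.p * (g * f) * t.s) := by
        rw [Matrix.mul_smul, Matrix.mul_one, Matrix.smul_mul]
        simp only [Matrix.mul_assoc]
      have h2 : (t''.p * g) * D.d = 0 := by
        rw [Matrix.mul_assoc, hg.chain, ← Matrix.mul_assoc, t''.pd, Matrix.zero_mul]
      have h3 : D.d * (f * t.s) = 0 := by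
        rw [← Matrix.mul_assoc, ← hf.chain, Matrix.mul_assoc, t.ds, Matrix.mul_zero]
      rw [← h1, ← t'.sp, Matrix.mul_add, Matrix.mul_add, ← Matrix.mul_assoc _ D.d, h2,
        Matrix.zero_mul, zero_add, Matrix.add_mul, Matrix.mul_assoc _ (t'.h * D.d),
        Matrix.mul_assoc t'.h, h3, Matrix.mul_zero, Matrix.mul_zero, add_zero]
      simp only [Matrix.mul_assoc]
    have := congrFun (congrFun key default) default
    rw [mul_apply, Fintype.sum_unique, Matrix.smul_apply, smul_eq_mul] at this
    exact ⟨_, this.trans (mul_comm _ _)⟩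

/-- An identification of bases compatible with all structure is an almost local map. -/
theorem of_equiv {C D : AlmostIotaComplex} (e : C.gen ≃ D.gen) (hgr : ∀ i, D.gr (e i) = C.gr i)
    (hd : ∀ i j, D.d (e i) (e j) = C.d i j) (hi : ∀ i j, D.iota (e i) (e j) = C.iota i j) :
    IsAlmostLocalMap C D (of fun j i => if j = e i then 1 else 0) := by
  have hl : ∀ M : Matrix C.gen C.gen FU,
      (of fun j i => if j = e i then (1 : FU) else 0 : Matrix D.gen C.gen FU) * M
        = of fun j i => M (e.symm j) i := by
    intro M
    ext1 j i
    simp only [mul_apply, of_apply, ite_mul, one_mul, zero_mul]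
    rw [Finset.sum_eq_single (e.symm j)]
    · simp
    · intro b _ hb
      rw [if_neg]
      rintro rfl
      exact hb (by simp)
    · simp
  have hr : ∀ M : Matrix D.gen D.gen FU,
      M * (of fun j i => if j = e i then (1 : FU) else 0 : Matrix D.gen C.gen FU)
        = of fun j i => M j (e i) := by
    intro M
    ext1 j i
    simp [mul_apply]
  have hd' : (of fun j i => C.d (e.symm j) i) = of fun j i => D.d j (e i) := by
    ext1 j i
    simp [← hd]
  have hi' : (of fun j i => C.iota (e.symm j) i) = of fun j i => D.iota j (e i) := by
    ext1 j i
    simp [← hi]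
  have hch : (of fun j i => if j = e i then (1 : FU) else 0 : Matrix D.gen C.gen FU) * C.d
      = D.d * (of fun j i => if j = e i then (1 : FU) else 0) := by rw [hl, hr, hd']
  refine ⟨?_, hch, ?_, ?_⟩
  · intro j i n hn
    rw [of_apply] at hn
    by_cases hji : j = e i
    · rw [if_pos hji, coeff_one] at hn
      have : n = 0 := by
        by_contra hne
        simp [hne] at hn
      rw [hji, hgr, this]
      simp
    · simp [hji] at hn
  · refine ⟨0, 0, IsHomogeneousMap.zero, ?_⟩
    rw [Matrix.zero_mul, Matrix.mul_zero, add_zero, add_zero, smul_zero]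
    exact FU_matrix_add_eq_zero (by rw [hl, hr, hi'])
  · refine bijective_of_mul_eq_one C.tower D.tower
      (g := of fun i j => if i = e.symm j then 1 else 0) hch ?_ ?_
    · ext1 i j
      simp only [mul_apply, of_apply, ite_mul, one_mul, zero_mul, mul_ite, mul_one, mul_zero]
      rw [Finset.sum_eq_single (e i), Finset.sum_eq_single (e.symm j)]
      · simp [← hd]
      · intro b _ hb
        rw [if_neg hb]
      · simp
      · intro b _ hb
        rw [if_neg]
        rintro rfl
        exact hb (by simp)
      · simp
    · ext1 i j
      simp [mul_apply, one_apply]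

theorem tensor {C D C' D' : AlmostIotaComplex} {f : Matrix C'.gen C.gen FU}
    {g : Matrix D'.gen D.gen FU} (hf : IsAlmostLocalMap C C' f) (hg : IsAlmostLocalMap D D' g) :
    IsAlmostLocalMap (C.tensor D) (C'.tensor D') (f ⊗ₖ g) := by
  have hch : ∀ F : Matrix (C'.tensor D').gen (C.tensor D).gen FU, F = f ⊗ₖ g →
      F * (C.tensor D).d = (C'.tensor D').d * F := by
    rintro _ rfl
    change (f ⊗ₖ g) * (C.d ⊗ₖ (1 : Matrix D.gen D.gen FU) + (1 : Matrix C.gen C.gen FU) ⊗ₖ D.d)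
      = (C'.d ⊗ₖ (1 : Matrix D'.gen D'.gen FU) + (1 : Matrix C'.gen C'.gen FU) ⊗ₖ D'.d) * (f ⊗ₖ g)
    rw [Matrix.mul_add, Matrix.add_mul]
    simp only [← mul_kronecker_mul, Matrix.one_mul, Matrix.mul_one, hf.chain, hg.chain]
  refine ⟨(hf.hom.kronecker hg.hom).congr (by norm_num), hch _ rfl, ?_, ?_⟩
  · obtain ⟨H, E, hH, h⟩ := hf.iota
    obtain ⟨H', E', hH', h'⟩ := hg.iota
    obtain ⟨G, hG⟩ := D.iota_comm
    obtain ⟨G', hG'⟩ := C'.iota_comm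
    refine ⟨H ⊗ₖ (g * D.iota) + (C'.iota * f) ⊗ₖ H',
      E ⊗ₖ (g * D.iota) + (C'.iota * f) ⊗ₖ E' + H ⊗ₖ (g * G) + (G' * f) ⊗ₖ H',
      ((hH.kronecker (hg.hom.mul D.iota_hom)).congr (by norm_num)).add
        (((C'.iota_hom.mul hf.hom).kronecker hH').congr (by norm_num)), ?_⟩
    change (f ⊗ₖ g) * (C.iota ⊗ₖ D.iota) + (C'.iota ⊗ₖ D'.iota) * (f ⊗ₖ g)
      + (H ⊗ₖ (g * D.iota) + (C'.iota * f) ⊗ₖ H')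
        * (C.d ⊗ₖ (1 : Matrix D.gen D.gen FU) + (1 : Matrix C.gen C.gen FU) ⊗ₖ D.d)
      + (C'.d ⊗ₖ (1 : Matrix D'.gen D'.gen FU) + (1 : Matrix C'.gen C'.gen FU) ⊗ₖ D'.d)
        * (H ⊗ₖ (g * D.iota) + (C'.iota * f) ⊗ₖ H')
      = (X : FU) • (E ⊗ₖ (g * D.iota) + (C'.iota * f) ⊗ₖ E' + H ⊗ₖ (g * G) + (G' * f) ⊗ₖ H')
    rw [smul_add, smul_add, smul_add, ← smul_kronecker, ← kronecker_smul, ← kronecker_smul,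
      ← smul_kronecker, ← Matrix.mul_smul, ← Matrix.smul_mul, ← h, ← h', ← hG, ← hG']
    have e1 : D'.d * (g * D.iota) = g * (D.d * D.iota) := by
      rw [← Matrix.mul_assoc, ← hg.chain, Matrix.mul_assoc]
    have e2 : C'.iota * (f * C.d) = C'.iota * (C'.d * f) := by rw [hf.chain]
    simp only [Matrix.mul_add, Matrix.add_mul, ← mul_kronecker_mul, Matrix.one_mul, Matrix.mul_one,
      add_kronecker, kronecker_add, Matrix.mul_assoc, e1, e2]
    refine (FU_matrix_eq_of_eq_add ((C'.iota * f) ⊗ₖ (g * D.iota)) ?_).symm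
    abel
  · obtain ⟨t⟩ := C.exists_splitting
    obtain ⟨t'⟩ := C'.exists_splitting
    obtain ⟨u⟩ := D.exists_splitting
    obtain ⟨u'⟩ := D'.exists_splitting
    obtain ⟨M, hM⟩ := (bijective_locHomologyMap_iff hf.chain t t').1 hf.loc
    obtain ⟨N, hN⟩ := (bijective_locHomologyMap_iff hg.chain u u').1 hg.loc
    refine (bijective_locHomologyMap_iff (hch _ rfl) (t.tensor u) (t'.tensor u')).2 ⟨M + N, ?_⟩
    have : (t'.p ⊗ₖ u'.p) * (f ⊗ₖ g) * (t.s ⊗ₖ u.s) = (t'.p * f * t.s) ⊗ₖ (u'.p * g * u.s) := by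
      rw [← mul_kronecker_mul, ← mul_kronecker_mul]
    change ((t'.p ⊗ₖ u'.p) * (f ⊗ₖ g) * (t.s ⊗ₖ u.s)) default default ∣ _
    rw [this, pow_add]
    exact mul_dvd_mul hM hN

theorem dual {C D : AlmostIotaComplex} {f : Matrix D.gen C.gen FU} (hf : IsAlmostLocalMap C D f) :
    IsAlmostLocalMap D.dual C.dual fᵀ := by
  have hch : ∀ F : Matrix C.dual.gen D.dual.gen FU, F = fᵀ →
      F * D.dual.d = C.dual.d * F := by
    rintro _ rfl
    change fᵀ * D.dᵀ = C.dᵀ * fᵀ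
    rw [← transpose_mul, ← transpose_mul, hf.chain]
  refine ⟨hf.hom.transpose, hch _ rfl, ?_, ?_⟩
  · obtain ⟨H, E, hH, h⟩ := hf.iota
    refine ⟨Hᵀ, Eᵀ, hH.transpose, ?_⟩
    change fᵀ * D.iotaᵀ + C.iotaᵀ * fᵀ + Hᵀ * D.dᵀ + C.dᵀ * Hᵀ = (X : FU) • Eᵀ
    rw [← transpose_smul, ← h]
    simp only [transpose_add, transpose_mul]
    abel
  · obtain ⟨t⟩ := C.exists_splitting
    obtain ⟨t'⟩ := D.exists_splitting
    obtain ⟨M, hM⟩ := (bijective_locHomologyMap_iff hf.chain t t').1 hf.loc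
    refine (bijective_locHomologyMap_iff (hch _ rfl) t'.dual t.dual).2 ⟨M, ?_⟩
    change (t.sᵀ * fᵀ * t'.pᵀ) default default ∣ _
    rw [← transpose_mul, ← transpose_mul, ← Matrix.mul_assoc]
    exact hM

/-- Evaluation `C ⊗ C^∨ → 𝔽[U]`. -/
theorem evaluation (C : AlmostIotaComplex) :
    IsAlmostLocalMap (C.tensor C.dual) AlmostIotaComplex.trivial
      (rowVec (1 : Matrix C.gen C.gen FU)) := by
  have hk : ∀ M : Matrix C.gen C.gen FU, rowVec M * (C.d ⊗ₖ (1 : Matrix C.gen C.gen FU)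
      + (1 : Matrix C.gen C.gen FU) ⊗ₖ C.dᵀ) = rowVec (M * C.d) + rowVec (C.d * M) := by
    intro M
    rw [Matrix.mul_add, rowVec_mul, ← transpose_one, rowVec_mul, transpose_one, Matrix.one_mul,
      Matrix.mul_one]
  have hch : ∀ F : Matrix AlmostIotaComplex.trivial.gen (C.tensor C.dual).gen FU,
      F = rowVec (1 : Matrix C.gen C.gen FU) →
      F * (C.tensor C.dual).d = AlmostIotaComplex.trivial.d * F := by
    rintro _ rfl
    refine ((hk 1).trans ?_).trans (Matrix.zero_mul _).symm
    rw [Matrix.one_mul, Matrix.mul_one]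
    exact FU_matrix_add_self _
  refine ⟨?_, hch _ rfl, ?_, ?_⟩
  · rintro u ⟨i, j⟩ n hn
    have := IsHomogeneousMap.one (g := C.gr) j i n hn
    change (0 : ℤ) - 2 * n = C.gr i + -C.gr j + 0
    linarith
  · obtain ⟨H, E, hH, h⟩ := C.iota_sq
    refine ⟨rowVec H, rowVec E, ?_, ?_⟩
    · rintro u ⟨i, j⟩ n hn
      have := hH j i n hn
      change (0 : ℤ) - 2 * n = C.gr i + -C.gr j + 1
      linarith
    · change rowVec (1 : Matrix C.gen C.gen FU) * (C.iota ⊗ₖ C.iotaᵀ)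
        + (1 : Matrix Unit Unit FU) * rowVec (1 : Matrix C.gen C.gen FU)
        + rowVec H * (C.d ⊗ₖ (1 : Matrix C.gen C.gen FU) + (1 : Matrix C.gen C.gen FU) ⊗ₖ C.dᵀ)
        + (0 : Matrix Unit Unit FU) * rowVec H = rowVec ((X : FU) • E)
      rw [hk, rowVec_mul, ← h, Matrix.one_mul, Matrix.zero_mul, add_zero, Matrix.mul_one]
      simp only [rowVec_add]
      abel
  · obtain ⟨t⟩ := C.exists_splitting
    refine (bijective_locHomologyMap_iff (hch _ rfl) (t.tensor t.dual) trivialSplitting).2 ⟨t.k, ?_⟩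
    change ((1 : Matrix Unit Unit FU) * rowVec (1 : Matrix C.gen C.gen FU) * (t.s ⊗ₖ t.pᵀ))
      default default ∣ _
    rw [Matrix.one_mul, rowVec_mul, Matrix.mul_one, t.ps]
    simp [rowVec]

/-- Coevaluation `𝔽[U] → C ⊗ C^∨`. -/
theorem coevaluation (C : AlmostIotaComplex) :
    IsAlmostLocalMap AlmostIotaComplex.trivial (C.tensor C.dual)
      (colVec (1 : Matrix C.gen C.gen FU)) := by
  have hk : ∀ M : Matrix C.gen C.gen FU, (C.d ⊗ₖ (1 : Matrix C.gen C.gen FU)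
      + (1 : Matrix C.gen C.gen FU) ⊗ₖ C.dᵀ) * colVec M = colVec (C.d * M) + colVec (M * C.d) := by
    intro M
    rw [Matrix.add_mul, mul_colVec, ← transpose_one, mul_colVec, transpose_one, Matrix.one_mul,
      Matrix.mul_one]
  have hch : ∀ F : Matrix (C.tensor C.dual).gen AlmostIotaComplex.trivial.gen FU,
      F = colVec (1 : Matrix C.gen C.gen FU) →
      F * AlmostIotaComplex.trivial.d = (C.tensor C.dual).d * F := by
    rintro _ rfl
    refine (Matrix.mul_zero _).trans (Eq.trans ?_ (hk 1).symm)
    rw [Matrix.one_mul, Matrix.mul_one]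
    exact (FU_matrix_add_self _).symm
  refine ⟨?_, hch _ rfl, ?_, ?_⟩
  · rintro ⟨i, j⟩ u n hn
    have := IsHomogeneousMap.one (g := C.gr) i j n hn
    change C.gr i + -C.gr j - 2 * (n : ℤ) = 0 + 0
    linarith
  · obtain ⟨H, E, hH, h⟩ := C.iota_sq
    refine ⟨colVec H, colVec E, ?_, ?_⟩
    · rintro ⟨i, j⟩ u n hn
      have := hH i j n hn
      change C.gr i + -C.gr j - 2 * (n : ℤ) = 0 + 1
      linarith
    · change colVec (1 : Matrix C.gen C.gen FU) * (1 : Matrix Unit Unit FU)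
        + (C.iota ⊗ₖ C.iotaᵀ) * colVec (1 : Matrix C.gen C.gen FU)
        + colVec H * (0 : Matrix Unit Unit FU)
        + (C.d ⊗ₖ (1 : Matrix C.gen C.gen FU) + (1 : Matrix C.gen C.gen FU) ⊗ₖ C.dᵀ) * colVec H
        = colVec ((X : FU) • E)
      rw [hk, mul_colVec, ← h, Matrix.mul_one, Matrix.mul_zero, add_zero, Matrix.mul_one]
      simp only [colVec_add]
      abel
  · obtain ⟨t⟩ := C.exists_splitting
    refine (bijective_locHomologyMap_iff (hch _ rfl) trivialSplitting (t.tensor t.dual)).2 ⟨t.k, ?_⟩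
    change ((t.p ⊗ₖ t.sᵀ) * colVec (1 : Matrix C.gen C.gen FU) * (1 : Matrix Unit Unit FU))
      default default ∣ _
    rw [Matrix.mul_one, mul_colVec, Matrix.mul_one, t.ps]
    simp [colVec]

end IsAlmostLocalMap

namespace AlmostLocallyEquivalent

theorem of_equiv {C D : AlmostIotaComplex} (e : C.gen ≃ D.gen) (hgr : ∀ i, D.gr (e i) = C.gr i)
    (hd : ∀ i j, D.d (e i) (e j) = C.d i j) (hi : ∀ i j, D.iota (e i) (e j) = C.iota i j) :
    AlmostLocallyEquivalent C D :=
  ⟨⟨_, IsAlmostLocalMap.of_equiv e hgr hd hi⟩,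
    ⟨_, IsAlmostLocalMap.of_equiv e.symm (fun i => by simp [← hgr]) (fun i j => by simp [← hd])
      (fun i j => by simp [← hi])⟩⟩

theorem refl (C : AlmostIotaComplex) : AlmostLocallyEquivalent C C :=
  of_equiv (Equiv.refl _) (fun _ => rfl) (fun _ _ => rfl) (fun _ _ => rfl)

theorem symm {C D : AlmostIotaComplex} (h : AlmostLocallyEquivalent C D) :
    AlmostLocallyEquivalent D C := ⟨h.2, h.1⟩

theorem trans {C D E : AlmostIotaComplex} (h : AlmostLocallyEquivalent C D)
    (h' : AlmostLocallyEquivalent D E) : AlmostLocallyEquivalent C E := by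
  obtain ⟨⟨f, hf⟩, ⟨g, hg⟩⟩ := h
  obtain ⟨⟨f', hf'⟩, ⟨g', hg'⟩⟩ := h'
  exact ⟨⟨_, hf'.comp hf⟩, ⟨_, hg.comp hg'⟩⟩

theorem tensor {C D C' D' : AlmostIotaComplex} (h : AlmostLocallyEquivalent C C')
    (h' : AlmostLocallyEquivalent D D') : AlmostLocallyEquivalent (C.tensor D) (C'.tensor D') := by
  obtain ⟨⟨f, hf⟩, ⟨g, hg⟩⟩ := h
  obtain ⟨⟨f', hf'⟩, ⟨g', hg'⟩⟩ := h'
  exact ⟨⟨_, hf.tensor hf'⟩, ⟨_, hg.tensor hg'⟩⟩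

theorem dual {C D : AlmostIotaComplex} (h : AlmostLocallyEquivalent C D) :
    AlmostLocallyEquivalent C.dual D.dual := by
  obtain ⟨⟨f, hf⟩, ⟨g, hg⟩⟩ := h
  exact ⟨⟨_, hg.dual⟩, ⟨_, hf.dual⟩⟩

theorem tensor_comm (C D : AlmostIotaComplex) :
    AlmostLocallyEquivalent (C.tensor D) (D.tensor C) := by
  refine of_equiv (C := C.tensor D) (D := D.tensor C) (Equiv.prodComm C.gen D.gen)
    ?_ ?_ ?_
  · rintro ⟨i, j⟩
    exact add_comm (D.gr j) (C.gr i)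
  · rintro ⟨i, j⟩ ⟨i', j'⟩
    change D.d j j' * (1 : Matrix C.gen C.gen FU) i i' + (1 : Matrix D.gen D.gen FU) j j' * C.d i i'
      = C.d i i' * (1 : Matrix D.gen D.gen FU) j j' + (1 : Matrix C.gen C.gen FU) i i' * D.d j j'
    ring
  · rintro ⟨i, j⟩ ⟨i', j'⟩
    exact mul_comm (D.iota j j') (C.iota i i')

theorem tensor_assoc (C D E : AlmostIotaComplex) :
    AlmostLocallyEquivalent ((C.tensor D).tensor E) (C.tensor (D.tensor E)) := by
  refine of_equiv (C := (C.tensor D).tensor E) (D := C.tensor (D.tensor E))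
    (Equiv.prodAssoc C.gen D.gen E.gen) ?_ ?_ ?_
  · rintro ⟨⟨i, j⟩, k⟩
    exact (add_assoc (C.gr i) (D.gr j) (E.gr k)).symm
  · rintro ⟨⟨i, j⟩, k⟩ ⟨⟨i', j'⟩, k'⟩
    change C.d i i' * (1 : Matrix (D.gen × E.gen) (D.gen × E.gen) FU) (j, k) (j', k')
        + (1 : Matrix C.gen C.gen FU) i i' * (D.d j j' * (1 : Matrix E.gen E.gen FU) k k'
          + (1 : Matrix D.gen D.gen FU) j j' * E.d k k')
      = (C.d i i' * (1 : Matrix D.gen D.gen FU) j j'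
          + (1 : Matrix C.gen C.gen FU) i i' * D.d j j') * (1 : Matrix E.gen E.gen FU) k k'
        + (1 : Matrix (C.gen × D.gen) (C.gen × D.gen) FU) (i, j) (i', j') * E.d k k'
    rw [← one_kronecker_one (m := D.gen) (n := E.gen), ← one_kronecker_one (m := C.gen) (n := D.gen),
      kronecker_apply, kronecker_apply]
    ring
  · rintro ⟨⟨i, j⟩, k⟩ ⟨⟨i', j'⟩, k'⟩
    exact (mul_assoc (C.iota i i') (D.iota j j') (E.iota k k')).symm

theorem trivial_tensor (C : AlmostIotaComplex) :
    AlmostLocallyEquivalent (AlmostIotaComplex.trivial.tensor C) C := by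
  refine of_equiv (C := AlmostIotaComplex.trivial.tensor C) (D := C)
    (Equiv.punitProd C.gen) ?_ ?_ ?_
  · rintro ⟨u, i⟩
    exact (zero_add (C.gr i)).symm
  · rintro ⟨u, i⟩ ⟨u', i'⟩
    change C.d i i' = 0 * (1 : Matrix C.gen C.gen FU) i i' + (1 : Matrix Unit Unit FU) u u' * C.d i i'
    rw [show (1 : Matrix Unit Unit FU) u u' = 1 from one_apply_eq (), zero_mul, zero_add, one_mul]
  · rintro ⟨u, i⟩ ⟨u', i'⟩
    change C.iota i i' = (1 : Matrix Unit Unit FU) u u' * C.iota i i'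
    rw [show (1 : Matrix Unit Unit FU) u u' = 1 from one_apply_eq (), one_mul]

theorem dual_tensor (C : AlmostIotaComplex) :
    AlmostLocallyEquivalent (C.dual.tensor C) AlmostIotaComplex.trivial :=
  (tensor_comm _ _).trans
    ⟨⟨_, IsAlmostLocalMap.evaluation C⟩, ⟨_, IsAlmostLocalMap.coevaluation C⟩⟩

end AlmostLocallyEquivalent

/-! ### The group of almost `ι`-complexes modulo almost local equivalence -/

instance almostLocalSetoid : Setoid AlmostIotaComplex where
  r := AlmostLocallyEquivalent
  iseqv := ⟨AlmostLocallyEquivalent.refl, AlmostLocallyEquivalent.symm,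
    AlmostLocallyEquivalent.trans⟩

/-- The set of almost local equivalence classes of almost `ι`-complexes. -/
def AlmostLocalGroup : Type 1 := Quotient almostLocalSetoid

namespace AlmostLocalGroup

/-- The almost local equivalence class of an almost `ι`-complex. -/
def mk (C : AlmostIotaComplex) : AlmostLocalGroup := Quotient.mk almostLocalSetoid C

/-- Addition is tensor product. -/
instance : Add AlmostLocalGroup :=
  ⟨Quotient.map₂ AlmostIotaComplex.tensor fun _ _ h _ _ h' => h.tensor h'⟩

/-- Zero is the class of `𝔽[U]` with the identity involution. -/
instance : Zero AlmostLocalGroup := ⟨mk AlmostIotaComplex.trivial⟩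

/-- Negation is dualization. -/
instance : Neg AlmostLocalGroup := ⟨Quotient.map AlmostIotaComplex.dual fun _ _ h => h.dual⟩

instance : AddCommGroup AlmostLocalGroup where
  add_assoc := by
    rintro ⟨C⟩ ⟨D⟩ ⟨E⟩
    exact Quotient.sound (AlmostLocallyEquivalent.tensor_assoc C D E)
  add_comm := by
    rintro ⟨C⟩ ⟨D⟩
    exact Quotient.sound (AlmostLocallyEquivalent.tensor_comm C D)
  zero_add := by
    rintro ⟨C⟩
    exact Quotient.sound (AlmostLocallyEquivalent.trivial_tensor C)
  add_zero := by
    rintro ⟨C⟩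
    exact Quotient.sound ((AlmostLocallyEquivalent.tensor_comm _ _).trans
      (AlmostLocallyEquivalent.trivial_tensor C))
  neg_add_cancel := by
    rintro ⟨C⟩
    exact Quotient.sound (AlmostLocallyEquivalent.dual_tensor C)
  nsmul := nsmulRec
  zsmul := zsmulRec

end AlmostLocalGroup

/-! ### Standard complexes -/

/-- Parameters `(a₁, b₂, …, a_{2m-1}, b_{2m})` of a standard complex, as the list of the `m` pairs
`(a_{2l+1}, b_{2l+2})`; a sign is a unit of `ℤ` and the `b`'s are nonzero integers. -/
abbrev StandardParams : Type := List (ℤˣ × {b : ℤ // b ≠ 0})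

namespace StandardParams

variable (L : StandardParams)

/-- The sign `a_{2l+1}`. -/
def a (l : Fin L.length) : ℤˣ := (L.get l).1

/-- The integer `b_{2l+2}`. -/
def b (l : Fin L.length) : ℤ := (L.get l).2.1

theorem b_ne_zero (l : Fin L.length) : L.b l ≠ 0 := (L.get l).2.2

/-- The generator `t_{2l}`. -/
def t₀ (l : Fin L.length) : Fin (2 * L.length + 1) := ⟨2 * l, by omega⟩

/-- The generator `t_{2l+1}`. -/
def t₁ (l : Fin L.length) : Fin (2 * L.length + 1) := ⟨2 * l + 1, by omega⟩

/-- The generator `t_{2l+2}`. -/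
def t₂ (l : Fin L.length) : Fin (2 * L.length + 1) := ⟨2 * l + 2, by omega⟩

/-- `∂ (t_{2l+2}) = U ^ |b| t_{2l+1}` if `b = b_{2l+2} > 0`, and
`∂ (t_{2l+1}) = U ^ |b| t_{2l+2}` if `b < 0`: the generator that is mapped. -/
def dSource (l : Fin L.length) : Fin (2 * L.length + 1) := if 0 < L.b l then L.t₂ l else L.t₁ l

/-- The generator to a multiple of which `dSource` is mapped by the differential. -/
def dTarget (l : Fin L.length) : Fin (2 * L.length + 1) := if 0 < L.b l then L.t₁ l else L.t₂ l

/-- `ω (t_{2l+1}) = t_{2l}` if `a_{2l+1} = +`, and `ω (t_{2l}) = t_{2l+1}` if `a_{2l+1} = -`: the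
generator that is mapped. -/
def omegaSource (l : Fin L.length) : Fin (2 * L.length + 1) := if L.a l = 1 then L.t₁ l else L.t₀ l

/-- The generator to which `omegaSource` is mapped by `ω`. -/
def omegaTarget (l : Fin L.length) : Fin (2 * L.length + 1) := if L.a l = 1 then L.t₀ l else L.t₁ l

/-- The grading of `t_i`.  It is determined by `gr t_0 = 0`, by `ω` preserving the grading and by
`∂` lowering it by one: `t_{2l+1}` has the grading of `t_{2l}`, and the grading of `t_{2l+2}` is
that of `t_{2l+1}` plus `sgn b - 2 b` for `b = b_{2l+2}`. -/
def gr (i : Fin (2 * L.length + 1)) : ℤ :=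
  ∑ l : Fin L.length, if 2 * (l : ℕ) + 2 ≤ i then (L.b l).sign - 2 * L.b l else 0

/-- The differential of the standard complex. -/
def d : Matrix (Fin (2 * L.length + 1)) (Fin (2 * L.length + 1)) FU :=
  ∑ l, single (L.dTarget l) (L.dSource l) ((X : FU) ^ (L.b l).natAbs)

/-- The map `ω = 1 + ι` of the standard complex. -/
def omega : Matrix (Fin (2 * L.length + 1)) (Fin (2 * L.length + 1)) FU :=
  ∑ l, single (L.omegaTarget l) (L.omegaSource l) (1 : FU)

theorem dSource_ne_dTarget (l l' : Fin L.length) : L.dSource l ≠ L.dTarget l' := by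
  unfold dSource dTarget t₁ t₂
  by_cases h : l = l'
  · subst h
    split_ifs <;> simp
  · have : (l : ℕ) ≠ l' := fun h' => h (Fin.ext h')
    split_ifs <;> simp only [ne_eq, Fin.mk.injEq] <;> omega

theorem dSource_injective : Function.Injective L.dSource := by
  intro l l' h
  unfold dSource t₁ t₂ at h
  apply Fin.ext
  split_ifs at h <;> simp only [Fin.mk.injEq] at h <;> omega

theorem dTarget_injective : Function.Injective L.dTarget := by
  intro l l' h
  unfold dTarget t₁ t₂ at h
  apply Fin.ext
  split_ifs at h <;> simp only [Fin.mk.injEq] at h <;> omega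

theorem dSource_ne_zero (l : Fin L.length) : L.dSource l ≠ 0 := by
  unfold dSource t₁ t₂
  split_ifs <;> simp [Fin.ext_iff]

theorem dTarget_ne_zero (l : Fin L.length) : L.dTarget l ≠ 0 := by
  unfold dTarget t₁ t₂
  split_ifs <;> simp [Fin.ext_iff]

theorem omegaSource_ne_omegaTarget (l l' : Fin L.length) : L.omegaSource l ≠ L.omegaTarget l' := by
  unfold omegaSource omegaTarget t₁ t₀
  by_cases h : l = l'
  · subst h
    split_ifs <;> simp
  · have : (l : ℕ) ≠ l' := fun h' => h (Fin.ext h')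
    split_ifs <;> simp only [ne_eq, Fin.mk.injEq] <;> omega

theorem gr_zero : L.gr 0 = 0 := Finset.sum_eq_zero fun l _ => by simp

theorem gr_t₁ (l : Fin L.length) : L.gr (L.t₁ l) = L.gr (L.t₀ l) := by
  refine Finset.sum_congr rfl fun l' _ => ?_
  have : 2 * (l' : ℕ) + 2 ≤ (L.t₁ l : ℕ) ↔ 2 * (l' : ℕ) + 2 ≤ (L.t₀ l : ℕ) := by
    simp only [t₁, t₀]
    omega
  simp only [this]

theorem gr_t₂ (l : Fin L.length) :
    L.gr (L.t₂ l) = L.gr (L.t₁ l) + ((L.b l).sign - 2 * L.b l) := by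
  have : ∀ l' : Fin L.length, (if 2 * (l' : ℕ) + 2 ≤ (L.t₂ l : ℕ)
        then (L.b l').sign - 2 * L.b l' else 0)
      = (if 2 * (l' : ℕ) + 2 ≤ (L.t₁ l : ℕ) then (L.b l').sign - 2 * L.b l' else 0)
        + if l' = l then (L.b l').sign - 2 * L.b l' else 0 := by
    intro l'
    simp only [t₁, t₂, Fin.ext_iff]
    split_ifs <;> omega
  unfold gr
  rw [Finset.sum_congr rfl fun l' _ => this l', Finset.sum_add_distrib, Finset.sum_ite_eq']
  simp

theorem gr_dTarget (l : Fin L.length) :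
    L.gr (L.dTarget l) - 2 * ((L.b l).natAbs : ℤ) = L.gr (L.dSource l) + -1 := by
  unfold dSource dTarget
  rcases lt_or_gt_of_ne (L.b_ne_zero l) with h | h
  · rw [if_neg (by omega), if_neg (by omega), gr_t₂, Int.sign_eq_neg_one_of_neg h]
    omega
  · rw [if_pos h, if_pos h, gr_t₂, Int.sign_eq_one_of_pos h]
    omega

theorem gr_omegaTarget (l : Fin L.length) : L.gr (L.omegaTarget l) = L.gr (L.omegaSource l) := by
  unfold omegaSource omegaTarget
  split_ifs <;> simp [gr_t₁]

end StandardParams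

theorem IsHomogeneousMap.sum_single {I J A : Type} [DecidableEq I] [DecidableEq J] [Fintype A]
    {g : I → ℤ} {g' : J → ℤ} {k : ℤ} {t : A → J} {s : A → I} {n : A → ℕ}
    (h : ∀ a, g' (t a) - 2 * (n a : ℤ) = g (s a) + k) :
    IsHomogeneousMap g g' k (∑ a, single (t a) (s a) ((X : FU) ^ n a)) := by
  intro j i m hm
  rw [Matrix.sum_apply, finsetSum_coeff] at hm
  obtain ⟨a, -, ha⟩ := Finset.exists_ne_zero_of_sum_ne_zero hm
  rw [single_apply] at ha
  by_cases hc : t a = j ∧ s a = i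
  · rw [if_pos hc, coeff_X_pow] at ha
    have hmn : m = n a := by
      by_contra hne
      simp [hne] at ha
    rw [← hc.1, ← hc.2, hmn]
    exact h a
  · rw [if_neg hc] at ha
    simp at ha

theorem sum_single_mul_sum_single {I A : Type} [Fintype I] [DecidableEq I] [Fintype A]
    {t s t' s' : A → I} {x y : A → FU} (h : ∀ a a', s a ≠ t' a') :
    (∑ a, single (t a) (s a) (x a)) * (∑ a, single (t' a) (s' a) (y a)) = (0 : Matrix I I FU) := by
  rw [Finset.sum_mul_sum]
  exact Finset.sum_eq_zero fun a _ => Finset.sum_eq_zero fun a' _ =>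
    single_mul_single_of_ne _ _ _ _ (h a a') _

theorem sum_single_mul_sum_single_same {I A : Type} [Fintype I] [DecidableEq I] [Fintype A]
    [DecidableEq A] {t s : A → I} (hs : Function.Injective s) {x y : A → FU} :
    (∑ a, single (t a) (s a) (x a)) * (∑ a, single (s a) (t a) (y a))
      = ∑ a, single (t a) (t a) (x a * y a) := by
  rw [Finset.sum_mul_sum]
  refine Finset.sum_congr rfl fun a _ => ?_
  rw [Finset.sum_eq_single a]
  · rw [single_mul_single_same]
  · intro a' _ ha'
    exact single_mul_single_of_ne _ _ _ _ (fun h => ha' (hs h).symm) _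
  · simp

namespace GradedComplex

/-- The graded complex underlying a standard complex. -/
def standard (L : StandardParams) : GradedComplex where
  gen := Fin (2 * L.length + 1)
  gr := L.gr
  d := L.d
  d_hom := IsHomogeneousMap.sum_single L.gr_dTarget
  d_sq := sum_single_mul_sum_single L.dSource_ne_dTarget

theorem diag_decomposition (L : StandardParams) (x : FU) :
    single (0 : Fin (2 * L.length + 1)) 0 x
      + (∑ l, single (L.dTarget l) (L.dTarget l) x + ∑ l, single (L.dSource l) (L.dSource l) x)
      = x • (1 : Matrix (Fin (2 * L.length + 1)) (Fin (2 * L.length + 1)) FU) := by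
  have h1 : ∑ l, single (L.dTarget l) (L.dTarget l) x + ∑ l, single (L.dSource l) (L.dSource l) x
      = ∑ l, (single (L.t₁ l) (L.t₁ l) x + single (L.t₂ l) (L.t₂ l) x) := by
    rw [← Finset.sum_add_distrib]
    refine Finset.sum_congr rfl fun l _ => ?_
    unfold StandardParams.dTarget StandardParams.dSource
    split_ifs
    · rfl
    · exact add_comm _ _
  rw [h1]
  ext1 i j
  rw [Matrix.add_apply, Matrix.sum_apply, Matrix.smul_apply]
  by_cases hij : i = j
  · subst hij
    rw [one_apply_eq, smul_eq_mul, mul_one]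
    simp only [Matrix.add_apply, single_apply, and_self]
    have hlt := i.2
    by_cases h0 : (i : ℕ) = 0
    · rw [if_pos (Fin.ext h0.symm), Finset.sum_eq_zero, add_zero]
      intro l _
      rw [if_neg, if_neg, add_zero]
      all_goals
        simp only [StandardParams.t₁, StandardParams.t₂, Fin.ext_iff]
        omega
    · rw [if_neg (by rw [Fin.ext_iff]; exact fun h => h0 h.symm), zero_add,
        Finset.sum_eq_single ⟨((i : ℕ) - 1) / 2, by omega⟩]
      · simp only [StandardParams.t₁, StandardParams.t₂, Fin.ext_iff]
        split_ifs <;> first | omega | simp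
      · intro l _ hl
        rw [ne_eq, Fin.ext_iff] at hl
        dsimp only at hl
        rw [if_neg, if_neg, add_zero]
        all_goals
          simp only [StandardParams.t₁, StandardParams.t₂, Fin.ext_iff]
          omega
      · simp
  · have hs : ∀ a : Fin (2 * L.length + 1), single a a x i j = 0 := fun a => by
      rw [single_apply, if_neg]
      rintro ⟨rfl, rfl⟩
      exact hij rfl
    rw [hs, one_apply_ne hij, smul_zero, zero_add]
    exact Finset.sum_eq_zero fun l _ => by rw [Matrix.add_apply, hs, hs, add_zero]

/-- The tower of a standard complex, generated by `t_0`. -/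
def standardSplitting (L : StandardParams) : TowerSplitting (standard L) Unit where
  s := (single 0 () 1 : Matrix (Fin (2 * L.length + 1)) Unit FU)
  p := (single () 0 (X ^ ∑ l, (L.b l).natAbs) : Matrix Unit (Fin (2 * L.length + 1)) FU)
  h := (∑ l, single (L.dSource l) (L.dTarget l) (X ^ ((∑ l, (L.b l).natAbs) - (L.b l).natAbs)) :
    Matrix (Fin (2 * L.length + 1)) (Fin (2 * L.length + 1)) FU)
  k := ∑ l, (L.b l).natAbs
  ds := by
    change (∑ l, single (L.dTarget l) (L.dSource l) ((X : FU) ^ (L.b l).natAbs))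
      * (single 0 () 1 : Matrix (Fin (2 * L.length + 1)) Unit FU) = 0
    rw [Matrix.sum_mul]
    exact Finset.sum_eq_zero fun l _ => single_mul_single_of_ne _ _ _ _ (L.dSource_ne_zero l) _
  pd := by
    change (single () 0 (X ^ ∑ l, (L.b l).natAbs) : Matrix Unit (Fin (2 * L.length + 1)) FU)
      * (∑ l, single (L.dTarget l) (L.dSource l) ((X : FU) ^ (L.b l).natAbs)) = 0
    rw [Matrix.mul_sum]
    exact Finset.sum_eq_zero fun l _ =>
      single_mul_single_of_ne _ _ _ _ (L.dTarget_ne_zero l).symm _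
  ps := by
    change (single () 0 (X ^ ∑ l, (L.b l).natAbs) : Matrix Unit (Fin (2 * L.length + 1)) FU)
      * (single 0 () 1 : Matrix (Fin (2 * L.length + 1)) Unit FU) = _
    rw [single_mul_single_same, mul_one]
    ext1 i j
    simp
  sp := by
    change (single 0 () 1 : Matrix (Fin (2 * L.length + 1)) Unit FU)
      * (single () 0 (X ^ ∑ l, (L.b l).natAbs) : Matrix Unit (Fin (2 * L.length + 1)) FU)
      + ((∑ l, single (L.dTarget l) (L.dSource l) ((X : FU) ^ (L.b l).natAbs))
        * (∑ l, single (L.dSource l) (L.dTarget l)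
          ((X : FU) ^ ((∑ l, (L.b l).natAbs) - (L.b l).natAbs)))
      + (∑ l, single (L.dSource l) (L.dTarget l)
          ((X : FU) ^ ((∑ l, (L.b l).natAbs) - (L.b l).natAbs)))
        * (∑ l, single (L.dTarget l) (L.dSource l) ((X : FU) ^ (L.b l).natAbs)))
      = X ^ (∑ l, (L.b l).natAbs)
        • (1 : Matrix (Fin (2 * L.length + 1)) (Fin (2 * L.length + 1)) FU)
    have hle : ∀ l, (L.b l).natAbs ≤ ∑ l, (L.b l).natAbs := fun l =>
      Finset.single_le_sum (f := fun l => (L.b l).natAbs) (fun _ _ => Nat.zero_le _)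
        (Finset.mem_univ l)
    rw [sum_single_mul_sum_single_same L.dSource_injective,
      sum_single_mul_sum_single_same L.dTarget_injective, single_mul_single_same, one_mul]
    simp only [← pow_add, Nat.add_sub_cancel' (hle _), Nat.sub_add_cancel (hle _)]
    exact diag_decomposition L _
  s_even := by
    intro i j hi
    refine (single_apply _ _ _ _ _).trans (if_neg ?_)
    rintro ⟨rfl, -⟩
    exact hi (by change Even (L.gr 0); rw [L.gr_zero]; simp)
  p_even := by
    intro j i hi
    refine (single_apply _ _ _ _ _).trans (if_neg ?_)
    rintro ⟨-, rfl⟩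
    exact hi (by change Even (L.gr 0); rw [L.gr_zero]; simp)

end GradedComplex

namespace StandardParams

variable (L : StandardParams)

/-- The almost involution `ι = 1 + ω` of the standard complex. -/
def iota : Matrix (Fin (2 * L.length + 1)) (Fin (2 * L.length + 1)) FU := 1 + L.omega

theorem iota_hom : IsHomogeneousMap L.gr L.gr 0 L.iota := by
  refine IsHomogeneousMap.one.add ?_
  have := IsHomogeneousMap.sum_single (g := L.gr) (g' := L.gr) (k := 0) (t := L.omegaTarget)
    (s := L.omegaSource) (n := fun _ => 0) (fun l => by simp [L.gr_omegaTarget l])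
  simp only [pow_zero] at this
  exact this

theorem iota_comm : ∃ E : Matrix (Fin (2 * L.length + 1)) (Fin (2 * L.length + 1)) FU,
    L.iota * L.d + L.d * L.iota = (X : FU) • E := by
  obtain ⟨E, hE⟩ : ∃ E, L.d = (X : FU) • E := by
    refine ⟨∑ l, single (L.dTarget l) (L.dSource l) ((X : FU) ^ ((L.b l).natAbs - 1)), ?_⟩
    rw [Finset.smul_sum]
    refine Finset.sum_congr rfl fun l _ => ?_
    rw [smul_single, smul_eq_mul, ← pow_succ', Nat.sub_add_cancel]
    exact Int.natAbs_pos.2 (L.b_ne_zero l)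
  exact ⟨L.iota * E + E * L.iota, by
    rw [smul_add, ← Matrix.mul_smul, ← Matrix.smul_mul, ← hE]⟩

theorem iota_mul_iota : L.iota * L.iota = 1 := by
  have h : L.omega * L.omega = 0 := sum_single_mul_sum_single L.omegaSource_ne_omegaTarget
  rw [iota, Matrix.mul_add, Matrix.add_mul, Matrix.add_mul, h, Matrix.one_mul, Matrix.one_mul,
    Matrix.mul_one, add_zero]
  exact FU_matrix_eq_of_eq_add L.omega (add_assoc _ _ _)

end StandardParams

/-- The standard complex `C(a₁, b₂, …, a_{2m-1}, b_{2m})`. -/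
def AlmostIotaComplex.standard (L : StandardParams) : AlmostIotaComplex where
  toGradedComplex := GradedComplex.standard L
  tower := (GradedComplex.standardSplitting L).hasEvenTower
  iota := L.iota
  iota_hom := L.iota_hom
  iota_comm := L.iota_comm
  iota_sq := by
    refine ⟨0, 0, IsHomogeneousMap.zero, ?_⟩
    rw [Matrix.zero_mul, Matrix.mul_zero, add_zero, add_zero, smul_zero]
    exact FU_matrix_add_eq_zero L.iota_mul_iota

/-- The sequence `L` is the standard representative of the class `x`: the standard complex of type
`L` represents `x`, and it is the only standard complex which does. -/
def IsStandardRepresentative (x : AlmostLocalGroup) (L : StandardParams) : Prop :=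
  AlmostLocalGroup.mk (AlmostIotaComplex.standard L) = x ∧
    ∀ L' : StandardParams, AlmostLocalGroup.mk (AlmostIotaComplex.standard L') = x → L' = L

/-- For a sign `ε` the parameters of `ε C(n)`: they are `(+, -1, +, -n)` for `C(n)` and
`(-, 1, -, n)` for `-C(n)`. -/
def boxParams (ε : ℤˣ) (n : ℕ+) : StandardParams :=
  [(ε, ⟨-(ε : ℤ), neg_ne_zero.2 ε.ne_zero⟩),
    (ε, ⟨-((ε : ℤ) * (n : ℤ)), neg_ne_zero.2 (mul_ne_zero ε.ne_zero (by simp))⟩)]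

/-- The almost `ι`-complex `C(n) = C(+, -1, +, -n)`. -/
def boxComplex (n : ℕ+) : AlmostIotaComplex := AlmostIotaComplex.standard (boxParams 1 n)

end

/-! Two things have to be shown: the standard complex of the concatenated sequence is almost locally
equivalent to the tensor product of the `ε_i C(n_i)`, and different sequences give inequivalent
standard complexes.

For the first, suppose that the differential of `D` vanishes modulo `U`. A map from a standard
complex to `D` is then given by a walk: homogeneous elements of `D` obeying the relations among the
`t_i`, exactly for `∂` and modulo `U` for `ω`. If the first element is a cycle generating the tower,
the map is almost local (`exists_isAlmostLocalMap_of_walk`). So a walk of the concatenated type in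
the tensor product (`exists_walk_boxTensorList`) gives one almost local map. The same construction
for the negated sum, dualized, gives a map in the other direction (`mk_standard_boxList`).

The walk is built by adding one tensor factor on the left. Given a walk in `E` starting at a cycle
`s`, the first guess in `ε C(n) ⊗ E` is `t_0 ⊗ s, ..., t_4 ⊗ s` followed by `t_4 ⊗` (rest of the
walk). Two effects spoil it. On a tensor product `ω` becomes `ω ⊗ (1 + ω) + 1 ⊗ ω`, which produces
extra terms when `ω s` is nonzero modulo `U`, that is, when the walk in `E` starts with a negative
box. And for `ε = -1` the generator `t_4` is not a cycle, since `∂ t_4 = U^n t_3`. The correction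
terms needed to restore the `∂` relations come with factors such as `U^(n-1)`, `U^(n-|b|)` and
`U^(n-n')`; those with positive exponent do not disturb the `ω` relations. This is where `n > 1`,
the decreasing order and full simplification enter. Only for repeated copies of `-C(n)` does a
correction with exponent `n - n' = 0` survive, as a term `t_0 ⊗ s_4`; the induction in
`Walk.box_neg_one` then continues from that term.

For the second, an almost local map between standard complexes forces a lexicographic inequality
between the parameter sequences (`IsAlmostLocalMap.lexLE`), because a nonzero constant coefficient
from `t_i` to `t_i` propagates along the sequences until they first differ. Maps in both directions
therefore force equality.

A nontrivial integral relation among the `[C(n)]` would be a nonempty fully simplified sum of class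
zero. Its standard representative is nonempty, whereas that of zero is the empty sequence. -/

noncomputable section

/-! ### Homogeneous vectors and reduction modulo `U` -/

/-- The vector `x` is a homogeneous element of degree `g` of the free module with basis gradings
`gr`. -/
def IsHomogeneousVec {I : Type} (gr : I → ℤ) (g : ℤ) (x : I → FU) : Prop :=
  ∀ j n, (x j).coeff n ≠ 0 → gr j - 2 * (n : ℤ) = g

namespace IsHomogeneousVec

variable {I : Type} {gr : I → ℤ} {g : ℤ} {x y : I → FU}

theorem zero : IsHomogeneousVec gr g (0 : I → FU) := by
  intro j n hn
  simp at hn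

theorem add (hx : IsHomogeneousVec gr g x) (hy : IsHomogeneousVec gr g y) :
    IsHomogeneousVec gr g (x + y) := by
  intro j n hn
  by_cases h1 : (x j).coeff n = 0
  · refine hy j n fun h2 => hn ?_
    simp [h1, h2]
  · exact hx j n h1

theorem pow_smul (hx : IsHomogeneousVec gr g x) {k : ℕ} {g' : ℤ} (hg : g' = g - 2 * k) :
    IsHomogeneousVec gr g' ((X : FU) ^ k • x) := by
  intro j n hn
  rw [Pi.smul_apply, smul_eq_mul, coeff_X_pow_mul'] at hn
  split_ifs at hn with h
  · have := hx j _ hn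
    push_cast [h] at this
    linarith
  · exact absurd rfl hn

theorem smul (hx : IsHomogeneousVec gr g x) {g' : ℤ} (hg : g' = g - 2) :
    IsHomogeneousVec gr g' ((X : FU) • x) := by
  simpa using hx.pow_smul (k := 1) (g' := g') (by simpa using hg)

theorem congr (hx : IsHomogeneousVec gr g x) {g' : ℤ} (hg : g' = g) :
    IsHomogeneousVec gr g' x := hg ▸ hx

end IsHomogeneousVec

/-- Reduction modulo `U`, i.e. passing to constant terms. -/
def redU {I : Type} : (I → FU) →+ (I → ZMod 2) where
  toFun x i := (x i).coeff 0
  map_zero' := by ext1 i; simp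
  map_add' x y := by ext1 i; simp

theorem redU_apply {I : Type} (x : I → FU) (i : I) : redU x i = (x i).coeff 0 := rfl

@[simp] theorem redU_X_smul {I : Type} (x : I → FU) : redU ((X : FU) • x) = 0 := by
  ext1 i
  simp [redU_apply]

@[simp] theorem redU_X_pow_succ_smul {I : Type} (k : ℕ) (x : I → FU) :
    redU ((X : FU) ^ (k + 1) • x) = 0 := by
  rw [pow_succ', mul_smul, redU_X_smul]

theorem redU_eq_iff {I : Type} {x y : I → FU} :
    redU x = redU y ↔ ∃ e : I → FU, x + y = (X : FU) • e := by
  constructor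
  · intro h
    have : ∀ i, (X : FU) ∣ x i + y i := fun i => by
      have hi : (x i).coeff 0 = (y i).coeff 0 := congrFun h i
      rw [X_dvd_iff, coeff_add, hi]
      exact CharTwo.add_self_eq_zero _
    choose e he using this
    exact ⟨e, funext he⟩
  · rintro ⟨e, he⟩
    have h := congrArg redU he
    rw [map_add, redU_X_smul] at h
    ext1 i
    exact CharTwo.add_eq_zero.1 (congrFun h i)

theorem redU_mulVec_congr {I J : Type} [Fintype I] (M : Matrix J I FU) {x y : I → FU}
    (h : redU x = redU y) : redU (M *ᵥ x) = redU (M *ᵥ y) := by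
  obtain ⟨e, he⟩ := redU_eq_iff.1 h
  exact redU_eq_iff.2 ⟨M *ᵥ e, by rw [← mulVec_add, he, mulVec_smul]⟩

theorem FU_vec_add_self {I : Type} (x : I → FU) : x + x = 0 := by
  ext1 i
  exact CharTwo.add_self_eq_zero (x i)

theorem FU_vec_add_add_cancel {I : Type} (x y : I → FU) : x + (x + y) = y := by
  rw [← add_assoc, FU_vec_add_self, zero_add]

theorem ZMod_two_vec_add_self {I : Type} (x : I → ZMod 2) : x + x = 0 := by
  ext1 i
  exact CharTwo.add_self_eq_zero (x i)

/-! ### Reduced complexes and walks in them. -/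

namespace AlmostIotaComplex

/-- The map `ω = 1 + ι`. -/
def omega (D : AlmostIotaComplex) : Matrix D.gen D.gen FU := 1 + D.iota

/-- A complex is reduced if its differential vanishes modulo `U`. -/
def IsReduced (D : AlmostIotaComplex) : Prop := ∃ E : Matrix D.gen D.gen FU, D.d = (X : FU) • E

theorem iota_mulVec (D : AlmostIotaComplex) (x : D.gen → FU) :
    D.iota *ᵥ x = x + D.omega *ᵥ x := by
  rw [omega, add_mulVec, one_mulVec, FU_vec_add_add_cancel]

/-- In characteristic two `ω² = ι² + 1`, which is `H∂ + ∂H` modulo `U`; both terms contain `∂` and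
so vanish modulo `U` in a reduced complex. -/
theorem IsReduced.redU_omega_omega {D : AlmostIotaComplex} (hD : D.IsReduced) (x : D.gen → FU) :
    redU (D.omega *ᵥ (D.omega *ᵥ x)) = 0 := by
  obtain ⟨E, hE⟩ := hD
  obtain ⟨H, G, -, hG⟩ := D.iota_sq
  rw [← map_zero redU, redU_eq_iff]
  refine ⟨(G + H * E + E * H) *ᵥ x, ?_⟩
  have h2 : D.omega * D.omega = D.iota * D.iota + 1 := by
    rw [omega, Matrix.mul_add, Matrix.mul_one, Matrix.add_mul, Matrix.one_mul]
    refine FU_matrix_eq_of_eq_add D.iota ?_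
    abel
  have h3 : D.iota * D.iota + 1 = (X : FU) • (G + H * E + E * H) := by
    rw [smul_add, smul_add, ← hG, ← Matrix.mul_smul, ← Matrix.smul_mul, ← hE]
    refine (FU_matrix_eq_of_eq_add (H * D.d + D.d * H) ?_).symm
    abel
  rw [add_zero, mulVec_mulVec, h2, h3, smul_mulVec]

/-- Supplies the relations `ω t_i = 0` that a walk does not record: whatever is hit by `ω` is killed
by it. -/
theorem IsReduced.redU_omega_of_eq {D : AlmostIotaComplex} (hD : D.IsReduced) {x y : D.gen → FU}
    (h : redU (D.omega *ᵥ x) = redU y) : redU (D.omega *ᵥ y) = 0 := by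
  rw [← redU_mulVec_congr D.omega h, hD.redU_omega_omega]

theorem IsReduced.tensor {C D : AlmostIotaComplex} (hC : C.IsReduced) (hD : D.IsReduced) :
    (C.tensor D).IsReduced := by
  obtain ⟨E, hE⟩ := hC
  obtain ⟨F, hF⟩ := hD
  have key : C.d ⊗ₖ (1 : Matrix D.gen D.gen FU) + (1 : Matrix C.gen C.gen FU) ⊗ₖ D.d
      = (X : FU) • (E ⊗ₖ (1 : Matrix D.gen D.gen FU) + (1 : Matrix C.gen C.gen FU) ⊗ₖ F) := by
    rw [smul_add, ← smul_kronecker, ← kronecker_smul, ← hE, ← hF]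
  exact ⟨_, key⟩

theorem isReduced_trivial : AlmostIotaComplex.trivial.IsReduced :=
  ⟨0, (smul_zero (M := FU) (A := Matrix Unit Unit FU) X).symm⟩

theorem isReduced_standard (L : StandardParams) : (AlmostIotaComplex.standard L).IsReduced := by
  have key : L.d = (X : FU) • (∑ l, single (L.dTarget l) (L.dSource l)
      ((X : FU) ^ ((L.b l).natAbs - 1))) := by
    rw [StandardParams.d, Finset.smul_sum]
    refine Finset.sum_congr rfl fun l _ => ?_
    rw [smul_single, smul_eq_mul, ← pow_succ', Nat.sub_add_cancel]
    exact Int.natAbs_pos.2 (L.b_ne_zero l)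
  exact ⟨_, key⟩

theorem d_d (D : AlmostIotaComplex) (x : D.gen → FU) : D.d *ᵥ (D.d *ᵥ x) = 0 := by
  rw [mulVec_mulVec, D.d_sq, zero_mulVec]

/-- The module is torsion free, so a power of `U` can be cancelled from `∂∂x = 0`. This is the
analogue for `∂` of `redU_omega_of_eq`. -/
theorem d_eq_zero_of_eq (D : AlmostIotaComplex) {x y : D.gen → FU} {k : ℕ}
    (h : D.d *ᵥ x = (X : FU) ^ k • y) : D.d *ᵥ y = 0 := by
  refine GradedComplex.X_pow_smul_cancel (k := k) ?_
  rw [← mulVec_smul, ← h, D.d_d]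

/-- `Walk D L g x`: the homogeneous element `x` of degree `g` is the first of a sequence of elements
which satisfy the relations between the generators of the standard complex of type `L`, those for
`ω` modulo `U`. -/
def Walk (D : AlmostIotaComplex) : StandardParams → ℤ → (D.gen → FU) → Prop
  | [], g, x => IsHomogeneousVec D.gr g x ∧ redU (D.omega *ᵥ x) = 0
  | p :: L, g, x => IsHomogeneousVec D.gr g x ∧ ∃ x₁ x₂, IsHomogeneousVec D.gr g x₁ ∧
      (p.1 = 1 → redU (D.omega *ᵥ x₁) = redU x) ∧ (p.1 = -1 → redU (D.omega *ᵥ x) = redU x₁) ∧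
      (p.2.1 < 0 → D.d *ᵥ x₁ = (X : FU) ^ p.2.1.natAbs • x₂) ∧
      (0 < p.2.1 → D.d *ᵥ x₂ = (X : FU) ^ p.2.1.natAbs • x₁) ∧
      -- The degree shift is the grading difference between `t_{2l+2}` and `t_{2l+1}` in a standard
      -- complex.
      Walk D L (g + (p.2.1.sign - 2 * p.2.1)) x₂

theorem Walk.hom {D : AlmostIotaComplex} {L : StandardParams} {g : ℤ} {x : D.gen → FU}
    (h : D.Walk L g x) : IsHomogeneousVec D.gr g x := by
  cases L <;> exact h.1

theorem Walk.congr {D : AlmostIotaComplex} {L : StandardParams} {g g' : ℤ} {x x' : D.gen → FU}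
    (h : D.Walk L g x) (hg : g' = g) (hx : x' = x) : D.Walk L g' x' := by
  rw [hg, hx]
  exact h

theorem units_int_one_ne_neg_one : (1 : ℤˣ) ≠ -1 := by decide

/-- The pattern of `C(n)` is `x ← x₁ → x₂ ← x₃ → x₄`, with `ω` pointing left and `∂` pointing right.
In the form for `-C(n)` below all four arrows are reversed. -/
theorem walk_boxParams_one_append {D : AlmostIotaComplex} {n : ℕ+} {L : StandardParams} {g : ℤ}
    {x : D.gen → FU} : D.Walk (boxParams 1 n ++ L) g x ↔ IsHomogeneousVec D.gr g x ∧
      ∃ x₁ x₂ x₃ x₄, IsHomogeneousVec D.gr g x₁ ∧ IsHomogeneousVec D.gr (g + 1) x₂ ∧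
        IsHomogeneousVec D.gr (g + 1) x₃ ∧ redU (D.omega *ᵥ x₁) = redU x ∧
        D.d *ᵥ x₁ = (X : FU) • x₂ ∧ redU (D.omega *ᵥ x₃) = redU x₂ ∧
        D.d *ᵥ x₃ = (X : FU) ^ (n : ℕ) • x₄ ∧ D.Walk L (g + 2 * n) x₄ := by
  have hn : (0 : ℤ) < n := by exact_mod_cast n.pos
  have hs : Int.sign (-(n : ℤ)) = -1 := Int.sign_eq_neg_one_of_neg (by omega)
  have e1 : g + (-1 - 2 * -1) = g + 1 := by ring
  have e2 : g + 1 + (-1 - 2 * -(n : ℤ)) = g + 2 * n := by ring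
  simp only [boxParams, List.cons_append, List.nil_append, Walk, units_int_one_ne_neg_one,
    Units.val_one, one_mul, forall_true_left, false_imp_iff, true_and, hs, Int.sign_neg,
    Int.sign_one, Left.neg_neg_iff, zero_lt_one, hn, Left.neg_pos_iff, not_lt.2 hn.le,
    not_lt.2 (zero_le_one (α := ℤ)), Int.natAbs_neg, Int.natAbs_one, pow_one, Int.natAbs_natCast,
    e1, e2]
  constructor
  · rintro ⟨h0, x₁, x₂, h1, h2, h3, h4, x₃, x₄, h5, h6, h7, h8⟩
    exact ⟨h0, x₁, x₂, x₃, x₄, h1, h4, h5, h2, h3, h6, h7, h8⟩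
  · rintro ⟨h0, x₁, x₂, x₃, x₄, h1, h4, h5, h2, h3, h6, h7, h8⟩
    exact ⟨h0, x₁, x₂, h1, h2, h3, h4, x₃, x₄, h5, h6, h7, h8⟩

theorem walk_boxParams_neg_one_append {D : AlmostIotaComplex} {n : ℕ+} {L : StandardParams} {g : ℤ}
    {x : D.gen → FU} : D.Walk (boxParams (-1) n ++ L) g x ↔ IsHomogeneousVec D.gr g x ∧
      ∃ x₁ x₂ x₃ x₄, IsHomogeneousVec D.gr g x₁ ∧ IsHomogeneousVec D.gr (g - 1) x₂ ∧
        IsHomogeneousVec D.gr (g - 1) x₃ ∧ redU (D.omega *ᵥ x) = redU x₁ ∧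
        D.d *ᵥ x₂ = (X : FU) • x₁ ∧ redU (D.omega *ᵥ x₂) = redU x₃ ∧
        D.d *ᵥ x₄ = (X : FU) ^ (n : ℕ) • x₃ ∧ D.Walk L (g - 2 * n) x₄ := by
  have hn : (0 : ℤ) < n := by exact_mod_cast n.pos
  have hs : Int.sign (n : ℤ) = 1 := Int.sign_eq_one_of_pos hn
  have e1 : g + (1 - 2 * 1) = g - 1 := by ring
  have e2 : g - 1 + (1 - 2 * (n : ℤ)) = g - 2 * n := by ring
  simp only [boxParams, List.cons_append, List.nil_append, Walk, units_int_one_ne_neg_one.symm,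
    Units.val_one, Units.val_neg, neg_mul, neg_neg, one_mul, forall_true_left, false_imp_iff,
    true_and, hs, Int.sign_one, zero_lt_one, hn, not_lt.2 hn.le,
    not_lt.2 (zero_le_one (α := ℤ)), Int.natAbs_one, pow_one, Int.natAbs_natCast, e1, e2]
  constructor
  · rintro ⟨h0, x₁, x₂, h1, h2, h3, h4, x₃, x₄, h5, h6, h7, h8⟩
    exact ⟨h0, x₁, x₂, x₃, x₄, h1, h4, h5, h2, h3, h6, h7, h8⟩
  · rintro ⟨h0, x₁, x₂, x₃, x₄, h1, h4, h5, h2, h3, h6, h7, h8⟩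
    exact ⟨h0, x₁, x₂, h1, h2, h3, h4, x₃, x₄, h5, h6, h7, h8⟩

end AlmostIotaComplex

/-! ### The tensor product with `± C(n)` -/

theorem kronecker_mulVec_apply {I J I' J' : Type} [Fintype I] [Fintype J] (A : Matrix I' I FU)
    (B : Matrix J' J FU) (x : I × J → FU) (i : I') (j : J') :
    ((A ⊗ₖ B) *ᵥ x) (i, j) = ∑ i', A i i' * (B *ᵥ fun j' => x (i', j')) j := by
  simp only [mulVec, dotProduct, Fintype.sum_prod_type, kronecker_apply, Finset.mul_sum, mul_assoc]

theorem tensor_d_mulVec_apply {I J : Type} [Fintype I] [Fintype J] [DecidableEq I] [DecidableEq J]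
    (A : Matrix I I FU) (B : Matrix J J FU) (x : I × J → FU) (i : I) (j : J) :
    ((A ⊗ₖ (1 : Matrix J J FU) + (1 : Matrix I I FU) ⊗ₖ B) *ᵥ x) (i, j)
      = ∑ i', A i i' * x (i', j) + (B *ᵥ fun j' => x (i, j')) j := by
  rw [add_mulVec, Pi.add_apply, kronecker_mulVec_apply, kronecker_mulVec_apply]
  simp [one_apply]

theorem boxParams_one_d (n : ℕ+) : (boxParams 1 n).d
    = (single 2 1 X + single 4 3 (X ^ (n : ℕ)) : Matrix (Fin 5) (Fin 5) FU) := by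
  refine (Fin.sum_univ_two (M := Matrix (Fin 5) (Fin 5) FU) fun l : Fin 2 =>
    single ((boxParams 1 n).dTarget l) ((boxParams 1 n).dSource l)
      ((X : FU) ^ ((boxParams 1 n).b l).natAbs)).trans ?_
  have h0 : ((boxParams 1 n).b (0 : Fin 2)) = -1 := rfl
  have h1 : ((boxParams 1 n).b (1 : Fin 2)) = -(n : ℤ) := by
    change -(1 * (n : ℤ)) = -n
    ring
  have hn : ¬ (0 : ℤ) < -n := by omega
  simp only [StandardParams.dTarget, StandardParams.dSource, h0, h1, hn]
  simp [StandardParams.t₁, StandardParams.t₂]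
  rfl

theorem boxParams_neg_one_d (n : ℕ+) : (boxParams (-1) n).d
    = (single 1 2 X + single 3 4 (X ^ (n : ℕ)) : Matrix (Fin 5) (Fin 5) FU) := by
  refine (Fin.sum_univ_two (M := Matrix (Fin 5) (Fin 5) FU) fun l : Fin 2 =>
    single ((boxParams (-1) n).dTarget l) ((boxParams (-1) n).dSource l)
      ((X : FU) ^ ((boxParams (-1) n).b l).natAbs)).trans ?_
  have h0 : ((boxParams (-1) n).b (0 : Fin 2)) = 1 := rfl
  have h1 : ((boxParams (-1) n).b (1 : Fin 2)) = (n : ℤ) := by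
    change -(-1 * (n : ℤ)) = n
    ring
  have hn : (0 : ℤ) < n := by exact_mod_cast n.pos
  simp only [StandardParams.dTarget, StandardParams.dSource, h0, h1, hn]
  simp [StandardParams.t₁, StandardParams.t₂]
  rfl

theorem boxParams_one_omega (n : ℕ+) : (boxParams 1 n).omega
    = (single 0 1 1 + single 2 3 1 : Matrix (Fin 5) (Fin 5) FU) := by
  refine (Fin.sum_univ_two (M := Matrix (Fin 5) (Fin 5) FU) fun l : Fin 2 =>
    single ((boxParams 1 n).omegaTarget l) ((boxParams 1 n).omegaSource l) (1 : FU)).trans ?_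
  rfl

theorem boxParams_neg_one_omega (n : ℕ+) : (boxParams (-1) n).omega
    = (single 1 0 1 + single 3 2 1 : Matrix (Fin 5) (Fin 5) FU) := by
  refine (Fin.sum_univ_two (M := Matrix (Fin 5) (Fin 5) FU) fun l : Fin 2 =>
    single ((boxParams (-1) n).omegaTarget l) ((boxParams (-1) n).omegaSource l) (1 : FU)).trans ?_
  rfl

theorem boxParams_gr (ε : ℤˣ) (n : ℕ+) (i : Fin 5) : (boxParams ε n).gr i
    = (![0, 0, (ε : ℤ), (ε : ℤ), 2 * (ε : ℤ) * n] : Fin 5 → ℤ) i := by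
  have hn : (0 : ℤ) < n := by exact_mod_cast n.pos
  refine (Fin.sum_univ_two fun l : Fin 2 => if 2 * (l : ℕ) + 2 ≤ (i : ℕ) then
    ((boxParams ε n).b l).sign - 2 * (boxParams ε n).b l else 0).trans ?_
  have h0 : ((boxParams ε n).b (0 : Fin 2)) = -(ε : ℤ) := rfl
  have h1 : ((boxParams ε n).b (1 : Fin 2)) = -((ε : ℤ) * n) := rfl
  have hs : Int.sign (n : ℤ) = 1 := Int.sign_eq_one_of_pos hn
  rw [h0, h1, Int.sign_neg, Int.sign_neg, Int.sign_mul, hs]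
  rcases Int.units_eq_one_or ε with rfl | rfl <;> fin_cases i <;> (simp; try ring)

namespace AlmostIotaComplex

/-- The tensor product with `ε C(n)`. -/
abbrev boxTensor (ε : ℤˣ) (n : ℕ+) (E : AlmostIotaComplex) : AlmostIotaComplex :=
  (standard (boxParams ε n)).tensor E

/-- The element `∑ t_j ⊗ v_j` of the tensor product with `ε C(n)`. -/
def pack (ε : ℤˣ) (n : ℕ+) (E : AlmostIotaComplex) (v₀ v₁ v₂ v₃ v₄ : E.gen → FU) :
    (boxTensor ε n E).gen → FU :=
  fun q => (![v₀, v₁, v₂, v₃, v₄] : Fin 5 → E.gen → FU) q.1 q.2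

variable {ε : ℤˣ} {n : ℕ+} {E : AlmostIotaComplex} {v₀ v₁ v₂ v₃ v₄ w₀ w₁ w₂ w₃ w₄ : E.gen → FU}

theorem pack_ext {f g : (boxTensor ε n E).gen → FU}
    (h : ∀ (i : Fin 5) (j : E.gen), f (i, j) = g (i, j)) : f = g := by
  funext ⟨i, j⟩
  exact h i j

/-- The coefficient of `t_j` must have degree `g - gr t_j`, and the gradings of `t_0, ..., t_4` are
`0, 0, ε, ε, 2εn`. -/
theorem hom_pack {g : ℤ} (h₀ : IsHomogeneousVec E.gr g v₀) (h₁ : IsHomogeneousVec E.gr g v₁)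
    (h₂ : IsHomogeneousVec E.gr (g - ε) v₂) (h₃ : IsHomogeneousVec E.gr (g - ε) v₃)
    (h₄ : IsHomogeneousVec E.gr (g - 2 * ε * n) v₄) :
    IsHomogeneousVec (boxTensor ε n E).gr g (pack ε n E v₀ v₁ v₂ v₃ v₄) := by
  rintro ⟨i, j⟩ m hm
  change (boxParams ε n).gr i + E.gr j - 2 * (m : ℤ) = g
  have e := boxParams_gr ε n i
  change Fin 5 at i
  rw [e]
  fin_cases i
  · have := h₀ j m hm
    simp
    linarith
  · have := h₁ j m hm
    simp
    linarith
  · have := h₂ j m hm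
    simp
    linarith
  · have := h₃ j m hm
    simp
    linarith
  · have := h₄ j m hm
    simp
    linarith

theorem redU_pack_congr (h₀ : redU v₀ = redU w₀) (h₁ : redU v₁ = redU w₁) (h₂ : redU v₂ = redU w₂)
    (h₃ : redU v₃ = redU w₃) (h₄ : redU v₄ = redU w₄) :
    redU (pack ε n E v₀ v₁ v₂ v₃ v₄) = redU (pack ε n E w₀ w₁ w₂ w₃ w₄) := by
  funext ⟨i, j⟩
  change Fin 5 at i
  fin_cases i
  · exact congrFun h₀ j
  · exact congrFun h₁ j
  · exact congrFun h₂ j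
  · exact congrFun h₃ j
  · exact congrFun h₄ j

theorem pack_zero : pack ε n E 0 0 0 0 0 = 0 := by
  refine pack_ext fun i j => ?_
  fin_cases i <;> rfl

theorem smul_pack (r : FU) : r • pack ε n E v₀ v₁ v₂ v₃ v₄
    = pack ε n E (r • v₀) (r • v₁) (r • v₂) (r • v₃) (r • v₄) := by
  refine pack_ext fun i j => ?_
  fin_cases i <;> rfl

theorem boxTensor_d_apply (x : (boxTensor ε n E).gen → FU) (i : Fin 5) (j : E.gen) :
    ((boxTensor ε n E).d *ᵥ x) (i, j)
      = ∑ i' : Fin 5, ((boxParams ε n).d : Matrix (Fin 5) (Fin 5) FU) i i' * x (i', j)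
        + (E.d *ᵥ fun j' => x (i, j')) j := by
  exact tensor_d_mulVec_apply (I := Fin 5) _ _ _ _ _

theorem boxTensor_omega_mulVec (x : (boxTensor ε n E).gen → FU) :
    (boxTensor ε n E).omega *ᵥ x = x + (boxTensor ε n E).iota *ᵥ x := by
  rw [omega, add_mulVec, one_mulVec]

/-- Expanding `1 + (1 + ω) ⊗ (1 + ω)` in characteristic two leaves `ω ⊗ (1 + ω) + 1 ⊗ ω`. -/
theorem boxTensor_omega_apply (x : (boxTensor ε n E).gen → FU) (i : Fin 5) (j : E.gen) :
    ((boxTensor ε n E).omega *ᵥ x) (i, j)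
      = ∑ i' : Fin 5, ((boxParams ε n).omega : Matrix (Fin 5) (Fin 5) FU) i i'
          * (x (i', j) + (E.omega *ᵥ fun j' => x (i', j')) j)
        + (E.omega *ᵥ fun j' => x (i, j')) j := by
  refine (congrFun (boxTensor_omega_mulVec x) _).trans ?_
  change x (i, j) + ((boxTensor ε n E).iota *ᵥ x) (i, j) = _
  have h : ((boxTensor ε n E).iota *ᵥ x) (i, j)
      = ∑ i' : Fin 5, ((1 : Matrix (Fin 5) (Fin 5) FU) i i' + ((boxParams ε n).omega :
        Matrix (Fin 5) (Fin 5) FU) i i') * (x (i', j) + (E.omega *ᵥ fun j' => x (i', j')) j) := by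
    refine (kronecker_mulVec_apply (I := Fin 5) _ _ _ _ _).trans ?_
    simp only [iota_mulVec]
    rfl
  rw [h]
  simp only [add_mul, Finset.sum_add_distrib, one_apply, ite_mul, one_mul, zero_mul,
    Finset.sum_ite_eq, Finset.mem_univ, if_true]
  have := CharTwo.add_self_eq_zero (x (i, j))
  linear_combination this

theorem d_pack_one : (boxTensor 1 n E).d *ᵥ pack 1 n E v₀ v₁ v₂ v₃ v₄
    = pack 1 n E (E.d *ᵥ v₀) (E.d *ᵥ v₁) ((X : FU) • v₁ + E.d *ᵥ v₂) (E.d *ᵥ v₃)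
      ((X : FU) ^ (n : ℕ) • v₃ + E.d *ᵥ v₄) := by
  refine pack_ext fun i j => ?_
  rw [boxTensor_d_apply, boxParams_one_d]
  fin_cases i <;> simp [single_apply] <;> rfl

theorem d_pack_neg_one : (boxTensor (-1) n E).d *ᵥ pack (-1) n E v₀ v₁ v₂ v₃ v₄
    = pack (-1) n E (E.d *ᵥ v₀) ((X : FU) • v₂ + E.d *ᵥ v₁) (E.d *ᵥ v₂) ((X : FU) ^ (n : ℕ) • v₄ + E.d *ᵥ v₃)
      (E.d *ᵥ v₄) := by
  refine pack_ext fun i j => ?_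
  rw [boxTensor_d_apply, boxParams_neg_one_d]
  fin_cases i <;> simp [single_apply] <;> rfl

theorem omega_pack_one : (boxTensor 1 n E).omega *ᵥ pack 1 n E v₀ v₁ v₂ v₃ v₄
    = pack 1 n E (v₁ + E.omega *ᵥ v₁ + E.omega *ᵥ v₀) (E.omega *ᵥ v₁)
      (v₃ + E.omega *ᵥ v₃ + E.omega *ᵥ v₂) (E.omega *ᵥ v₃) (E.omega *ᵥ v₄) := by
  refine pack_ext fun i j => ?_
  rw [boxTensor_omega_apply, boxParams_one_omega]
  fin_cases i <;> simp [single_apply] <;> rfl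

theorem omega_pack_neg_one : (boxTensor (-1) n E).omega *ᵥ pack (-1) n E v₀ v₁ v₂ v₃ v₄
    = pack (-1) n E (E.omega *ᵥ v₀) (v₀ + E.omega *ᵥ v₀ + E.omega *ᵥ v₁) (E.omega *ᵥ v₂)
      (v₂ + E.omega *ᵥ v₂ + E.omega *ᵥ v₃) (E.omega *ᵥ v₄) := by
  refine pack_ext fun i j => ?_
  rw [boxTensor_omega_apply, boxParams_neg_one_omega]
  fin_cases i <;> simp [single_apply] <;> rfl


/-! ### Lifting walks to the tensor product with `± C(n)`. -/

variable {n : ℕ+} {E : AlmostIotaComplex}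

/-- In `C(n)` both `∂` and `ω` kill `t_4`, so `t_4 ⊗ E` is a shifted copy of `E` and walks carry
over unchanged. -/
theorem Walk.tail_one {L : StandardParams} {g : ℤ} {s : E.gen → FU} (h : E.Walk L g s) :
    (boxTensor 1 n E).Walk L (g + 2 * n) (pack 1 n E 0 0 0 0 s) := by
  have hom : ∀ {g : ℤ} {s : E.gen → FU}, IsHomogeneousVec E.gr g s →
      IsHomogeneousVec (boxTensor 1 n E).gr (g + 2 * n) (pack 1 n E 0 0 0 0 s) := fun hs =>
    hom_pack .zero .zero .zero .zero (hs.congr (by push_cast; ring))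
  induction L generalizing g s with
  | nil =>
    refine ⟨hom h.1, ?_⟩
    rw [omega_pack_one, ← map_zero redU, ← pack_zero]
    apply redU_pack_congr <;> simp [h.2]
  | cons p L ih =>
    obtain ⟨h0, s₁, s₂, h1, h2, h3, h4, h5, h6⟩ := h
    refine ⟨hom h0, pack 1 n E 0 0 0 0 s₁, pack 1 n E 0 0 0 0 s₂, hom h1, fun hp => ?_,
      fun hp => ?_, fun hp => ?_, fun hp => ?_, (ih h6).congr (by ring) rfl⟩
    · rw [omega_pack_one]
      apply redU_pack_congr <;> simp [h2 hp]
    · rw [omega_pack_one]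
      apply redU_pack_congr <;> simp [h3 hp]
    · rw [d_pack_one, smul_pack, h4 hp]
      simp
    · rw [d_pack_one, smul_pack, h5 hp]
      simp

/-- In `-C(n)` one has `∂ t_4 = U^n t_3`, so `t_4 ⊗ s_i` is only a first approximation; the error is
absorbed by a term `U^(n-|b|) t_3 ⊗ (...)`, invisible modulo `U` because `|b| < n`. The starting
element `x` need not be `t_4 ⊗ s`: the walk sees `ω x` modulo `U`, and `x` itself modulo `U` only
when the first sign is `+`. This freedom is used in `Walk.box_neg_one`, where the tail starts near
`t_4 ⊗ (s + s₁)`. -/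
theorem Walk.tail_neg_one {L : StandardParams} (hL : ∀ p ∈ L, p.2.1.natAbs < n) {g : ℤ}
    {s : E.gen → FU} (h : E.Walk L g s) {x : (boxTensor (-1) n E).gen → FU}
    (hx : IsHomogeneousVec (boxTensor (-1) n E).gr (g - 2 * n) x)
    (hω : redU ((boxTensor (-1) n E).omega *ᵥ x)
      = redU (pack (-1) n E 0 0 0 0 (E.omega *ᵥ s)))
    (hhead : ∀ p ∈ L.head?, p.1 = 1 → redU x = redU (pack (-1) n E 0 0 0 0 s)) :
    (boxTensor (-1) n E).Walk L (g - 2 * n) x := by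
  induction L generalizing g s x with
  | nil =>
    refine ⟨hx, hω.trans ?_⟩
    rw [← map_zero redU, ← pack_zero]
    apply redU_pack_congr <;> simp [h.2]
  | cons p L ih =>
    obtain ⟨h0, s₁, s₂, h1, h2, h3, h4, h5, h6⟩ := h
    have hp0 : p.2.1 ≠ 0 := p.2.2
    -- Here `c + 1 = n - |b|`, the positive exponent of the correction.
    obtain ⟨c, hc⟩ := Nat.exists_eq_add_of_lt (hL p (by simp))
    have hhead' := hhead p (by simp)
    have hsmul : ∀ v : E.gen → FU, (X : FU) ^ (n : ℕ) • v
        = (X : FU) ^ p.2.1.natAbs • (X : FU) ^ (c + 1) • v := fun v => by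
      rw [smul_smul, ← pow_add, hc, add_assoc]
    rcases lt_or_gt_of_ne hp0 with hneg | hpos
    -- From `∂ s₁ = U^|b| s₂` follows `∂(t_4 ⊗ s₁) = U^|b| (t_4 ⊗ s₂ + U^(n-|b|) t_3 ⊗ s₁)`, so here
    -- the target of `∂` is corrected.
    · have hs : p.2.1.sign = -1 := Int.sign_eq_neg_one_of_neg hneg
      refine ⟨hx, pack (-1) n E 0 0 0 0 s₁, pack (-1) n E 0 0 0 ((X : FU) ^ (c + 1) • s₁) s₂,
        hom_pack .zero .zero .zero .zero (h1.congr (by push_cast; ring)), fun hp => ?_,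
        fun hp => ?_, fun _ => ?_, fun hp => absurd hp (by omega), ?_⟩
      · rw [hhead' hp, omega_pack_neg_one]
        apply redU_pack_congr <;> simp [h2 hp]
      · rw [hω]
        apply redU_pack_congr <;> simp [h3 hp]
      · rw [d_pack_neg_one, smul_pack, h4 hneg, hsmul]
        simp
      · have e : redU (pack (-1) n E 0 0 0 ((X : FU) ^ (c + 1) • s₁) s₂)
            = redU (pack (-1) n E 0 0 0 0 s₂) := by
          apply redU_pack_congr <;> simp
        refine (ih (fun q hq => hL q (by simp [hq])) h6 ?_ ?_ fun _ _ _ => e).congr (by ring) rfl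
        · refine hom_pack .zero .zero .zero (h1.pow_smul ?_) (h6.hom.congr ?_)
          · rw [hs]
            push_cast
            omega
          · push_cast
            ring
        · rw [redU_mulVec_congr _ e, omega_pack_neg_one]
          apply redU_pack_congr <;> simp
    -- Now `∂` runs from `s₂` to `s₁`, so the target to be corrected is the element over `s₁`.
    · have hs : p.2.1.sign = 1 := Int.sign_eq_one_of_pos hpos
      have e : redU (pack (-1) n E 0 0 0 ((X : FU) ^ (c + 1) • s₂) s₁)
          = redU (pack (-1) n E 0 0 0 0 s₁) := by
        apply redU_pack_congr <;> simp
      refine ⟨hx, pack (-1) n E 0 0 0 ((X : FU) ^ (c + 1) • s₂) s₁, pack (-1) n E 0 0 0 0 s₂,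
        ?_, fun hp => ?_, fun hp => ?_, fun hp => absurd hp (by omega), fun _ => ?_, ?_⟩
      · refine hom_pack .zero .zero .zero (h6.hom.pow_smul ?_) (h1.congr ?_)
        · rw [hs]
          push_cast
          omega
        · push_cast
          ring
      · rw [hhead' hp, redU_mulVec_congr _ e, omega_pack_neg_one]
        apply redU_pack_congr <;> simp [h2 hp]
      · rw [hω, e]
        apply redU_pack_congr <;> simp [h3 hp]
      · rw [d_pack_neg_one, smul_pack, h5 hpos, hsmul]
        simp
      · refine (ih (fun q hq => hL q (by simp [hq])) h6 ?_ ?_ fun _ _ _ => rfl).congr (by ring) rfl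
        · exact hom_pack .zero .zero .zero .zero (h6.hom.congr (by push_cast; ring))
        · rw [omega_pack_neg_one]
          apply redU_pack_congr <;> simp

/-- The concatenation of the parameters of a list of complexes `± C(n)`. -/
def boxList (l : List (ℤˣ × ℕ+)) : StandardParams := l.flatMap fun p => boxParams p.1 p.2

@[simp] theorem boxList_nil : boxList [] = [] := rfl

@[simp] theorem boxList_cons (p : ℤˣ × ℕ+) (l : List (ℤˣ × ℕ+)) :
    boxList (p :: l) = boxParams p.1 p.2 ++ boxList l := List.flatMap_cons

/-- Each box contributes the absolute values `1` and `n`; the bound `1 < m` takes care of the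
former. -/
theorem natAbs_lt_of_mem_boxList {l : List (ℤˣ × ℕ+)} {m : ℕ} (hm : 1 < m)
    (hl : ∀ q ∈ l, (q.2 : ℕ) < m) : ∀ p ∈ boxList l, p.2.1.natAbs < m := by
  intro p hp
  obtain ⟨q, hq, hp⟩ := List.mem_flatMap.1 hp
  have := hl q hq
  simp only [boxParams, List.mem_cons, List.not_mem_nil, or_false] at hp
  rcases Int.units_eq_one_or q.1 with h | h <;> rw [h] at hp <;> rcases hp with rfl | rfl <;>
    simp <;> omega

/-- The first box of the list is not negative. -/
def StartsNonneg (l : List (ℤˣ × ℕ+)) : Prop := ∀ q ∈ l.head?, q.1 = 1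

/-- Either `s` ends the walk, or its first box is positive and `s = ω s₁` modulo `U`, so that `ω² =
0` applies. -/
theorem Walk.redU_omega_eq_zero {l : List (ℤˣ × ℕ+)} (hE : E.IsReduced) (hl : StartsNonneg l)
    {g : ℤ} {s : E.gen → FU} (h : E.Walk (boxList l) g s) : redU (E.omega *ᵥ s) = 0 := by
  cases l with
  | nil => exact h.2
  | cons p l =>
    have hp : p.1 = 1 := hl p (by simp)
    rw [boxList_cons, hp, walk_boxParams_one_append] at h
    obtain ⟨-, s₁, -, -, -, -, -, -, h1, -⟩ := h
    exact hE.redU_omega_of_eq h1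

/-- Since `ω s = 0` modulo `U`, the uncorrected sequence `t_0 ⊗ s, ..., t_4 ⊗ s` already works, with
no bound relating `n` to `l`. -/
theorem Walk.box_one_of_startsNonneg {l : List (ℤˣ × ℕ+)} (hE : E.IsReduced)
    (hl : StartsNonneg l) {g : ℤ} {s : E.gen → FU} (h : E.Walk (boxList l) g s)
    (hs : E.d *ᵥ s = 0) :
    (boxTensor 1 n E).Walk (boxParams 1 n ++ boxList l) g (pack 1 n E s 0 0 0 0) := by
  have hω := h.redU_omega_eq_zero hE hl
  have hom := h.hom
  rw [walk_boxParams_one_append]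
  refine ⟨hom_pack hom .zero .zero .zero .zero, pack 1 n E 0 s 0 0 0, pack 1 n E 0 0 s 0 0,
    pack 1 n E 0 0 0 s 0, pack 1 n E 0 0 0 0 s, ?_, ?_, ?_, ?_, ?_, ?_, ?_, h.tail_one⟩
  · exact hom_pack .zero hom .zero .zero .zero
  · exact hom_pack .zero .zero (hom.congr (by simp)) .zero .zero
  · exact hom_pack .zero .zero .zero (hom.congr (by simp)) .zero
  · rw [omega_pack_one]
    apply redU_pack_congr <;> simp [hω]
  · rw [d_pack_one, smul_pack]
    simp [hs]
  · rw [omega_pack_one]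
    apply redU_pack_congr <;> simp [hω]
  · rw [d_pack_one, smul_pack]
    simp [hs]

/-- Now `ω s = s₁` modulo `U`, and the first elements must be corrected by terms from the negative
box `s, s₁, s₂, s₃, s₄` of `E`. The condition `n' < n` lets the new first element be completed to a
cycle by a multiple of `U`. -/
theorem Walk.box_one_of_neg {n' : ℕ+} {L : StandardParams} (hE : E.IsReduced)
    (hn : 1 < n) (hn' : n' < n) {g : ℤ} {s : E.gen → FU}
    (h : E.Walk (boxParams (-1) n' ++ L) g s) (hs : E.d *ᵥ s = 0) :
    ∃ v₁ v₂ v₃ v₄, (boxTensor 1 n E).Walk (boxParams 1 n ++ (boxParams (-1) n' ++ L)) g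
      (pack 1 n E s v₁ v₂ v₃ v₄) ∧ (boxTensor 1 n E).d *ᵥ (pack 1 n E s v₁ v₂ v₃ v₄) = 0 := by
  have htail := h.tail_one (n := n)
  rw [walk_boxParams_neg_one_append] at h
  obtain ⟨h0, s₁, s₂, s₃, s₄, h1, h2, h3, h5, h6, h7, h8, h9⟩ := h
  have h4 := h9.hom
  have d1 : E.d *ᵥ s₁ = 0 := E.d_eq_zero_of_eq (k := 1) (by rw [h6, pow_one])
  have d3 : E.d *ᵥ s₃ = 0 := E.d_eq_zero_of_eq h8
  have ω1 := hE.redU_omega_of_eq h5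
  -- So `k + 1 = n - 1` is positive because `n > 1`, and below `c + 1 = n - n'`.
  obtain ⟨k, hk⟩ : ∃ k, (n : ℕ) = k + 1 + 1 := Nat.exists_eq_add_of_le' (m := 2) hn
  obtain ⟨c, hc⟩ := Nat.exists_eq_add_of_lt (show (n' : ℕ) < n from hn')
  have hsmul : ∀ v : E.gen → FU, (X : FU) ^ (n : ℕ) • v
      = (X : FU) ^ (c + 1) • (X : FU) ^ (n' : ℕ) • v := fun v => by
    rw [smul_smul, ← pow_add, hc]
    congr 2
    ring
  have hsmul' : ∀ v : E.gen → FU, (X : FU) ^ (n : ℕ) • v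
      = (X : FU) • (X : FU) ^ (k + 1) • v := fun v => by
    rw [smul_smul, ← pow_succ', hk]
  -- Modulo `U` this is `ω (t_1 ⊗ (s + s₁) + t_3 ⊗ s₂)`. The last coefficient, zero modulo `U`,
  -- makes it a cycle: `∂(U^(n-n') s₄) = U^n s₃` cancels the `U^n s₃` produced by `∂ t_3 = U^n t_4`.
  refine ⟨s₁, s₂ + s₃, s₃, (X : FU) ^ (c + 1) • s₄, ?_, ?_⟩
  · rw [walk_boxParams_one_append]
    -- The summand `t_3 ⊗ s₂` makes `∂` of the first element produce `U t_3 ⊗ s₁`, so that its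
    -- quotient by `U` agrees modulo `U` with `ω (t_3 ⊗ s)`; the leftover `U^(n-1) t_4 ⊗ s₂` is
    -- harmless.
    refine ⟨?_, pack 1 n E 0 (s + s₁) 0 s₂ 0, pack 1 n E 0 0 (s + s₁) s₁ ((X : FU) ^ (k + 1) • s₂),
      pack 1 n E 0 0 0 s 0, pack 1 n E 0 0 0 0 s, ?_, ?_, ?_, ?_, ?_, ?_, ?_, htail⟩
    · refine hom_pack h0 h1 (h2.add h3) h3 (h4.pow_smul ?_)
      push_cast
      omega
    · exact hom_pack .zero (h0.add h1) .zero h2 .zero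
    · refine hom_pack .zero .zero ((h0.add h1).congr (by simp)) (h1.congr (by simp))
        (h2.pow_smul ?_)
      push_cast
      omega
    · exact hom_pack .zero .zero .zero (h0.congr (by simp)) .zero
    · rw [omega_pack_one]
      apply redU_pack_congr <;>
        simp [mulVec_add, h5, ω1, h7, add_assoc, ZMod_two_vec_add_self]
    · rw [d_pack_one, smul_pack]
      simp [mulVec_add, hs, d1, h6, hsmul']
    · rw [omega_pack_one]
      apply redU_pack_congr <;> simp [h5]
    · rw [d_pack_one, smul_pack]
      simp [hs]
  · rw [d_pack_one, ← pack_zero, mulVec_add, mulVec_smul, h8, hs, d1, h6, d3, add_zero,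
      FU_vec_add_self, ← hsmul, FU_vec_add_self]

/-- The base case of `Walk.box_neg_one`. The elements `y, r₁, r₂, r₃, s` form a `-C(n)` box of `E`
already passed through, carried along in the `t_4` coordinate while `s` occupies the others. With
`z`, `y` and all `r_i` zero this is the uncorrected sequence `t_j ⊗ s`. -/
theorem Walk.box_neg_one_of_startsNonneg {l : List (ℤˣ × ℕ+)} (hE : E.IsReduced)
    (hl : StartsNonneg l) (hn : 1 < n) (hlt : ∀ q ∈ l, q.2 < n) {g : ℤ}
    {s z y r₁ r₂ r₃ : E.gen → FU} (h : E.Walk (boxList l) g s)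
    (hz : IsHomogeneousVec E.gr (g + 3) z) (hy : IsHomogeneousVec E.gr (g + 2 * n) y)
    (hr₁ : IsHomogeneousVec E.gr (g + 2 * n) r₁) (hr₂ : IsHomogeneousVec E.gr (g + 2 * n - 1) r₂)
    (hr₃ : IsHomogeneousVec E.gr (g + 2 * n - 1) r₃) (hs : E.d *ᵥ s = (X : FU) ^ (n : ℕ) • r₃)
    (hr : E.d *ᵥ r₂ = (X : FU) • r₁) (ωr : redU (E.omega *ᵥ r₂) = redU r₃)
    (ωy : redU (E.omega *ᵥ y) = redU r₁) :
    (boxTensor (-1) n E).Walk (boxParams (-1) n ++ boxList l) g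
      (pack (-1) n E s 0 ((X : FU) • z) 0 y) := by
  have hω := h.redU_omega_eq_zero hE hl
  have h0 := h.hom
  obtain ⟨k, hk⟩ : ∃ k, (n : ℕ) = k + 1 + 1 := Nat.exists_eq_add_of_le' (m := 2) hn
  have hsmul' : ∀ v : E.gen → FU, (X : FU) ^ (n : ℕ) • v
      = (X : FU) • (X : FU) ^ (k + 1) • v := fun v => by
    rw [smul_smul, ← pow_succ', hk]
  rw [walk_boxParams_neg_one_append]
  -- The entries `U^(n-1) r₃` and `U^(n-1) r₂` are the quotients by `U` of `∂ s` and of the `t_3`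
  -- part of `∂(t_4 ⊗ r₂)`; as `n > 1` they vanish modulo `U`.
  refine ⟨?_, pack (-1) n E 0 s ((X : FU) ^ (k + 1) • r₃) ((X : FU) ^ (k + 1) • r₂) r₁,
    pack (-1) n E 0 0 s 0 r₂, pack (-1) n E 0 0 0 s r₃, pack (-1) n E 0 0 0 0 s,
    ?_, ?_, ?_, ?_, ?_, ?_, ?_, ?_⟩
  · refine hom_pack h0 .zero (hz.smul ?_) .zero (hy.congr ?_) <;> (push_cast; ring)
  · refine hom_pack .zero h0 (hr₃.pow_smul ?_) (hr₂.pow_smul ?_) (hr₁.congr ?_) <;>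
      push_cast <;> omega
  · refine hom_pack .zero .zero (h0.congr ?_) .zero (hr₂.congr ?_) <;> (push_cast; ring)
  · refine hom_pack .zero .zero .zero (h0.congr ?_) (hr₃.congr ?_) <;> (push_cast; ring)
  · rw [omega_pack_neg_one]
    apply redU_pack_congr <;> simp [hω, ωy, mulVec_smul]
  · rw [d_pack_neg_one, smul_pack, hs, hr]
    simp [hsmul']
  · rw [omega_pack_neg_one]
    apply redU_pack_congr <;> simp [hω, ωr]
  · rw [d_pack_neg_one, smul_pack, hs]
    simp
  · refine h.tail_neg_one (natAbs_lt_of_mem_boxList hn hlt) ?_ ?_ fun _ _ _ => rfl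
    · exact hom_pack .zero .zero .zero .zero (h0.congr (by push_cast; ring))
    · rw [omega_pack_neg_one]
      apply redU_pack_congr <;> simp


/-! ### Fully simplified lists and repeated copies of `-C(n)`. -/

variable {n : ℕ+} {E : AlmostIotaComplex}

/-- The list of complexes `± C(n)` is fully simplified and ordered by decreasing `n > 1`. -/
def FullySimplified (l : List (ℤˣ × ℕ+)) : Prop :=
  (∀ p ∈ l, 1 < p.2) ∧ l.Pairwise fun p q => q.2 ≤ p.2 ∧ (p.2 = q.2 → p.1 = q.1)

theorem FullySimplified.tail {p : ℤˣ × ℕ+} {l : List (ℤˣ × ℕ+)} (h : FullySimplified (p :: l)) :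
    FullySimplified l :=
  ⟨fun q hq => h.1 q (List.mem_cons_of_mem _ hq), (List.pairwise_cons.1 h.2).2⟩

theorem FullySimplified.lt_of_head_lt {p q : ℤˣ × ℕ+} {l : List (ℤˣ × ℕ+)}
    (h : FullySimplified (p :: q :: l)) (hq : q.2 < n) : ∀ q' ∈ q :: l, q'.2 < n := by
  intro q' hq'
  rcases List.mem_cons.1 hq' with rfl | hq'
  · exact hq
  · exact lt_of_le_of_lt ((List.pairwise_cons.1 h.tail.2).1 q' hq').1 hq

/-- Full simplification enters here: at a change of sign the parameter drops strictly, and by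
monotonicity so do all later ones. -/
theorem FullySimplified.lt_of_ne {ε : ℤˣ} {q : ℤˣ × ℕ+} {l : List (ℤˣ × ℕ+)}
    (h : FullySimplified ((ε, n) :: q :: l)) (hq : q.1 ≠ ε) : ∀ q' ∈ q :: l, q'.2 < n := by
  have h1 := List.pairwise_cons.1 h.2
  have h2 := h1.1 q (by simp)
  exact h.lt_of_head_lt (lt_of_le_of_ne h2.1 fun e => hq (h2.2 e.symm).symm)

/-- A walk whose type is a list starting with `-C(n)`; the elements `r₁, r₂, r₃` are those which
precede `s` in a longer walk. -/
theorem Walk.box_neg_one {l : List (ℤˣ × ℕ+)} (hE : E.IsReduced)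
    (hl : FullySimplified ((-1, n) :: l)) {g : ℤ}
    {s z y r₁ r₂ r₃ : E.gen → FU} (h : E.Walk (boxList l) g s)
    (hz : IsHomogeneousVec E.gr (g + 3) z) (hy : IsHomogeneousVec E.gr (g + 2 * n) y)
    (hr₁ : IsHomogeneousVec E.gr (g + 2 * n) r₁) (hr₂ : IsHomogeneousVec E.gr (g + 2 * n - 1) r₂)
    (hr₃ : IsHomogeneousVec E.gr (g + 2 * n - 1) r₃) (hs : E.d *ᵥ s = (X : FU) ^ (n : ℕ) • r₃)
    (hr : E.d *ᵥ r₂ = (X : FU) • r₁) (ωr : redU (E.omega *ᵥ r₂) = redU r₃)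
    (ωy : redU (E.omega *ᵥ y) = redU r₁) :
    (boxTensor (-1) n E).Walk (boxParams (-1) n ++ boxList l) g
      (pack (-1) n E s 0 ((X : FU) • z) 0 y) := by
  have hn : 1 < n := hl.1 (-1, n) (by simp)
  -- Everything is generalized because, when the next box is another `-C(n)`, the construction is
  -- repeated with `s₄` in place of `s`, the box just traversed supplying the new `y` and `r_i`.
  induction l generalizing g s z y r₁ r₂ r₃ with
  | nil =>
    exact h.box_neg_one_of_startsNonneg hE (by simp [StartsNonneg]) hn (by simp) hz hy
      hr₁ hr₂ hr₃ hs hr ωr ωy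
  | cons p l ih =>
    obtain ⟨ε, n'⟩ := p
    rcases Int.units_eq_one_or ε with rfl | rfl
    · exact h.box_neg_one_of_startsNonneg hE (by simp [StartsNonneg]) hn
        (hl.lt_of_ne units_int_one_ne_neg_one) hz hy hr₁ hr₂ hr₃ hs hr ωr ωy
    have h0 := h.hom
    have hle : n' ≤ n := ((List.pairwise_cons.1 hl.2).1 (-1, n') (by simp)).1
    have h' := h
    rw [boxList_cons, walk_boxParams_neg_one_append] at h
    obtain ⟨-, s₁, s₂, s₃, s₄, h1, h2, h3, h5, h6, h7, h8, h9⟩ := h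
    have h4 := h9.hom
    have d1 : E.d *ᵥ s₁ = 0 := E.d_eq_zero_of_eq (k := 1) (by rw [h6, pow_one])
    have ω1 := hE.redU_omega_of_eq h5
    obtain ⟨k, hk⟩ : ∃ k, (n : ℕ) = k + 1 + 1 := Nat.exists_eq_add_of_le' (m := 2) hn
    obtain ⟨c, hc⟩ := Nat.exists_eq_add_of_le (show (n' : ℕ) ≤ n from hle)
    have hsmul : ∀ v : E.gen → FU, (X : FU) ^ (n : ℕ) • v
        = (X : FU) ^ c • (X : FU) ^ (n' : ℕ) • v := fun v => by
      rw [smul_smul, ← pow_add, hc, add_comm]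
    have hsmul' : ∀ v : E.gen → FU, (X : FU) ^ (n : ℕ) • v
        = (X : FU) • (X : FU) ^ (k + 1) • v := fun v => by
      rw [smul_smul, ← pow_succ', hk]
    have hsmul'' : ∀ v : E.gen → FU, (X : FU) ^ (n : ℕ) • v
        = (X : FU) ^ (k + 1) • (X : FU) • v := fun v => by
      rw [smul_smul, ← pow_succ, hk]
    rw [walk_boxParams_neg_one_append]
    -- The next negative box of `E` is traversed in the coordinates `t_0` to `t_3` at the same time
    -- as the new factor; at the end `s + s₁` has moved to `t_4` and `U^(n-n') s₄` to `t_0`. The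
    -- coefficient of `t_2` in the last element is `U^(n-1) s₂`, written as `U • U^k • s₂` to match
    -- the shape `U • z` required by the induction.
    refine ⟨?_, pack (-1) n E s₁ (s + s₁) ((X : FU) ^ (k + 1) • r₃) ((X : FU) ^ (k + 1) • r₂) r₁,
      pack (-1) n E s₂ s₂ s 0 r₂, pack (-1) n E s₃ s₂ s₁ (s + s₁) r₃,
      pack (-1) n E ((X : FU) ^ c • s₄) 0 ((X : FU) • (X : FU) ^ k • s₂) 0 (s + s₁),
      ?_, ?_, ?_, ?_, ?_, ?_, ?_, ?_⟩
    · refine hom_pack h0 .zero (hz.smul ?_) .zero (hy.congr ?_) <;> (push_cast; ring)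
    · refine hom_pack h1 (h0.add h1) (hr₃.pow_smul ?_) (hr₂.pow_smul ?_) (hr₁.congr ?_) <;>
        push_cast <;> omega
    · refine hom_pack h2 h2 (h0.congr ?_) .zero (hr₂.congr ?_) <;> (push_cast; ring)
    · refine hom_pack h3 h2 (h1.congr ?_) ((h0.add h1).congr ?_) (hr₃.congr ?_) <;>
        (push_cast; ring)
    · rw [omega_pack_neg_one]
      apply redU_pack_congr <;> simp [h5, ωy, mulVec_smul]
    · rw [d_pack_neg_one, smul_pack, hs, hr, h6]
      simp [hsmul']
    · rw [omega_pack_neg_one]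
      apply redU_pack_congr <;>
        simp [h5, h7, ωr, add_assoc, ZMod_two_vec_add_self]
    · have e₂ : (X : FU) ^ (n : ℕ) • s₂ = (X : FU) • (X : FU) • (X : FU) ^ k • s₂ := by
        simp only [smul_smul, hk, pow_succ']
      have e₁ : (X : FU) ^ (n : ℕ) • s₁ = (X : FU) • (X : FU) ^ k • (X : FU) • s₁ := by
        simp only [smul_smul, hk, pow_succ']
        ring_nf
      rw [d_pack_neg_one, smul_pack]
      simp only [mulVec_smul, mulVec_add, mulVec_zero, h8, h6, hs, d1, hsmul s₃, e₁, e₂, add_zero]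
    -- If `n' < n`, only `t_4 ⊗ (s + s₁)` survives modulo `U`, and `ω (s + s₁) = ω s` there, so the
    -- tail lemma applies to the whole walk in `E`, whose first sign is `-`. If `n' = n`, the term
    -- `t_0 ⊗ s₄` survives and the induction hypothesis continues from it.
    · rcases hle.lt_or_eq with hlt | rfl
      · have e : redU (pack (-1) n E ((X : FU) ^ c • s₄) 0 ((X : FU) • (X : FU) ^ k • s₂) 0 (s + s₁))
            = redU (pack (-1) n E 0 0 0 0 (s + s₁)) := by
          have hc1 : c = c - 1 + 1 := by
            have : (n' : ℕ) < n := hlt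
            omega
          rw [hc1]
          apply redU_pack_congr <;> simp
        refine h'.tail_neg_one (natAbs_lt_of_mem_boxList hn (hl.lt_of_head_lt hlt)) ?_ ?_ ?_
        · refine hom_pack (h4.pow_smul ?_) .zero ?_ .zero ((h0.add h1).congr ?_)
          · push_cast
            omega
          · rw [smul_smul, ← pow_succ']
            refine h2.pow_smul ?_
            push_cast
            omega
          · push_cast
            ring
        · rw [redU_mulVec_congr _ e, omega_pack_neg_one]
          apply redU_pack_congr <;> simp [mulVec_add, ω1]
        · simp [boxParams]
      · have hc0 : c = 0 := by omega
        subst hc0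
        rw [pow_zero, one_smul]
        refine ih hl.tail h9 (h2.pow_smul ?_) ((h0.add h1).congr ?_) (h1.congr ?_) (h2.congr ?_)
          (h3.congr ?_) h8 h6 h7 ?_
        · omega
        · ring
        · ring
        · ring
        · ring
        · simp [mulVec_add, h5, ω1]

/-! ### Tower generators and the walk in an iterated tensor product. -/

/-- The tower is generated, up to a power of `U`, by the class of the cycle `x`. -/
def GeneratesTower (D : AlmostIotaComplex) (x : D.gen → FU) : Prop :=
  D.d *ᵥ x = 0 ∧ ∃ (κ : Type) (_ : Fintype κ) (_ : DecidableEq κ) (_ : Unique κ)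
    (t : GradedComplex.TowerSplitting D.toGradedComplex κ) (N : ℕ),
    (t.p *ᵥ x) default ∣ (X : FU) ^ N

/-- The projection of `ε C(n)` to its tower is supported on `t_0`, so only the coefficient `s`
matters and the corrections are free. -/
theorem GeneratesTower.pack {ε : ℤˣ} {s v₁ v₂ v₃ v₄ : E.gen → FU} (hs : E.GeneratesTower s)
    (hd : (boxTensor ε n E).d *ᵥ pack ε n E s v₁ v₂ v₃ v₄ = 0) :
    (boxTensor ε n E).GeneratesTower (pack ε n E s v₁ v₂ v₃ v₄) := by
  obtain ⟨-, κ, _, _, _, t, N, hN⟩ := hs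
  refine ⟨hd, Unit × κ, inferInstance, inferInstance, inferInstance,
    (GradedComplex.standardSplitting (boxParams ε n)).tensor t,
    (∑ l, ((boxParams ε n).b l).natAbs) + N, ?_⟩
  have key : ∀ (a : FU) (v : Fin 5 × E.gen → FU),
      ((((single () 0 a : Matrix Unit (Fin 5) FU) ⊗ₖ t.p) *ᵥ v) ((), default))
        = a * (t.p *ᵥ fun j => v (0, j)) default := by
    intro a v
    rw [kronecker_mulVec_apply, Finset.sum_eq_single 0]
    · simp
    · intro i _ hi
      simp [hi.symm]
    · simp
  have h := key (X ^ (∑ l, ((boxParams ε n).b l).natAbs))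
    (AlmostIotaComplex.pack ε n E s v₁ v₂ v₃ v₄)
  rw [pow_add]
  exact (dvd_of_eq h).trans (mul_dvd_mul_left _ hN)

/-- The iterated tensor product of a list of complexes `± C(n)`. -/
def boxTensorList : List (ℤˣ × ℕ+) → AlmostIotaComplex
  | [] => trivial
  | p :: l => boxTensor p.1 p.2 (boxTensorList l)

theorem isReduced_boxTensorList (l : List (ℤˣ × ℕ+)) : (boxTensorList l).IsReduced := by
  induction l with
  | nil => exact isReduced_trivial
  | cons p l ih => exact (isReduced_standard _).tensor ih

/-- Adds one factor at a time on the left. The generator of the tower is part of the induction,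
since the constructions need the first element of the walk to be a cycle. -/
theorem exists_walk_boxTensorList {l : List (ℤˣ × ℕ+)} (hl : FullySimplified l) :
    ∃ x, (boxTensorList l).Walk (boxList l) 0 x ∧ (boxTensorList l).GeneratesTower x := by
  induction l with
  | nil =>
    have hom : IsHomogeneousVec (fun _ : Unit => (0 : ℤ)) 0 (fun _ => (1 : FU)) := by
      intro j m hm
      have : m = 0 := by
        by_contra hne
        simp [coeff_one, hne] at hm
      simp [this]
    have hω : redU (((1 : Matrix Unit Unit FU) + 1) *ᵥ fun _ => (1 : FU)) = 0 := by
      rw [FU_matrix_add_self, zero_mulVec, map_zero]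
    refine ⟨fun _ => 1, ⟨hom, hω⟩, zero_mulVec (m := Unit) (n := Unit) (α := FU) _, Unit,
      inferInstance, inferInstance, inferInstance, GradedComplex.trivialSplitting, 0, ?_⟩
    have h : ((1 : Matrix Unit Unit FU) *ᵥ fun _ => (1 : FU)) default ∣ X ^ 0 := by simp
    exact h
  | cons p l ih =>
    obtain ⟨ε, n⟩ := p
    obtain ⟨s, hs, ht⟩ := ih hl.tail
    have hE := isReduced_boxTensorList l
    have hn : 1 < n := hl.1 (ε, n) (by simp)
    rw [boxList_cons]
    rcases Int.units_eq_one_or ε with rfl | rfl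
    · suffices ∃ v₁ v₂ v₃ v₄, (boxTensor 1 n (boxTensorList l)).Walk (boxParams 1 n ++ boxList l) 0
          (AlmostIotaComplex.pack 1 n (boxTensorList l) s v₁ v₂ v₃ v₄) ∧
          (boxTensor 1 n (boxTensorList l)).d *ᵥ
            (AlmostIotaComplex.pack 1 n (boxTensorList l) s v₁ v₂ v₃ v₄) = 0 by
        obtain ⟨v₁, v₂, v₃, v₄, h1, h2⟩ := this
        exact ⟨_, h1, ht.pack h2⟩
      by_cases hneg : StartsNonneg l
      · refine ⟨0, 0, 0, 0, hs.box_one_of_startsNonneg hE hneg ht.1, ?_⟩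
        rw [d_pack_one, ht.1, ← pack_zero]
        simp
      · cases l with
        | nil => exact absurd (by simp [StartsNonneg]) hneg
        | cons q l =>
          obtain ⟨ε', n'⟩ := q
          rcases Int.units_eq_one_or ε' with rfl | rfl
          · exact absurd (by simp [StartsNonneg]) hneg
          · exact hs.box_one_of_neg hE hn
              (hl.lt_of_ne units_int_one_ne_neg_one.symm (-1, n') (by simp)) ht.1
    -- No box has been traversed yet, so all the auxiliary elements `z, y, r_i` are zero.
    · have hd : (boxTensor (-1) n (boxTensorList l)).d *ᵥ
          (AlmostIotaComplex.pack (-1) n (boxTensorList l) s 0 ((X : FU) • 0) 0 0) = 0 := by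
        rw [d_pack_neg_one, ht.1, ← pack_zero]
        simp
      exact ⟨_, hs.box_neg_one hE hl .zero .zero .zero .zero .zero (by simp [ht.1]) (by simp)
        (by simp) (by simp), ht.pack hd⟩

end AlmostIotaComplex

/-! ### Sums of multiples of matrix units acting on vectors. -/

section SumSingle

variable {I A : Type} [Fintype I] [DecidableEq I] [Fintype A] {t s : A → I} {c : A → FU}

theorem sum_single_mulVec_apply (v : I → FU) (i : I) :
    ((∑ a, single (t a) (s a) (c a)) *ᵥ v) i = ∑ a, if t a = i then c a * v (s a) else 0 := by
  rw [sum_mulVec, Finset.sum_apply]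
  refine Finset.sum_congr rfl fun a _ => ?_
  rw [single_mulVec]
  by_cases h : t a = i
  · subst h
    simp
  · simp [h, Function.update_of_ne (Ne.symm h)]

theorem sum_single_mulVec_apply_target (ht : Function.Injective t) (v : I → FU) (a : A) :
    ((∑ a, single (t a) (s a) (c a)) *ᵥ v) (t a) = c a * v (s a) := by
  rw [sum_single_mulVec_apply, Finset.sum_eq_single a]
  · rw [if_pos rfl]
  · intro b _ hb
    rw [if_neg fun h => hb (ht h)]
  · simp

theorem sum_single_mulVec_apply_of_ne {i : I} (hi : ∀ a, t a ≠ i) (v : I → FU) :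
    ((∑ a, single (t a) (s a) (c a)) *ᵥ v) i = 0 := by
  rw [sum_single_mulVec_apply]
  exact Finset.sum_eq_zero fun a _ => if_neg (hi a)

theorem sum_single_mulVec_single_source (hs : Function.Injective s) (a : A) :
    (∑ a, single (t a) (s a) (c a)) *ᵥ Pi.single (s a) 1 = c a • Pi.single (t a) 1 := by
  ext1 i
  rw [sum_single_mulVec_apply, Finset.sum_eq_single a]
  · simp [Pi.single_apply, eq_comm]
  · intro b _ hb
    rw [Pi.single_eq_of_ne fun h => hb (hs h)]
    simp
  · simp

theorem sum_single_mulVec_single_of_ne {i : I} (hi : ∀ a, s a ≠ i) :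
    (∑ a, single (t a) (s a) (c a)) *ᵥ Pi.single i 1 = 0 := by
  ext1 j
  rw [sum_single_mulVec_apply]
  refine Finset.sum_eq_zero fun a _ => ?_
  rw [Pi.single_eq_of_ne (hi a)]
  simp

end SumSingle

/-! ### The action of `∂` and `ω` on the generators of a standard complex. -/

namespace StandardParams

variable (L : StandardParams)

theorem omegaSource_injective : Function.Injective L.omegaSource := by
  intro l l' h
  unfold omegaSource t₁ t₀ at h
  apply Fin.ext
  split_ifs at h <;> simp only [Fin.mk.injEq] at h <;> omega

theorem omegaTarget_injective : Function.Injective L.omegaTarget := by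
  intro l l' h
  unfold omegaTarget t₁ t₀ at h
  apply Fin.ext
  split_ifs at h <;> simp only [Fin.mk.injEq] at h <;> omega

/-- The last generator. -/
def tLast : Fin (2 * L.length + 1) := ⟨2 * L.length, by omega⟩

theorem omegaSource_ne_tLast (l : Fin L.length) : L.omegaSource l ≠ L.tLast := by
  unfold omegaSource t₁ t₀ tLast
  have := l.2
  split_ifs <;> simp only [ne_eq, Fin.mk.injEq] <;> omega

/-- The differential pairs all generators except `t_0`; `ω` pairs all except the last one, as in
`cases_omega`. Identities of maps are checked pair by pair. -/
theorem cases_d (i : Fin (2 * L.length + 1)) :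
    i = 0 ∨ ∃ l, i = L.dSource l ∨ i = L.dTarget l := by
  by_cases h0 : i = 0
  · exact Or.inl h0
  have h0' : (i : ℕ) ≠ 0 := fun h => h0 (Fin.ext h)
  have hi := i.2
  refine Or.inr ⟨⟨((i : ℕ) - 1) / 2, by omega⟩, ?_⟩
  unfold dSource dTarget t₁ t₂
  split_ifs <;> simp only [Fin.ext_iff] <;> omega

theorem cases_omega (i : Fin (2 * L.length + 1)) :
    i = L.tLast ∨ ∃ l, i = L.omegaSource l ∨ i = L.omegaTarget l := by
  by_cases h0 : (i : ℕ) = 2 * L.length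
  · exact Or.inl (Fin.ext h0)
  have hi := i.2
  refine Or.inr ⟨⟨(i : ℕ) / 2, by omega⟩, ?_⟩
  unfold omegaSource omegaTarget t₁ t₀
  split_ifs <;> simp only [Fin.ext_iff] <;> omega

theorem d_mulVec_single_dSource (l : Fin L.length) :
    L.d *ᵥ Pi.single (L.dSource l) 1 = (X : FU) ^ (L.b l).natAbs • Pi.single (L.dTarget l) 1 :=
  sum_single_mulVec_single_source L.dSource_injective l

theorem d_mulVec_single_dTarget (l : Fin L.length) : L.d *ᵥ Pi.single (L.dTarget l) 1 = 0 :=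
  sum_single_mulVec_single_of_ne fun l' => L.dSource_ne_dTarget l' l

theorem d_mulVec_single_zero : L.d *ᵥ Pi.single 0 1 = 0 :=
  sum_single_mulVec_single_of_ne L.dSource_ne_zero

theorem d_mulVec_dTarget (v : Fin (2 * L.length + 1) → FU) (l : Fin L.length) :
    (L.d *ᵥ v) (L.dTarget l) = (X : FU) ^ (L.b l).natAbs * v (L.dSource l) :=
  sum_single_mulVec_apply_target L.dTarget_injective v l

theorem omega_mulVec_single_omegaSource (l : Fin L.length) :
    L.omega *ᵥ Pi.single (L.omegaSource l) 1 = Pi.single (L.omegaTarget l) 1 :=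
  (sum_single_mulVec_single_source L.omegaSource_injective l).trans (one_smul _ _)

theorem omega_mulVec_single_omegaTarget (l : Fin L.length) :
    L.omega *ᵥ Pi.single (L.omegaTarget l) 1 = 0 :=
  sum_single_mulVec_single_of_ne fun l' => L.omegaSource_ne_omegaTarget l' l

theorem omega_mulVec_single_tLast : L.omega *ᵥ Pi.single L.tLast 1 = 0 :=
  sum_single_mulVec_single_of_ne L.omegaSource_ne_tLast

theorem omega_mulVec_omegaTarget (v : Fin (2 * L.length + 1) → FU) (l : Fin L.length) :
    (L.omega *ᵥ v) (L.omegaTarget l) = v (L.omegaSource l) :=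
  (sum_single_mulVec_apply_target L.omegaTarget_injective v l).trans (one_mul _)

theorem omega_mulVec_tLast (v : Fin (2 * L.length + 1) → FU) : (L.omega *ᵥ v) L.tLast = 0 := by
  refine sum_single_mulVec_apply_of_ne (fun l => ?_) v
  unfold omegaTarget t₁ t₀ tLast
  have := l.2
  split_ifs <;> simp only [ne_eq, Fin.mk.injEq] <;> omega

theorem gr_cons_of_lt_two (p : ℤˣ × {b : ℤ // b ≠ 0}) (i : Fin (2 * (p :: L).length + 1))
    (hi : (i : ℕ) < 2) : gr (p :: L) i = 0 :=
  Finset.sum_eq_zero fun l _ => if_neg (by omega)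

theorem gr_cons_add_two (p : ℤˣ × {b : ℤ // b ≠ 0}) (i : Fin (2 * L.length + 1)) :
    gr (p :: L) ⟨i + 2, by simp only [List.length_cons]; omega⟩
      = p.2.1.sign - 2 * p.2.1 + L.gr i := by
  unfold gr
  refine (Fin.sum_univ_succ (n := L.length) fun l => if 2 * (l : ℕ) + 2 ≤ (i : ℕ) + 2 then
    (b (p :: L) l).sign - 2 * b (p :: L) l else 0).trans ?_
  refine congrArg₂ (· + ·) ?_ ?_
  · simp [b]
  · refine Finset.sum_congr rfl fun l _ => ?_
    have e : b (p :: L) l.succ = L.b l := rfl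
    rw [e]
    simp only [Fin.val_succ]
    congr 1
    simp only [eq_iff_iff]
    omega

end StandardParams

/-! ### From walks to almost local maps. -/

namespace AlmostIotaComplex

variable {D : AlmostIotaComplex}

/-- Replaces the nested existentials by one sequence, whose terms become the columns of a matrix.
Indexing by `ℕ` avoids casts between the index types of `L` and its tail. -/
theorem Walk.exists_seq {L : StandardParams} {g : ℤ} {x : D.gen → FU} (h : D.Walk L g x) :
    ∃ y : ℕ → D.gen → FU, y 0 = x ∧
      (∀ i : Fin (2 * L.length + 1), IsHomogeneousVec D.gr (g + L.gr i) (y i)) ∧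
      (∀ l : Fin L.length,
        (L.a l = 1 → redU (D.omega *ᵥ y (2 * l + 1)) = redU (y (2 * l))) ∧
        (L.a l = -1 → redU (D.omega *ᵥ y (2 * l)) = redU (y (2 * l + 1))) ∧
        (L.b l < 0 → D.d *ᵥ y (2 * l + 1) = (X : FU) ^ (L.b l).natAbs • y (2 * l + 2)) ∧
        (0 < L.b l → D.d *ᵥ y (2 * l + 2) = (X : FU) ^ (L.b l).natAbs • y (2 * l + 1))) ∧
      redU (D.omega *ᵥ y (2 * L.length)) = 0 := by
  induction L generalizing g x with
  | nil =>
    refine ⟨fun _ => x, rfl, fun i => h.1.congr ?_, fun l => l.elim0, h.2⟩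
    simp [StandardParams.gr]
  | cons p L ih =>
    obtain ⟨h0, x₁, x₂, h1, h2, h3, h4, h5, h6⟩ := h
    obtain ⟨y, hy0, hyg, hyl, hylast⟩ := ih h6
    let z : ℕ → D.gen → FU := fun i => Nat.casesOn i x fun i => Nat.casesOn i x₁ y
    have hz : ∀ i, z (i + 2) = y i := fun i => rfl
    refine ⟨z, rfl, ?_, ?_, hylast⟩
    · rintro ⟨i, hi⟩
      match i, hi with
      | 0, hi =>
        exact h0.congr (by rw [StandardParams.gr_cons_of_lt_two _ _ _ (by simp), add_zero])
      | 1, hi =>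
        exact h1.congr (by rw [StandardParams.gr_cons_of_lt_two _ _ _ (by simp), add_zero])
      | i + 2, hi =>
        have hi' : i < 2 * L.length + 1 := by
          simp only [List.length_cons] at hi
          omega
        refine (hyg ⟨i, hi'⟩).congr ?_
        rw [StandardParams.gr_cons_add_two L p ⟨i, hi'⟩]
        ring
    · intro l
      refine Fin.cases ?_ (fun l => ?_) l
      · refine ⟨h2, h3, fun hb => ?_, fun hb => ?_⟩
        · exact (h4 hb).trans (by rw [← hy0]; rfl)
        · refine Eq.trans ?_ (h5 hb)
          rw [← hy0]
          rfl
      · exact hyl l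

theorem standard_omega (L : StandardParams) :
    (AlmostIotaComplex.standard L).omega
      = (L.omega : Matrix (Fin (2 * L.length + 1)) (Fin (2 * L.length + 1)) FU) := by
  have h : (1 : Matrix (Fin (2 * L.length + 1)) (Fin (2 * L.length + 1)) FU) + (1 + L.omega)
      = L.omega := by
    rw [← add_assoc, FU_matrix_add_self, zero_add]
  exact h

/-- A walk starting at a generator of the tower defines an almost local map. -/
theorem exists_isAlmostLocalMap_of_walk {L : StandardParams} (hD : D.IsReduced) {x : D.gen → FU}
    (h : D.Walk L 0 x) (hx : D.GeneratesTower x) :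
    ∃ f, IsAlmostLocalMap (AlmostIotaComplex.standard L) D f := by
  obtain ⟨y, hy0, hyg, hyl, hylast⟩ := h.exists_seq
  let f : Matrix D.gen (Fin (2 * L.length + 1)) FU := of fun j i => y i j
  have hf : ∀ i, f *ᵥ Pi.single i 1 = y i := fun i => by
    rw [mulVec_single_one]
    rfl
  have hd : ∀ l, D.d *ᵥ y (L.dSource l) = (X : FU) ^ (L.b l).natAbs • y (L.dTarget l) := by
    intro l
    obtain ⟨-, -, h1, h2⟩ := hyl l
    rcases lt_or_gt_of_ne (L.b_ne_zero l) with hb | hb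
    · have hb' : ¬ 0 < L.b l := by omega
      rw [StandardParams.dSource, StandardParams.dTarget, if_neg hb', if_neg hb']
      exact h1 hb
    · rw [StandardParams.dSource, StandardParams.dTarget, if_pos hb, if_pos hb]
      exact h2 hb
  have hω : ∀ l, redU (D.omega *ᵥ y (L.omegaSource l)) = redU (y (L.omegaTarget l)) := by
    intro l
    obtain ⟨h1, h2, -, -⟩ := hyl l
    rcases Int.units_eq_one_or (L.a l) with ha | ha
    · rw [StandardParams.omegaSource, StandardParams.omegaTarget, if_pos ha, if_pos ha]
      exact h1 ha
    · have ha' : ¬ L.a l = 1 := by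
        rw [ha]
        decide
      rw [StandardParams.omegaSource, StandardParams.omegaTarget, if_neg ha', if_neg ha']
      exact h2 ha
  have hchain : f * L.d = D.d * f := by
    refine ext_of_mulVec_single fun i => ?_
    rw [← mulVec_mulVec, ← mulVec_mulVec, hf]
    rcases L.cases_d i with rfl | ⟨l, rfl | rfl⟩
    · rw [L.d_mulVec_single_zero, mulVec_zero, Fin.val_zero, hy0, hx.1]
    · rw [L.d_mulVec_single_dSource, mulVec_smul, hf, hd]
    · rw [L.d_mulVec_single_dTarget, mulVec_zero, D.d_eq_zero_of_eq (hd l)]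
  -- Since `f` commutes with `ω` modulo `U` on the nose, the zero homotopy suffices below.
  have hred : ∀ i, redU ((D.omega * f) *ᵥ Pi.single i 1) = redU ((f * L.omega) *ᵥ Pi.single i 1) := by
    intro i
    rw [← mulVec_mulVec, ← mulVec_mulVec, hf]
    rcases L.cases_omega i with rfl | ⟨l, rfl | rfl⟩
    · rw [L.omega_mulVec_single_tLast, mulVec_zero, map_zero]
      exact hylast
    · rw [L.omega_mulVec_single_omegaSource, hf, hω]
    · rw [L.omega_mulVec_single_omegaTarget, mulVec_zero, map_zero, hD.redU_omega_of_eq (hω l)]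
  choose e he using fun i => redU_eq_iff.1 (hred i)
  have hE : f * L.iota + D.iota * f + (0 : Matrix D.gen (Fin (2 * L.length + 1)) FU) * L.d
      + D.d * (0 : Matrix D.gen (Fin (2 * L.length + 1)) FU) = (X : FU) • of fun j i => e i j := by
    have h1 : f * L.iota + D.iota * f = D.omega * f + f * L.omega := by
      rw [StandardParams.iota, omega, Matrix.mul_add, Matrix.add_mul, Matrix.mul_one, Matrix.one_mul]
      abel
    rw [h1, Matrix.zero_mul, Matrix.mul_zero, add_zero, add_zero]
    refine ext_of_mulVec_single fun i => ?_
    rw [add_mulVec, he, smul_mulVec, mulVec_single_one]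
    rfl
  obtain ⟨-, κ, _, _, _, t, N, hN⟩ := hx
  refine ⟨f, ?_, hchain, ⟨0, _, IsHomogeneousMap.zero, hE⟩, ?_⟩
  · intro j i n hn
    have := hyg i j n hn
    rw [this]
    exact (add_comm _ _)
  · refine (GradedComplex.bijective_locHomologyMap_iff hchain
      (GradedComplex.standardSplitting L) t).2 ⟨N, ?_⟩
    have h1 : (t.p * f * (single 0 () 1 : Matrix (Fin (2 * L.length + 1)) Unit FU)) default ()
        = (t.p *ᵥ x) default := by
      rw [Matrix.mul_assoc]
      have h2 : f * (single 0 () 1 : Matrix (Fin (2 * L.length + 1)) Unit FU)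
          = of fun j _ => x j := by
        ext1 j u
        rw [← hy0]
        simp [mul_apply, single_apply, f]
      rw [h2]
      rfl
    exact (dvd_of_eq h1).trans hN

end AlmostIotaComplex

/-! ### Comparison of standard complexes -/

namespace StandardParams

/-- The strict order `-1 < -2 < ⋯ < 2 < 1` on nonzero integers. -/
def ParamLT (b b' : ℤ) : Prop := (b < 0 ∧ 0 < b') ∨ (b < 0 ∧ b' < 0 ∧ b' < b) ∨ (0 < b' ∧ b' < b)

/-- The lexicographic order on parameter sequences. -/
def LexLE : StandardParams → StandardParams → Prop
  | [], [] => True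
  -- The end of a sequence ranks strictly between the signs `-` and `+`.
  | [], q :: _ => q.1 = 1
  | p :: _, [] => p.1 = -1
  | p :: L, q :: M => (p.1 = -1 ∧ q.1 = 1) ∨
      (p.1 = q.1 ∧ (ParamLT p.2.1 q.2.1 ∨ (p.2.1 = q.2.1 ∧ LexLE L M)))

theorem LexLE.antisymm {L M : StandardParams} (h : LexLE L M) (h' : LexLE M L) : L = M := by
  induction L generalizing M with
  | nil =>
    cases M with
    | nil => rfl
    | cons q M => exact absurd (h.symm.trans h') (by decide)
  | cons p L ih =>
    cases M with
    | nil => exact absurd (h'.symm.trans h) (by decide)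
    | cons q M =>
      obtain ⟨a, b, hb⟩ := p
      obtain ⟨a', b', hb'⟩ := q
      simp only [LexLE, ParamLT] at h h'
      have hne : (1 : ℤˣ) ≠ -1 := by decide
      rcases h with ⟨rfl, rfl⟩ | ⟨rfl, h⟩
      · simp [hne, hne.symm] at h'
      · have h'' : ParamLT b' b ∨ b' = b ∧ LexLE M L := by
          rcases h' with ⟨h1, h2⟩ | ⟨-, h'⟩
          · exact absurd (h2.symm.trans h1) hne
          · exact h'
        rcases h with h | ⟨rfl, h⟩
        · rcases h'' with h'' | ⟨h'', -⟩ <;> unfold ParamLT at * <;> omega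
        · rcases h'' with h'' | ⟨-, h''⟩
          · unfold ParamLT at h''
            omega
          · rw [ih h h'']

/-- The right side has a nonzero coefficient in degree `n`, while the left side has none below
degree `m`. -/
theorem le_of_X_pow_mul_eq {p q : FU} {m n : ℕ} (h : X ^ m * p = X ^ n * q) (hq : q.coeff 0 ≠ 0) :
    m ≤ n := by
  by_contra hlt
  push Not at hlt
  have h1 := congrArg (fun r => r.coeff n) h
  simp only [coeff_X_pow_mul', le_refl, if_true, Nat.sub_self] at h1
  rw [if_neg (by omega)] at h1
  exact hq h1.symm

variable {L L' : StandardParams}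
  {f : Matrix (Fin (2 * L'.length + 1)) (Fin (2 * L.length + 1)) FU}

/-- If `f` maps `t_{2p}` to `t'_{2p}` with a nonzero constant coefficient, the next parameters
either agree and pass such a coefficient on to `t_{2p+2}`, or differ in the direction allowed by the
order. The induction is on the number `k` of pairs of `L` that remain. -/
theorem lexLE_drop (hchain : f * L.d = L'.d * f)
    (hω : ∀ v, redU (f *ᵥ (L.omega *ᵥ v)) = redU (L'.omega *ᵥ (f *ᵥ v))) (k p : ℕ)
    (hp : p + k = L.length) (hp' : p ≤ L'.length)
    (h : (f ⟨2 * p, by omega⟩ ⟨2 * p, by omega⟩).coeff 0 ≠ 0) :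
    LexLE (L.drop p) (L'.drop p) := by
  have hcol : ∀ i j, (f *ᵥ Pi.single i 1) j = f j i := fun i j => by
    rw [mulVec_single_one]
    rfl
  have hd : ∀ v, f *ᵥ (L.d *ᵥ v) = L'.d *ᵥ (f *ᵥ v) := fun v => by
    rw [mulVec_mulVec, hchain, mulVec_mulVec]
  induction k generalizing p with
  | zero =>
    have hL : L.drop p = [] := List.drop_eq_nil_of_le (by omega)
    rw [hL]
    rcases hp'.lt_or_eq with hlt | rfl
    · rw [List.drop_eq_getElem_cons hlt]
      change (L'.a ⟨p, hlt⟩ = 1)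
      -- With sign `-`, `ω` would be nonzero on `t'_{2p}`, and hence modulo `U` on the image of the
      -- last generator of `L`, which `ω` kills.
      by_contra ha
      have h1 := congrFun (hω (Pi.single L.tLast 1)) (L'.omegaTarget ⟨p, hlt⟩)
      rw [omega_mulVec_single_tLast, mulVec_zero, map_zero, redU_apply, omega_mulVec_omegaTarget,
        hcol] at h1
      have e1 : L'.omegaSource ⟨p, hlt⟩ = ⟨2 * p, by omega⟩ := by
        rw [omegaSource, if_neg ha]
        rfl
      have e2 : L.tLast = ⟨2 * p, by omega⟩ := by
        unfold tLast
        apply Fin.ext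
        simp only
        omega
      rw [e1, e2] at h1
      exact h h1.symm
    · rw [List.drop_eq_nil_of_le le_rfl]
      trivial
  | succ k ih =>
    have hlt : p < L.length := by omega
    rw [List.drop_eq_getElem_cons hlt]
    have e1 : L.t₀ ⟨p, hlt⟩ = ⟨2 * p, by omega⟩ := rfl
    rcases hp'.lt_or_eq with hlt' | rfl
    · rw [List.drop_eq_getElem_cons hlt']
      have e2 : L'.t₀ ⟨p, hlt'⟩ = ⟨2 * p, by omega⟩ := rfl
      have hb0 := L.b_ne_zero ⟨p, hlt⟩
      have hb0' := L'.b_ne_zero ⟨p, hlt'⟩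
      change (L.a ⟨p, hlt⟩ = -1 ∧ L'.a ⟨p, hlt'⟩ = 1) ∨ (L.a ⟨p, hlt⟩ = L'.a ⟨p, hlt'⟩ ∧
        (ParamLT (L.b ⟨p, hlt⟩) (L'.b ⟨p, hlt'⟩) ∨ (L.b ⟨p, hlt⟩ = L'.b ⟨p, hlt'⟩ ∧
          LexLE (L.drop (p + 1)) (L'.drop (p + 1)))))
      have ih' := ih (p + 1) (by omega) (by omega)
      have e3 : L.t₂ ⟨p, hlt⟩ = ⟨2 * (p + 1), by omega⟩ := rfl
      have e4 : L'.t₂ ⟨p, hlt'⟩ = ⟨2 * (p + 1), by omega⟩ := rfl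
      rw [← e3, ← e4] at ih'
      rw [← e1, ← e2] at h
      generalize (⟨p, hlt⟩ : Fin L.length) = l at *
      generalize (⟨p, hlt'⟩ : Fin L'.length) = l' at *
      have ω1 := congrFun (hω (Pi.single (L.omegaSource l) 1)) (L'.omegaTarget l')
      rw [omega_mulVec_single_omegaSource, redU_apply, redU_apply, omega_mulVec_omegaTarget, hcol,
        hcol] at ω1
      have ω2 := congrFun (hω (Pi.single (L.omegaTarget l) 1)) (L'.omegaTarget l')
      rw [omega_mulVec_single_omegaTarget, mulVec_zero, map_zero, redU_apply,
        omega_mulVec_omegaTarget, hcol] at ω2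
      have d1 := congrFun (hd (Pi.single (L.dSource l) 1)) (L'.dTarget l')
      rw [d_mulVec_single_dSource, mulVec_smul, d_mulVec_dTarget, Pi.smul_apply, hcol, hcol,
        smul_eq_mul] at d1
      have d2 := congrFun (hd (Pi.single (L.dTarget l) 1)) (L'.dTarget l')
      rw [d_mulVec_single_dTarget, mulVec_zero, d_mulVec_dTarget, hcol, Pi.zero_apply, eq_comm,
        mul_eq_zero, or_iff_right (pow_ne_zero _ X_ne_zero)] at d2
      -- Once the signs agree and the coefficient has reached the odd generators, only the exponents
      -- of `∂` remain to be compared.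
      have key : L.a l = L'.a l' → (f (L'.t₁ l') (L.t₁ l)).coeff 0 ≠ 0 → (L.a l = -1 ∧ L'.a l' = 1) ∨
          (L.a l = L'.a l' ∧ (ParamLT (L.b l) (L'.b l') ∨ (L.b l = L'.b l' ∧
          LexLE (L.drop (p + 1)) (L'.drop (p + 1))))) := by
        intro ha h1
        refine Or.inr ⟨ha, ?_⟩
        unfold dSource dTarget at d1 d2
        unfold ParamLT
        rcases lt_or_gt_of_ne hb0 with hb | hb <;> rcases lt_or_gt_of_ne hb0' with hb' | hb'
        · rw [if_neg (by omega), if_neg (by omega), if_neg (by omega), if_neg (by omega)] at d1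
          have hle := le_of_X_pow_mul_eq d1 h1
          by_cases heq : L.b l = L'.b l'
          · rw [heq] at d1
            refine Or.inr ⟨heq, ih' ?_⟩
            rw [mul_left_cancel₀ (pow_ne_zero _ X_ne_zero) d1]
            exact h1
          · omega
        · exact Or.inl (Or.inl ⟨hb, hb'⟩)
        -- For `b > 0 > b'` a `U`-power multiple of `t_{2p+1}` is a boundary, so its image is a
        -- cycle and cannot involve `t'_{2p+1}`, on which `∂` is nonzero.
        · rw [if_neg (by omega), if_pos hb] at d2
          rw [d2] at h1
          exact absurd (coeff_zero 0) h1
        · rw [if_pos hb, if_pos hb, if_pos hb', if_pos hb'] at d1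
          have hle := le_of_X_pow_mul_eq d1.symm h1
          by_cases heq : L.b l = L'.b l'
          · rw [heq] at d1
            refine Or.inr ⟨heq, ih' ?_⟩
            rw [← mul_left_cancel₀ (pow_ne_zero _ X_ne_zero) d1]
            exact h1
          · omega
      unfold omegaSource omegaTarget at ω1 ω2
      rcases Int.units_eq_one_or (L.a l) with ha | ha <;>
        rcases Int.units_eq_one_or (L'.a l') with ha' | ha' <;>
        simp only [ha, ha', if_true, if_neg (show ¬ (-1 : ℤˣ) = 1 by decide)] at ω1 ω2
      · exact key (by rw [ha, ha']) (by rw [← ω1]; exact h)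
      -- Signs `+` and `-`: `t_{2p}` lies in the image of `ω` and is killed by it, whereas `ω` maps
      -- `t'_{2p}` to `t'_{2p+1}`.
      · exact absurd ω2.symm h
      · exact Or.inl ⟨ha, ha'⟩
      · exact key (by rw [ha, ha']) (by rw [ω1]; exact h)
    · rw [List.drop_eq_nil_of_le le_rfl]
      change L.a ⟨L'.length, hlt⟩ = -1
      by_contra ha
      have ha' : L.a ⟨L'.length, hlt⟩ = 1 := (Int.units_eq_one_or _).resolve_right ha
      have h1 := congrFun (hω (Pi.single (L.omegaSource ⟨L'.length, hlt⟩) 1)) L'.tLast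
      rw [omega_mulVec_single_omegaSource, redU_apply, redU_apply, omega_mulVec_tLast, hcol,
        omegaTarget, if_pos ha'] at h1
      exact h h1

end StandardParams

/-- Between reduced complexes the homotopy terms are multiples of `U`, so commuting up to homotopy
modulo `U` becomes commuting modulo `U`. -/
theorem IsAlmostLocalMap.redU_omega {C D : AlmostIotaComplex} {f : Matrix D.gen C.gen FU}
    (hf : IsAlmostLocalMap C D f) (hC : C.IsReduced) (hD : D.IsReduced) (v : C.gen → FU) :
    redU (f *ᵥ (C.omega *ᵥ v)) = redU (D.omega *ᵥ (f *ᵥ v)) := by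
  obtain ⟨E, hE⟩ := hC
  obtain ⟨E', hE'⟩ := hD
  obtain ⟨H, G, -, h⟩ := hf.iota
  rw [redU_eq_iff]
  have h1 : f * C.omega + D.omega * f = (X : FU) • (G + H * E + E' * H) := by
    rw [smul_add, smul_add, ← h, ← Matrix.mul_smul, ← Matrix.smul_mul, ← hE, ← hE',
      AlmostIotaComplex.omega, AlmostIotaComplex.omega, Matrix.mul_add, Matrix.add_mul,
      Matrix.mul_one, Matrix.one_mul]
    refine FU_matrix_eq_of_eq_add f ?_
    refine (FU_matrix_eq_of_eq_add (H * C.d + D.d * H) ?_).symm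
    abel
  refine ⟨(G + H * E + E' * H) *ᵥ v, ?_⟩
  rw [mulVec_mulVec, mulVec_mulVec, ← add_mulVec, h1, smul_mulVec]

/-- The towers are generated by the two copies of `t_0`, so an almost local map has a nonzero
coefficient between them, which starts the propagation in `lexLE_drop`. -/
theorem IsAlmostLocalMap.lexLE {L L' : StandardParams}
    {f : Matrix (Fin (2 * L'.length + 1)) (Fin (2 * L.length + 1)) FU}
    (hf : IsAlmostLocalMap (AlmostIotaComplex.standard L) (AlmostIotaComplex.standard L') f) :
    StandardParams.LexLE L L' := by
  have hω := hf.redU_omega (AlmostIotaComplex.isReduced_standard L)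
    (AlmostIotaComplex.isReduced_standard L')
  rw [AlmostIotaComplex.standard_omega, AlmostIotaComplex.standard_omega] at hω
  have h0 : f 0 0 ≠ 0 := by
    obtain ⟨N, hN⟩ := (GradedComplex.bijective_locHomologyMap_iff hf.chain
      (GradedComplex.standardSplitting L) (GradedComplex.standardSplitting L')).1 hf.loc
    intro h0
    have h1 : ((single () 0 (X ^ ∑ l, (L'.b l).natAbs) : Matrix Unit (Fin (2 * L'.length + 1)) FU)
        * f * (single 0 () 1 : Matrix (Fin (2 * L.length + 1)) Unit FU)) () () = 0 := by
      simp [mul_apply, single_apply, h0]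
    have h2 : (0 : FU) ∣ X ^ N := (dvd_of_eq h1.symm).trans hN
    exact pow_ne_zero N X_ne_zero (zero_dvd_iff.1 h2)
  -- Both copies of `t_0` have grading zero and `f` preserves gradings, so the nonzero entry is a
  -- constant.
  have h0' : (f 0 0).coeff 0 ≠ 0 := by
    obtain ⟨n, hn⟩ : ∃ n, (f 0 0).coeff n ≠ 0 := by
      by_contra hcon
      push Not at hcon
      exact h0 (Polynomial.ext hcon)
    have h1 : L'.gr 0 - 2 * (n : ℤ) = L.gr 0 + 0 := 
      hf.hom (0 : Fin (2 * L'.length + 1)) (0 : Fin (2 * L.length + 1)) n hn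
    rw [StandardParams.gr_zero, StandardParams.gr_zero] at h1
    have : n = 0 := by omega
    rwa [this] at hn
  simpa using StandardParams.lexLE_drop hf.chain hω L.length 0 (by omega) (by omega) h0'

theorem AlmostLocallyEquivalent.standardParams_eq {L L' : StandardParams}
    (h : AlmostLocallyEquivalent (AlmostIotaComplex.standard L) (AlmostIotaComplex.standard L')) :
    L = L' := by
  obtain ⟨⟨f, hf⟩, ⟨g, hg⟩⟩ := h
  exact (IsAlmostLocalMap.lexLE hf).antisymm (IsAlmostLocalMap.lexLE hg)

/-! ### Duals of standard complexes -/

namespace StandardParams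

/-- The parameters of the dual standard complex. -/
def neg (L : StandardParams) : StandardParams :=
  L.map fun p => (-p.1, ⟨-p.2.1, neg_ne_zero.2 p.2.2⟩)

theorem neg_neg (L : StandardParams) : L.neg.neg = L := by
  simp only [neg, List.map_map]
  conv_rhs => rw [← List.map_id L]
  refine List.map_congr_left fun p _ => ?_
  simp

theorem length_neg (L : StandardParams) : L.neg.length = L.length := List.length_map _

variable (L : StandardParams)

/-- The identification of the pairs of generators of a standard complex and its dual. -/
def negIndex : Fin L.length ≃ Fin L.neg.length := finCongr L.length_neg.symm

/-- The identification of the generators of a standard complex and its dual. -/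
def negGen : Fin (2 * L.length + 1) ≃ Fin (2 * L.neg.length + 1) :=
  finCongr (by rw [length_neg])

theorem neg_b (l : Fin L.length) : L.neg.b (L.negIndex l) = -L.b l := by
  simp [b, neg, negIndex]
  rfl

theorem neg_a (l : Fin L.length) : L.neg.a (L.negIndex l) = -L.a l := by
  simp [a, neg, negIndex]
  rfl

theorem neg_dSource (l : Fin L.length) : L.neg.dSource (L.negIndex l) = L.negGen (L.dTarget l) := by
  have := L.b_ne_zero l
  unfold dSource dTarget
  rw [neg_b]
  split_ifs <;> first | rfl | omega

theorem neg_dTarget (l : Fin L.length) : L.neg.dTarget (L.negIndex l) = L.negGen (L.dSource l) := by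
  have := L.b_ne_zero l
  unfold dSource dTarget
  rw [neg_b]
  split_ifs <;> first | rfl | omega

theorem neg_omegaSource (l : Fin L.length) :
    L.neg.omegaSource (L.negIndex l) = L.negGen (L.omegaTarget l) := by
  unfold omegaSource omegaTarget
  rw [neg_a]
  rcases Int.units_eq_one_or (L.a l) with h | h <;> rw [h] <;> rfl

theorem neg_omegaTarget (l : Fin L.length) :
    L.neg.omegaTarget (L.negIndex l) = L.negGen (L.omegaSource l) := by
  unfold omegaSource omegaTarget
  rw [neg_a]
  rcases Int.units_eq_one_or (L.a l) with h | h <;> rw [h] <;> rfl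

theorem neg_gr (i : Fin (2 * L.length + 1)) : L.neg.gr (L.negGen i) = -L.gr i := by
  unfold gr
  rw [← Finset.sum_neg_distrib]
  refine (Fintype.sum_equiv L.negIndex _ _ fun l => ?_).symm
  rw [neg_b]
  change -(if 2 * (l : ℕ) + 2 ≤ (i : ℕ) then _ else _) = if 2 * (l : ℕ) + 2 ≤ (i : ℕ) then _ else _
  split_ifs
  · rw [Int.sign_neg]
    ring
  · simp

theorem neg_d (i j : Fin (2 * L.length + 1)) : L.neg.d (L.negGen i) (L.negGen j) = L.d j i := by
  unfold d
  rw [Matrix.sum_apply, Matrix.sum_apply]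
  refine (Fintype.sum_equiv L.negIndex _ _ fun l => ?_).symm
  rw [single_apply, single_apply, neg_dSource, neg_dTarget, neg_b, Int.natAbs_neg]
  simp only [L.negGen.apply_eq_iff_eq, and_comm]

theorem neg_iota (i j : Fin (2 * L.length + 1)) :
    L.neg.iota (L.negGen i) (L.negGen j) = L.iota j i := by
  have h : L.neg.omega (L.negGen i) (L.negGen j) = L.omega j i := by
    unfold omega
    rw [Matrix.sum_apply, Matrix.sum_apply]
    refine (Fintype.sum_equiv L.negIndex _ _ fun l => ?_).symm
    rw [single_apply, single_apply, neg_omegaSource, neg_omegaTarget]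
    simp only [L.negGen.apply_eq_iff_eq, and_comm]
  have h1 : (1 : Matrix (Fin (2 * L.neg.length + 1)) (Fin (2 * L.neg.length + 1)) FU)
      (L.negGen i) (L.negGen j)
        = (1 : Matrix (Fin (2 * L.length + 1)) (Fin (2 * L.length + 1)) FU) j i := by
    simp only [one_apply, L.negGen.apply_eq_iff_eq, eq_comm]
  exact congrArg₂ (· + ·) h1 h

end StandardParams

/-- Transposing exchanges the sources and targets of all arrows, which is exactly what changing
every sign in the parameter sequence does. -/
theorem AlmostLocallyEquivalent.standard_dual (L : StandardParams) :
    AlmostLocallyEquivalent (AlmostIotaComplex.standard L).dual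
      (AlmostIotaComplex.standard L.neg) :=
  of_equiv (C := (AlmostIotaComplex.standard L).dual) L.negGen L.neg_gr L.neg_d L.neg_iota

/-! ### Standard representatives of fully simplified sums. -/

namespace AlmostLocalGroup

theorem mk_standard_neg (L : StandardParams) :
    mk (AlmostIotaComplex.standard L.neg) = -mk (AlmostIotaComplex.standard L) :=
  (Quotient.sound (AlmostLocallyEquivalent.standard_dual L)).symm

theorem neg_boxParams (ε : ℤˣ) (n : ℕ+) : (boxParams ε n).neg = boxParams (-ε) n := by
  simp [StandardParams.neg, boxParams]

theorem mk_boxParams (ε : ℤˣ) (n : ℕ+) :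
    mk (AlmostIotaComplex.standard (boxParams ε n)) = (ε : ℤ) • mk (boxComplex n) := by
  rcases Int.units_eq_one_or ε with rfl | rfl
  · rw [Units.val_one, one_smul]
    rfl
  · rw [← neg_boxParams, mk_standard_neg, Units.val_neg, Units.val_one, neg_smul, one_smul]
    rfl

open AlmostIotaComplex

theorem mk_boxTensorList (l : List (ℤˣ × ℕ+)) :
    mk (boxTensorList l) = (l.map fun p => (p.1 : ℤ) • mk (boxComplex p.2)).sum := by
  induction l with
  | nil => rfl
  | cons p l ih =>
    rw [List.map_cons, List.sum_cons, ← ih, ← mk_boxParams]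
    rfl

/-- The negatives of a list of complexes `± C(n)`. -/
def negList (l : List (ℤˣ × ℕ+)) : List (ℤˣ × ℕ+) := l.map fun p => (-p.1, p.2)

theorem boxList_negList (l : List (ℤˣ × ℕ+)) : boxList (negList l) = (boxList l).neg := by
  induction l with
  | nil => rfl
  | cons p l ih =>
    rw [boxList_cons, StandardParams.neg, List.map_append]
    change boxParams (-p.1) p.2 ++ boxList (negList l) = (boxParams p.1 p.2).neg ++ (boxList l).neg
    rw [ih, neg_boxParams]

theorem mk_boxTensorList_negList (l : List (ℤˣ × ℕ+)) :
    mk (boxTensorList (negList l)) = -mk (boxTensorList l) := by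
  rw [mk_boxTensorList, mk_boxTensorList]
  induction l with
  | nil => exact neg_zero.symm
  | cons p l ih =>
    rw [negList, List.map_cons, List.map_cons, List.map_cons, List.sum_cons, List.sum_cons, neg_add,
      ← ih, Units.val_neg, neg_smul]
    rfl

theorem fullySimplified_negList {l : List (ℤˣ × ℕ+)} (hl : FullySimplified l) :
    FullySimplified (negList l) := by
  refine ⟨?_, ?_⟩
  · intro p hp
    obtain ⟨q, hq, rfl⟩ := List.mem_map.1 hp
    exact hl.1 q hq
  · refine List.pairwise_map.2 (hl.2.imp fun {p q} h => ⟨h.1, fun e => ?_⟩)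
    rw [h.2 e]

/-- Walks only give maps out of standard complexes. Full simplification is preserved by negation, so
the walk for the negated list exists too; its dual is a map into the standard complex of `l`. -/
theorem mk_standard_boxList {l : List (ℤˣ × ℕ+)} (hl : FullySimplified l) :
    mk (standard (boxList l)) = (l.map fun p => (p.1 : ℤ) • mk (boxComplex p.2)).sum := by
  have hmap : ∀ {l : List (ℤˣ × ℕ+)}, FullySimplified l →
      ∃ f, IsAlmostLocalMap (standard (boxList l)) (boxTensorList l) f := fun {l} hl => by
    obtain ⟨x, hx, hx'⟩ := exists_walk_boxTensorList hl
    exact exists_isAlmostLocalMap_of_walk (isReduced_boxTensorList l) hx hx'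
  rw [← mk_boxTensorList]
  refine Quotient.sound ⟨hmap hl, ?_⟩
  obtain ⟨g, hg⟩ := hmap (fullySimplified_negList hl)
  have h1 : AlmostLocallyEquivalent (boxTensorList l) (boxTensorList (negList l)).dual := by
    refine Quotient.exact (s := almostLocalSetoid) ?_
    change mk (boxTensorList l) = -mk (boxTensorList (negList l))
    rw [mk_boxTensorList_negList, _root_.neg_neg]
  have h2 := AlmostLocallyEquivalent.standard_dual (boxList (negList l))
  rw [boxList_negList, StandardParams.neg_neg, ← boxList_negList] at h2
  obtain ⟨f₁, hf₁⟩ := h1.1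
  obtain ⟨f₂, hf₂⟩ := h2.1
  -- The composite runs from the tensor product to the dual of the negated one, then by the dual of
  -- `g` to the dual of the negated standard complex, then to the standard complex of `l`.
  exact ⟨_, hf₂.comp (hg.dual.comp hf₁)⟩

theorem isStandardRepresentative_boxList {l : List (ℤˣ × ℕ+)} (hl : FullySimplified l) :
    IsStandardRepresentative (l.map fun p => (p.1 : ℤ) • mk (boxComplex p.2)).sum (boxList l) := by
  refine ⟨mk_standard_boxList hl, fun L' hL' => ?_⟩
  refine AlmostLocallyEquivalent.standardParams_eq (Quotient.exact (s := almostLocalSetoid) ?_)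
  exact hL'.trans (mk_standard_boxList hl).symm

/-- The empty sequence represents zero, so by uniqueness the concatenated sequence is empty; every
box contributes two pairs, so there are no boxes. -/
theorem list_eq_nil_of_sum_eq_zero {l : List (ℤˣ × ℕ+)} (hl : FullySimplified l)
    (h : (l.map fun p => (p.1 : ℤ) • mk (boxComplex p.2)).sum = 0) : l = [] := by
  have h1 : mk (standard []) = 0 := mk_standard_boxList (l := []) ⟨by simp, by simp⟩
  have h2 := (isStandardRepresentative_boxList hl).2 [] (h1.trans h.symm)
  cases l with
  | nil => rfl
  | cons p l => exact absurd h2 (by simp [boxParams])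

end AlmostLocalGroup

/-! ### Linear independence and the free subgroup of infinite rank. -/

namespace AlmostLocalGroup

open AlmostIotaComplex

/-- The list of complexes `± C(n)` representing an integral linear combination, ordered by
decreasing `n`. -/
def finsuppList (c : {n : ℕ+ // 1 < n} →₀ ℤ) : List (ℤˣ × ℕ+) :=
  (c.support.sort (· ≥ ·)).flatMap fun n =>
    -- All copies of a given `n` carry the same sign, which makes the list fully simplified; for `c
    -- n = 0` the default sign `-1` is never used.
    List.replicate (c n).natAbs (if 0 < c n then 1 else -1, n.1)

theorem fullySimplified_finsuppList (c : {n : ℕ+ // 1 < n} →₀ ℤ) :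
    FullySimplified (finsuppList c) := by
  constructor
  · intro p hp
    obtain ⟨n, -, hn⟩ := List.mem_flatMap.1 hp
    rw [List.eq_of_mem_replicate hn]
    exact n.2
  · refine List.pairwise_flatMap.2
      ⟨fun n _ => List.pairwise_replicate.2 (Or.inr ⟨le_rfl, fun _ => rfl⟩),
      (Finset.sortedGT_sort c.support).pairwise.imp fun {n n'} hlt p hp q hq => ?_⟩
    rw [List.eq_of_mem_replicate hp, List.eq_of_mem_replicate hq]
    have hlt' : n'.1 < n.1 := hlt
    exact ⟨hlt'.le, fun h => absurd h hlt'.ne'⟩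

theorem sum_finsuppList (c : {n : ℕ+ // 1 < n} →₀ ℤ) :
    ((finsuppList c).map fun p => (p.1 : ℤ) • mk (boxComplex p.2)).sum
      = c.sum fun n z => z • mk (boxComplex n) := by
  -- Stated for an arbitrary list so that induction applies; the sorted support is substituted
  -- afterwards.
  have h1 : ∀ l : List {n : ℕ+ // 1 < n}, ((l.flatMap fun n =>
      List.replicate (c n).natAbs ((if 0 < c n then 1 else -1 : ℤˣ), n.1)).map
        fun p => (p.1 : ℤ) • mk (boxComplex p.2)).sum
      = (l.map fun n => c n • mk (boxComplex n)).sum := by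
    intro l
    induction l with
    | nil => rfl
    | cons n l ih =>
      rw [List.flatMap_cons, List.map_append, List.sum_append, ih, List.map_cons, List.sum_cons,
        List.map_replicate, List.sum_replicate, ← natCast_zsmul, smul_smul]
      congr 2
      split_ifs with h
      · rw [Units.val_one]
        omega
      · rw [Units.val_neg, Units.val_one]
        omega
  rw [finsuppList, h1, Finsupp.sum, ← Finset.sum_map_val, ← Finset.sort_eq c.support (· ≥ ·),
    Multiset.map_coe, Multiset.sum_coe]

/-- A relation is the sum over a fully simplified list, which must then be empty; a nonzero
coefficient would contribute at least one copy to it. -/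
theorem linearIndependent_boxComplex : LinearIndependent ℤ
    (fun n : {n : ℕ+ // 1 < n} => mk (boxComplex n)) := by
  rw [linearIndependent_iff]
  intro c hc
  rw [Finsupp.linearCombination_apply, ← sum_finsuppList] at hc
  have h := list_eq_nil_of_sum_eq_zero (fullySimplified_finsuppList c) hc
  rw [finsuppList, List.flatMap_eq_nil_iff] at h
  ext n
  by_contra hn
  have hn' : c n ≠ 0 := hn
  have := h n ((Finset.mem_sort _).2 (Finsupp.mem_support_iff.2 hn'))
  rw [List.replicate_eq_nil_iff] at this
  omega

theorem nonempty_closure_equiv : Nonempty (AddSubgroup.closure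
    (Set.range fun n : {n : ℕ+ // 1 < n} => mk (boxComplex n)) ≃+ (ℕ →₀ ℤ)) := by
  have : Infinite {n : ℕ+ // 1 < n} := by
    refine Infinite.of_injective (fun k : ℕ => ⟨⟨k + 2, by omega⟩, ?_⟩) fun a b h => ?_
    · change 1 < k + 2
      omega
    · have h' : a + 2 = b + 2 := congrArg (fun n : {n : ℕ+ // 1 < n} => ((n : ℕ+) : ℕ)) h
      omega
  obtain ⟨e⟩ := nonempty_equiv_of_countable (α := {n : ℕ+ // 1 < n}) (β := ℕ)
  have h := linearIndependent_boxComplex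
  rw [← Submodule.span_int_eq_addSubgroupClosure]
  -- A linearly independent family is a basis of its span; the index set is countably infinite and
  -- is renumbered by `ℕ`.
  exact ⟨(h.linearCombinationEquiv.symm.trans (Finsupp.domLCongr (R := ℤ) (M := ℤ) e)).toAddEquiv⟩

end AlmostLocalGroup

end

/-- Standard representatives of fully simplified sums of the classes `± C(n)`, and the resulting
free abelian subgroup of infinite rank. -/
theorem theorem4p1 :
    (∀ (m : ℕ) (ε : Fin m → ℤˣ) (n : Fin m → ℕ+),
      Antitone n → (∀ i, 1 < n i) → (∀ i j, n i = n j → ε i = ε j) →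
      IsStandardRepresentative
        (∑ i, (ε i : ℤ) • AlmostLocalGroup.mk (boxComplex (n i)))
        (List.ofFn fun i => boxParams (ε i) (n i)).flatten) ∧
    LinearIndependent ℤ
      (fun n : {n : ℕ+ // 1 < n} => AlmostLocalGroup.mk (boxComplex n)) ∧
    Nonempty (AddSubgroup.closure
      (Set.range fun n : {n : ℕ+ // 1 < n} => AlmostLocalGroup.mk (boxComplex n)) ≃+ (ℕ →₀ ℤ)) := by
  refine ⟨fun m ε n hn h1 hε => ?_, AlmostLocalGroup.linearIndependent_boxComplex,
    AlmostLocalGroup.nonempty_closure_equiv⟩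
  have hl : AlmostIotaComplex.FullySimplified (List.ofFn fun i => (ε i, n i)) := by
    constructor
    · intro p hp
      obtain ⟨i, rfl⟩ := (List.mem_ofFn' _ _).1 hp
      exact h1 i
    · exact List.pairwise_ofFn.2 fun i j hij => ⟨hn hij.le, hε i j⟩
  have h := AlmostLocalGroup.isStandardRepresentative_boxList hl
  rw [List.map_ofFn, List.sum_ofFn, AlmostIotaComplex.boxList, List.flatMap_def, List.map_ofFn] at h
  exact h
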